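/- Fix $0<\alpha\le\beta<1$, $A>0$, $B>0$, $T>0$. Let $\sigma(a)=a(1-a)$ and, for $0<\varrho<1$, $D>0$, $a\in[0,1]$, $M\in\mathbb R$, $$\mathfrak p_{\varrho,D}(a,M)=\frac1D\big\{(1-a)\,\varrho\, e^{M}-a\,(1-\varrho)\,e^{-M}\big\}.$$ Write $\nabla$ for the space derivative. Let $C^{m,n}([0,T]\times[0,1])$ be the space of functions with $m$ derivatives in time and $n$ derivatives in space that are continuous up to the boundary, and let $\mathcal H^1$ be the Sobolev space of functions in $L^2([0,1])$ with generalized derivative in $L^2([0,1])$; elements of $\mathcal H^1$ are identified with their continuous versions. Let $\gamma:[0,1]\to[0,1]$ be measurable and let $H\in C^{0,1}([0,T]\times[0,1])$. A weak solution of $$\begin{cases}\partial_t u=\Delta u-2\nabla\{\sigma(u)\nabla H\},\\ \nabla u_t(1)-2\sigma(u_t(1))\nabla H_t(1)=\mathfrak p_{\beta,B}(u_t(1),H_t(1)),\\ \nabla u_t(0)-2\sigma(u_t(0))\nabla H_t(0)=-\mathfrak p_{\alpha,A}(u_t(0),H_t(0)),\\ u(0,\cdot)=\gamma\end{cases}$$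 is a function $u\in L^2(0,T;\mathcal H^1)$, with $u_t\in L^2([0,1])$ given for every $t\in[0,T]$ and with $0\le u\le1$ a.e., such that $$\begin{aligned}&\int_0^1u_tG_t\,dx-\int_0^1\gamma\, G_0\,dx-\int_0^t\!\!\int_0^1u_s\,\partial_sG_s\,dx\,ds\\&\quad=\int_0^t\!\!\int_0^1\{-\nabla u_s\nabla G_s+2\sigma(u_s)\nabla H_s\nabla G_s\}\,dx\,ds+\int_0^t\{\mathfrak p_{\beta,B}(u_s(1),H_s(1))G_s(1)+\mathfrak p_{\alpha,A}(u_s(0),H_s(0))G_s(0)\}\,ds\end{aligned}$$ for every $0<t\le T$ and every $G\in C^{1,2}([0,T]\times[0,1])$. Then there exists a unique weak solution: a weak solution exists, and any two weak solutions $u,v$ satisfy $u_t=v_t$ a.e. on $[0,1]$ for every $0<t\le T$. -/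

import Mathlib

open Set MeasureTheory
open scoped ContDiff

noncomputable section

namespace RobinWASEP

/-- Lebesgue measure on `[0,1]`. -/
def unitMeasure : Measure ℝ := volume.restrict (Icc 0 1)

/-- The cylinder `[0,T] × [0,1]`; a function on it is written `u t x`, time first. -/
def cylinder (T : ℝ) : Set (ℝ × ℝ) := Icc 0 T ×ˢ Icc 0 1

/-- The class `C^{m,n}([0,T] × [0,1])`: `m` derivatives in time and `n` derivatives in space, all
of them continuous on the closed cylinder (one-sided derivatives at the boundary). -/
structure IsC (T : ℝ) (m n : ℕ) (G : ℝ → ℝ → ℝ) : Prop where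
  time_contDiff : ∀ x ∈ Icc (0 : ℝ) 1, ContDiffOn ℝ m (fun t => G t x) (Icc 0 T)
  space_contDiff : ∀ t ∈ Icc (0 : ℝ) T, ContDiffOn ℝ n (G t) (Icc 0 1)
  time_continuous : ∀ j ≤ m, ContinuousOn
    (fun p : ℝ × ℝ => iteratedDerivWithin j (fun t => G t p.2) (Icc 0 T) p.1) (cylinder T)
  space_continuous : ∀ k ≤ n, ContinuousOn
    (fun p : ℝ × ℝ => iteratedDerivWithin k (G p.1) (Icc 0 1) p.2) (cylinder T)

/-- The time derivative `∂_t G (t,x)`, one-sided at `t = 0` and `t = T`. -/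
def timeDeriv (T : ℝ) (G : ℝ → ℝ → ℝ) (t x : ℝ) : ℝ :=
  derivWithin (fun s => G s x) (Icc 0 T) t

/-- The space derivative `∇ G (t,x)`, one-sided at `x = 0` and `x = 1`. -/
def spaceDeriv (G : ℝ → ℝ → ℝ) (t x : ℝ) : ℝ :=
  derivWithin (G t) (Icc 0 1) x

/-- `g` is a generalized derivative of `f` on `(0,1)`. -/
def HasWeakDeriv (f g : ℝ → ℝ) : Prop :=
  ∀ φ : ℝ → ℝ, ContDiff ℝ ∞ φ → HasCompactSupport φ → tsupport φ ⊆ Ioo 0 1 →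
    ∫ x, f x * deriv φ x ∂unitMeasure = - ∫ x, g x * φ x ∂unitMeasure

/-- `f` is (the continuous version of) an element of the Sobolev space `H¹` of `[0,1]`, with
generalized derivative `g`. -/
structure IsH1 (f g : ℝ → ℝ) : Prop where
  memLp : MemLp f 2 unitMeasure
  memLp_deriv : MemLp g 2 unitMeasure
  hasWeakDeriv : HasWeakDeriv f g
  continuousOn : ContinuousOn f (Icc 0 1)

/-- `u` belongs to `L²(0,T; H¹)`, with generalized space derivative `g = ∇u`. For almost every `t`
the function `u t` is the continuous version, so that `u t 0` and `u t 1` are its boundary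
values. -/
structure IsL2H1 (T : ℝ) (u g : ℝ → ℝ → ℝ) : Prop where
  memLp : MemLp (fun p : ℝ × ℝ => u p.1 p.2) 2 (volume.restrict (cylinder T))
  memLp_deriv : MemLp (fun p : ℝ × ℝ => g p.1 p.2) 2 (volume.restrict (cylinder T))
  isH1 : ∀ᵐ t ∂(volume.restrict (Icc 0 T)), IsH1 (u t) (g t)

/-- The mobility `σ(a) = a (1 - a)`. -/
def mobility (a : ℝ) : ℝ := a * (1 - a)

/-- `𝔭_{ϱ,D}(a,M) = D⁻¹ { (1 - a) ϱ e^M - a (1 - ϱ) e^{-M} }`. -/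
def boundaryFlux (ϱ D a M : ℝ) : ℝ :=
  D⁻¹ * ((1 - a) * ϱ * Real.exp M - a * (1 - ϱ) * Real.exp (-M))

/-- The integral identity at time `t` with test function `G`, for a function `u` with generalized
space derivative `g`. -/
def WeakIdentity (α β A B T : ℝ) (H : ℝ → ℝ → ℝ) (γ : ℝ → ℝ) (u g : ℝ → ℝ → ℝ)
    (t : ℝ) (G : ℝ → ℝ → ℝ) : Prop :=
  (∫ x, u t x * G t x ∂unitMeasure) - (∫ x, γ x * G 0 x ∂unitMeasure)
      - (∫ s in (0 : ℝ)..t, ∫ x, u s x * timeDeriv T G s x ∂unitMeasure)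
    = (∫ s in (0 : ℝ)..t, ∫ x, (- (g s x * spaceDeriv G s x)
          + 2 * mobility (u s x) * spaceDeriv H s x * spaceDeriv G s x) ∂unitMeasure)
      + ∫ s in (0 : ℝ)..t, (boundaryFlux β B (u s 1) (H s 1) * G s 1
          + boundaryFlux α A (u s 0) (H s 0) * G s 0)

/-- Weak (generalized) solutions in `[0,T] × [0,1]` of `∂_t u = Δu - 2 ∇(σ(u) ∇H)` with
`∇u - 2 σ(u) ∇H` equal to `𝔭_{β,B}(u,H)` at `x = 1` and to `-𝔭_{α,A}(u,H)` at `x = 0`, and with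
initial condition `γ`. The field `memLp` gives a meaning to the profile `u t` at each time. -/
structure IsWeakSolution (α β A B T : ℝ) (H : ℝ → ℝ → ℝ) (γ : ℝ → ℝ)
    (u : ℝ → ℝ → ℝ) : Prop where
  memLp : ∀ t ∈ Icc 0 T, MemLp (u t) 2 unitMeasure
  mem_Icc : ∀ᵐ p ∂(volume.restrict (cylinder T)), u p.1 p.2 ∈ Icc (0 : ℝ) 1
  weak : ∃ g : ℝ → ℝ → ℝ, IsL2H1 T u g ∧
    ∀ t ∈ Ioc 0 T, ∀ G : ℝ → ℝ → ℝ, IsC T 1 2 G → WeakIdentity α β A B T H γ u g t G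

end RobinWASEP

end

/-! Both halves rest on one energy inequality, `IsFluxSolution.energy_le`, for a conservation law
`∂_t w = ∂_x f` with fluxes `q₀`, `q₁` entering through the end points. For a convex `Ψ` with `0 ≤
Ψ'' = ρ ≤ 1` and `Ψ(w₀) = 0`, it bounds `K ∫∫ e^{-Kt} Ψ(w)` by the integral of `e^{-Kt} (q₁ Ψ'(w(1))
+ q₀ Ψ'(w(0)) - f ρ(w) g)`, where `g = ∇w`. No regularity in time is needed: `Ψ'(w_t)` is tested
against the increment `w_t - w_{t-r}`, convexity bounds `Ψ(w_t) - Ψ(w_{t-r})`, the increment is an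
integral of translated fluxes, and continuity of translations in `L²` allows division by `r → 0`.

Uniqueness takes `Ψ(a) = a²/2` and the difference of two solutions. The boundary flux is affine and
decreasing in the density, so its terms have a good sign. The mobility is 1-Lipschitz on `[0,1]`, so
the drift is absorbed by the diffusion and by a large `K`. Equality for almost every time becomes
equality at each positive time, because the moments of the difference are continuous in time.

Existence replaces the mobility by a bounded Lipschitz truncation that vanishes outside `[0,1]`.
After the substitution `u = e^{r² t} v`, Lions' projection theorem solves the linear problem with
solution operator of norm at most `1/κ`, where `κ` is the coercivity constant. Measuring `v` through
the component `r v` makes the Lipschitz constant of the drift `2C/r`, with `C` a bound for `|∇H|`; a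
large `r` gives a contraction (`exists_inner_eq_of_coercive_of_lipschitz`,
`exists_weak_of_lipschitz`).

The energy inequality with `ρ` supported in `a ≤ 0` or in `a ≥ 1` then shows that the solution stays
in `[0,1]` (`ae_mem_Icc_of_truncFlux`), so the truncation is invisible. Finally, the identity
obtained at almost every time is extended to every time by choosing each exceptional profile through
Riesz representation (`exists_slice`). -/

noncomputable section

namespace RobinWASEP

open Filter Topology

/-! ### Riesz representation and Lions' projection theorem with a contraction. -/

section Abstract

variable {Φ E : Type*} [AddCommGroup Φ] [Module ℝ Φ] [NormedAddCommGroup E]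
  [InnerProductSpace ℝ E] [CompleteSpace E]

/-- A linear functional dominated by `φ ↦ ‖K φ‖` is represented by a vector in the closure of the
range of `K`. -/
theorem exists_mem_closure_range_inner_eq (K : Φ →ₗ[ℝ] E) (l : Φ →ₗ[ℝ] ℝ) {C : ℝ} (hC : 0 ≤ C)
    (h : ∀ φ, |l φ| ≤ C * ‖K φ‖) :
    ∃ u ∈ (LinearMap.range K).topologicalClosure, ‖u‖ ≤ C ∧ ∀ φ, inner ℝ u (K φ) = l φ := by
  obtain ⟨s, hs⟩ := LinearMap.exists_rightInverse_of_surjective K.rangeRestrict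
    (LinearMap.range_rangeRestrict K)
  have hs' : ∀ y : LinearMap.range K, K (s y) = y := fun y => by
    have := LinearMap.congr_fun hs y
    exact congrArg Subtype.val this
  -- The bound forces `l` to vanish on the kernel of `K`, so `l` factors through the range and the
  -- choice of the section `s` is immaterial.
  have hl : ∀ φ, l (s ⟨K φ, LinearMap.mem_range_self K φ⟩) = l φ := fun φ => by
    have h1 := h (s ⟨K φ, LinearMap.mem_range_self K φ⟩ - φ)
    rw [map_sub, map_sub, hs', sub_self, norm_zero, mul_zero] at h1
    exact sub_eq_zero.1 (abs_nonpos_iff.1 h1)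
  let f : StrongDual ℝ (LinearMap.range K) := (l.comp s).mkContinuous C fun y => by
    have := h (s y)
    rw [hs'] at this
    simpa using this
  obtain ⟨g, hg, hgn⟩ := exists_extension_norm_eq (LinearMap.range K) f
  let v : E := (InnerProductSpace.toDual ℝ E).symm g
  have hv : ‖v‖ ≤ C := by
    rw [LinearIsometryEquiv.norm_map, hgn]
    exact LinearMap.mkContinuous_norm_le _ hC _
  let F := (LinearMap.range K).topologicalClosure
  have : CompleteSpace F := (LinearMap.range K).isClosed_topologicalClosure.completeSpace_coe
  -- Projecting onto the closure of the range leaves all pairings with `K φ` unchanged; it makes the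
  -- representing vector unique.
  refine ⟨F.starProjection v, F.starProjection_apply_mem v,
    (F.norm_starProjection_apply_le v).trans hv, fun φ => ?_⟩
  have hmem : K φ ∈ F := (LinearMap.range K).le_topologicalClosure (LinearMap.mem_range_self K φ)
  rw [F.inner_starProjection_left_eq_right, Submodule.starProjection_eq_self_iff.2 hmem,
    InnerProductSpace.toDual_symm_apply]
  have := hg ⟨K φ, LinearMap.mem_range_self K φ⟩
  rw [this]
  exact hl φ

/-- Lions' projection theorem, combined with a contraction argument for a Lipschitz right-hand
side. -/
theorem exists_inner_eq_of_coercive_of_lipschitz (i k : Φ →ₗ[ℝ] E) (l : Φ →ₗ[ℝ] ℝ)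
    {κ C q : ℝ} (hκ : 0 < κ) (hC : 0 ≤ C) (hq : 0 ≤ q) (hqκ : q < κ)
    (hco : ∀ φ, κ * ‖i φ‖ ^ 2 ≤ inner ℝ (i φ) (k φ))
    (hl : ∀ φ, l φ ^ 2 ≤ C * inner ℝ (i φ) (k φ))
    (N : E → E) (hN : ∀ u v, ‖N u - N v‖ ≤ q * ‖u - v‖) :
    ∃ u ∈ (LinearMap.range i).topologicalClosure,
      ∀ φ, inner ℝ u (k φ) = l φ + inner ℝ (N u) (i φ) := by
  let F := (LinearMap.range i).topologicalClosure
  have : CompleteSpace F := (LinearMap.range i).isClosed_topologicalClosure.completeSpace_coe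
  -- The unknown is sought in `F`, where only the projection of `k φ` is seen. As `i φ ∈ F`,
  -- coercivity gives `κ‖i φ‖² ≤ ⟪i φ, K φ⟫`, hence `‖i φ‖ ≤ κ⁻¹‖K φ‖`.
  let K : Φ →ₗ[ℝ] E := F.starProjection.toLinearMap.comp k
  have hF : ∀ u ∈ F, ∀ φ, inner ℝ u (K φ) = inner ℝ u (k φ) := fun u hu φ => by
    change inner ℝ u (F.starProjection (k φ)) = _
    rw [← F.inner_starProjection_left_eq_right, Submodule.starProjection_eq_self_iff.2 hu]
  have hi : ∀ φ, i φ ∈ F := fun φ =>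
    (LinearMap.range i).le_topologicalClosure (LinearMap.mem_range_self i φ)
  have hik : ∀ φ, inner ℝ (i φ) (k φ) ≤ ‖i φ‖ * ‖K φ‖ := fun φ => by
    rw [← hF _ (hi φ)]; exact real_inner_le_norm _ _
  have hiK : ∀ φ, ‖i φ‖ ≤ κ⁻¹ * ‖K φ‖ := fun φ => by
    rcases (norm_nonneg (i φ)).eq_or_lt with h0 | h0
    · rw [← h0]; positivity
    · have h1 := (hco φ).trans (hik φ)
      rw [sq, ← mul_assoc, mul_comm _ ‖i φ‖] at h1
      have h2 := le_of_mul_le_mul_left h1 h0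
      rw [inv_mul_eq_div, le_div_iff₀ hκ]; linarith
  have hlK : ∀ φ, |l φ| ≤ √(C * κ⁻¹) * ‖K φ‖ := fun φ => by
    rw [← Real.sqrt_sq_eq_abs]
    refine (Real.sqrt_le_sqrt (y := C * κ⁻¹ * ‖K φ‖ ^ 2) ?_).trans_eq ?_
    · refine (hl φ).trans ?_
      rw [mul_assoc]
      refine mul_le_mul_of_nonneg_left ((hik φ).trans ?_) hC
      nlinarith [hiK φ, norm_nonneg (K φ)]
    · rw [Real.sqrt_mul (by positivity), Real.sqrt_sq (norm_nonneg _)]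
  have hKF : (LinearMap.range K).topologicalClosure ≤ F := by
    refine Submodule.topologicalClosure_minimal _ ?_
      (LinearMap.range i).isClosed_topologicalClosure
    rintro _ ⟨φ, rfl⟩
    exact F.starProjection_apply_mem (k φ)
  -- The linear problem with frozen right-hand side `z`; its functional is bounded by a multiple of
  -- `‖K φ‖`.
  have key : ∀ z : E, ∃ u ∈ (LinearMap.range K).topologicalClosure,
      ∀ φ, inner ℝ u (K φ) = l φ + inner ℝ z (i φ) := fun z => by
    obtain ⟨u, hu, -, h⟩ := exists_mem_closure_range_inner_eq K
      (l + (innerSL ℝ z).toLinearMap.comp i) (C := √(C * κ⁻¹) + ‖z‖ * κ⁻¹) (by positivity)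
      (fun φ => by
        refine (abs_add_le _ _).trans ?_
        rw [add_mul]
        refine add_le_add (hlK φ) ?_
        refine (abs_real_inner_le_norm z (i φ)).trans ?_
        rw [mul_assoc]
        exact mul_le_mul_of_nonneg_left (hiK φ) (norm_nonneg _))
    exact ⟨u, hu, fun φ => by simpa using h φ⟩
  choose S hSmem hS using key
  have hdiff : ∀ z z', ‖S z - S z'‖ ≤ ‖z - z'‖ * κ⁻¹ := fun z z' => by
    obtain ⟨d, hd, hdn, h⟩ := exists_mem_closure_range_inner_eq K
      ((innerSL ℝ (z - z')).toLinearMap.comp i) (C := ‖z - z'‖ * κ⁻¹) (by positivity)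
      (fun φ => by
        refine (abs_real_inner_le_norm (z - z') (i φ)).trans ?_
        rw [mul_assoc]
        exact mul_le_mul_of_nonneg_left (hiK φ) (norm_nonneg _))
    -- `S z - S z'` and `d` represent the same functional and both lie in the closure of the range
    -- of `K`, so their difference is orthogonal to itself.
    suffices hz : S z - S z' - d = 0 by rwa [sub_eq_zero.1 hz]
    have hmem : S z - S z' - d ∈ (LinearMap.range K).topologicalClosure :=
      Submodule.sub_mem _ (Submodule.sub_mem _ (hSmem z) (hSmem z')) hd
    have horth : ∀ y ∈ (LinearMap.range K).topologicalClosure,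
        inner ℝ (S z - S z' - d) y = 0 := by
      have hcl : IsClosed {y : E | inner ℝ (S z - S z' - d) y = 0} :=
        isClosed_eq (continuous_const.inner continuous_id) continuous_const
      intro y hy
      refine closure_minimal ?_ hcl hy
      rintro _ ⟨φ, rfl⟩
      have := h φ
      simp only [LinearMap.coe_comp, Function.comp_apply, ContinuousLinearMap.coe_coe,
        innerSL_apply_apply] at this
      simp only [mem_ofPred_eq]
      rw [inner_sub_left, inner_sub_left, hS, hS, this, inner_sub_left]
      ring
    exact inner_self_eq_zero.1 (horth _ hmem)
  -- `S` is `κ⁻¹`-Lipschitz and `N` is `q`-Lipschitz with `q < κ`.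
  have hcontr : ContractingWith (Real.toNNReal (q * κ⁻¹)) (fun u => S (N u)) := by
    refine ⟨?_, LipschitzWith.of_dist_le_mul fun u v => ?_⟩
    · rw [Real.toNNReal_lt_one, ← div_eq_mul_inv, div_lt_one hκ]; exact hqκ
    · rw [Real.coe_toNNReal _ (by positivity), dist_eq_norm, dist_eq_norm]
      refine (hdiff _ _).trans ?_
      have := mul_le_mul_of_nonneg_right (hN u v) (inv_nonneg.2 hκ.le)
      linarith
  let u := hcontr.fixedPoint
  have hu : S (N u) = u := hcontr.fixedPoint_isFixedPt
  have huF : u ∈ F := by rw [← hu]; exact hKF (hSmem _)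
  refine ⟨u, huF, fun φ => ?_⟩
  rw [← hF u huF, ← hS (N u) φ, hu]

end Abstract

/-! ### Measures on the two intervals and on the cylinder. -/

section Measures

/-- Lebesgue measure on `[0,T]`. -/
def timeMeasure (T : ℝ) : Measure ℝ := volume.restrict (Icc 0 T)

instance : IsProbabilityMeasure unitMeasure :=
  ⟨by simp [unitMeasure]⟩

instance (T : ℝ) : IsFiniteMeasure (timeMeasure T) :=
  ⟨by simp [timeMeasure]⟩

theorem restrict_cylinder (T : ℝ) :
    (volume : Measure (ℝ × ℝ)).restrict (cylinder T) = (timeMeasure T).prod unitMeasure := by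
  rw [cylinder, timeMeasure, unitMeasure, Measure.prod_restrict, Measure.volume_eq_prod]

theorem ae_unitMeasure_mem : ∀ᵐ x ∂unitMeasure, x ∈ Icc (0 : ℝ) 1 :=
  ae_restrict_mem measurableSet_Icc

theorem ae_timeMeasure_mem (T : ℝ) : ∀ᵐ t ∂timeMeasure T, t ∈ Icc (0 : ℝ) T :=
  ae_restrict_mem measurableSet_Icc

theorem intervalIntegral_eq_setIntegral_timeMeasure {T t : ℝ} (ht : t ∈ Icc 0 T) (f : ℝ → ℝ) :
    ∫ s in (0 : ℝ)..t, f s = ∫ s in Iic t, f s ∂timeMeasure T := by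
  rw [intervalIntegral.integral_of_le ht.1, timeMeasure, Measure.restrict_restrict measurableSet_Iic,
    ← integral_Icc_eq_integral_Ioc]
  congr 2
  ext s
  simp only [mem_Icc, mem_inter_iff, mem_Iic]
  exact ⟨fun h => ⟨h.2, h.1, h.2.trans ht.2⟩, fun h => ⟨h.2.1, h.1⟩⟩

theorem integral_timeMeasure {T : ℝ} (hT : 0 ≤ T) (f : ℝ → ℝ) :
    ∫ s, f s ∂timeMeasure T = ∫ s in (0 : ℝ)..T, f s := by
  rw [intervalIntegral.integral_of_le hT, timeMeasure, integral_Icc_eq_integral_Ioc]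

theorem integral_unitMeasure (f : ℝ → ℝ) : ∫ x, f x ∂unitMeasure = ∫ x in (0 : ℝ)..1, f x := by
  rw [intervalIntegral.integral_of_le zero_le_one, unitMeasure, integral_Icc_eq_integral_Ioc]

theorem sq_integral_le_integral_sq {α : Type*} [MeasurableSpace α] {μ : Measure α}
    [IsProbabilityMeasure μ] {f : α → ℝ} (hf : MemLp f 2 μ) :
    (∫ x, f x ∂μ) ^ 2 ≤ ∫ x, f x ^ 2 ∂μ := by
  have h1 : Integrable f μ := hf.integrable one_le_two
  have h2 := hf.integrable_sq
  set m := ∫ x, f x ∂μ with hm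
  have h : 0 ≤ ∫ x, (f x - m) ^ 2 ∂μ := integral_nonneg fun x => sq_nonneg _
  have : ∫ x, (f x - m) ^ 2 ∂μ = ∫ x, f x ^ 2 ∂μ - m ^ 2 := by
    have e : ∀ x, (f x - m) ^ 2 = f x ^ 2 - (2 * m) * f x + m ^ 2 := fun x => by ring
    simp_rw [e]
    have h3 : Integrable (fun x => f x ^ 2 - (2 * m) * f x) μ := h2.sub (h1.const_mul _)
    rw [integral_add h3 (integrable_const _), integral_sub h2 (h1.const_mul _),
      integral_const_mul, ← hm]
    simp; ring
  linarith

theorem ae_memLp_slice {α β : Type*} [MeasurableSpace α] [MeasurableSpace β] {μ : Measure α}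
    {ν : Measure β} [SFinite μ] [SFinite ν] {f : α → β → ℝ}
    (hf : MemLp (fun p : α × β => f p.1 p.2) 2 (μ.prod ν)) : ∀ᵐ t ∂μ, MemLp (f t) 2 ν := by
  have h1 := hf.1.prodMk_left
  have h2 := hf.integrable_sq.prod_right_ae
  filter_upwards [h1, h2] with t h1 h2
  exact (memLp_two_iff_integrable_sq h1).2 h2

theorem integrable_mul_of_memLp_two {α : Type*} [MeasurableSpace α] {μ : Measure α}
    {f g : α → ℝ} (hf : MemLp f 2 μ) (hg : MemLp g 2 μ) : Integrable (fun x => f x * g x) μ :=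
  hf.integrable_mul hg

end Measures

/-! ### Determinacy by moments. -/

section Moments

/-- An integrable function on an interval all of whose moments vanish is zero. -/
theorem ae_eq_zero_of_moments_eq_zero {a b : ℝ} {h : ℝ → ℝ}
    (h_int : Integrable h (volume.restrict (Icc a b)))
    (hm : ∀ n : ℕ, ∫ x, x ^ n * h x ∂(volume.restrict (Icc a b)) = 0) :
    ∀ᵐ x ∂(volume.restrict (Icc a b)), h x = 0 := by
  set μ := (volume : Measure ℝ).restrict (Icc a b)
  have hmul : ∀ f : ℝ → ℝ, Continuous f → Integrable (fun x => f x * h x) μ := fun f hf => by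
    obtain ⟨C, hC⟩ := isCompact_Icc.exists_bound_of_continuousOn (hf.continuousOn (s := Icc a b))
    exact h_int.bdd_mul (c := C) hf.aestronglyMeasurable
      ((ae_restrict_mem measurableSet_Icc).mono fun x hx => hC x hx)
  have hpoly : ∀ p : Polynomial ℝ, ∫ x, p.eval x * h x ∂μ = 0 := fun p => by
    simp_rw [Polynomial.eval_eq_sum_range, Finset.sum_mul]
    rw [integral_finsetSum]
    · refine Finset.sum_eq_zero fun n _ => ?_
      simp_rw [mul_assoc]
      rw [integral_const_mul, hm, mul_zero]
    · intro n _
      exact hmul (fun x => p.coeff n * x ^ n) (by fun_prop)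
  refine ae_eq_zero_of_integral_contDiff_smul_eq_zero h_int.locallyIntegrable fun f hf _ => ?_
  simp only [smul_eq_mul]
  -- By Weierstrass, `f` is within `ε` of a polynomial, whose integral against `h` vanishes.
  have hbound : ∀ ε > 0, |∫ x, f x * h x ∂μ| ≤ ε * ∫ x, |h x| ∂μ := fun ε hε => by
    obtain ⟨p, hp⟩ := exists_polynomial_near_of_continuousOn a b f hf.continuous.continuousOn ε hε
    have e : ∫ x, f x * h x ∂μ = ∫ x, (f x - p.eval x) * h x ∂μ := by
      simp_rw [sub_mul]
      rw [integral_sub (hmul f hf.continuous) (hmul _ p.continuous), hpoly, sub_zero]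
    rw [e, ← integral_const_mul]
    refine (abs_integral_le_integral_abs).trans (integral_mono_ae ?_ (h_int.abs.const_mul ε) ?_)
    · exact (hmul (fun x => f x - p.eval x) (by have := hf.continuous; fun_prop)).abs
    · filter_upwards [ae_restrict_mem measurableSet_Icc] with x hx
      rw [abs_mul]
      refine mul_le_mul_of_nonneg_right ?_ (abs_nonneg _)
      rw [abs_sub_comm]; exact (hp x hx).le
  have h0 : 0 ≤ ∫ x, |h x| ∂μ := integral_nonneg fun x => abs_nonneg _
  by_contra hne
  have hpos : 0 < |∫ x, f x * h x ∂μ| := abs_pos.2 hne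
  -- This `ε` would bound the integral by half of itself; the `+ 1` avoids division by zero.
  have := hbound (|∫ x, f x * h x ∂μ| / (2 * (∫ x, |h x| ∂μ + 1))) (by positivity)
  rw [div_mul_eq_mul_div, le_div_iff₀ (by positivity)] at this
  nlinarith

end Moments

/-! ### Primitives as Volterra operators. -/

section Primitive

/-- The Volterra kernel `1_{y ≤ x}`. -/
def leKernel (x y : ℝ) : ℝ := if y ≤ x then 1 else 0

theorem measurable_leKernel : Measurable fun p : ℝ × ℝ => leKernel p.1 p.2 :=
  Measurable.ite (measurableSet_le measurable_snd measurable_fst) measurable_const measurable_const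

theorem abs_leKernel_le (x y : ℝ) : |leKernel x y| ≤ 1 := by
  unfold leKernel; split_ifs <;> simp

/-- The primitive on `[0,1]` that vanishes at `0`. -/
def primitive (g : ℝ → ℝ) (x : ℝ) : ℝ := ∫ y, leKernel x y * g y ∂unitMeasure

/-- The integral of `D` from `y` to `1`. -/
def tailIntegral (D : ℝ → ℝ) (y : ℝ) : ℝ := ∫ x, leKernel x y * D x ∂unitMeasure

theorem primitive_eq_intervalIntegral (g : ℝ → ℝ) {x : ℝ} (hx : x ∈ Icc (0 : ℝ) 1) :
    primitive g x = ∫ y in (0 : ℝ)..x, g y := by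
  rw [intervalIntegral.integral_of_le hx.1, primitive, unitMeasure, ← integral_Icc_eq_integral_Ioc]
  have : ∀ y, leKernel x y * g y = (Iic x).indicator g y := fun y => by
    simp [leKernel, indicator_apply]
  simp_rw [this]
  rw [integral_indicator measurableSet_Iic, Measure.restrict_restrict measurableSet_Iic]
  congr 2
  ext y
  simp only [mem_Icc, mem_inter_iff, mem_Iic]
  exact ⟨fun h => ⟨h.2.1, h.1⟩, fun h => ⟨h.2, h.1, h.2.trans hx.2⟩⟩

theorem tailIntegral_eq_intervalIntegral (D : ℝ → ℝ) {y : ℝ} (hy : y ∈ Icc (0 : ℝ) 1) :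
    tailIntegral D y = ∫ x in y..1, D x := by
  rw [intervalIntegral.integral_of_le hy.2, tailIntegral, unitMeasure,
    ← integral_Icc_eq_integral_Ioc]
  have : ∀ x, leKernel x y * D x = (Ici y).indicator D x := fun x => by
    simp [leKernel, indicator_apply]
  simp_rw [this]
  rw [integral_indicator measurableSet_Ici, Measure.restrict_restrict measurableSet_Ici]
  congr 2
  ext x
  simp only [mem_Icc, mem_inter_iff, mem_Ici]
  exact ⟨fun h => ⟨h.1, h.2.2⟩, fun h => ⟨h.1, hy.1.trans h.1, h.2⟩⟩

theorem primitive_zero (g : ℝ → ℝ) : primitive g 0 = 0 := by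
  rw [primitive_eq_intervalIntegral g (left_mem_Icc.2 zero_le_one), intervalIntegral.integral_same]

theorem primitive_one (g : ℝ → ℝ) : primitive g 1 = ∫ x, g x ∂unitMeasure := by
  rw [primitive_eq_intervalIntegral g (right_mem_Icc.2 zero_le_one), integral_unitMeasure]

theorem primitive_congr {g g' : ℝ → ℝ} (h : g =ᵐ[unitMeasure] g') (x : ℝ) :
    primitive g x = primitive g' x :=
  integral_congr_ae (h.mono fun y hy => by simp only [hy])

theorem integrable_leKernel_mul {g : ℝ → ℝ} (hg : Integrable g unitMeasure) (x : ℝ) :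
    Integrable (fun y => leKernel x y * g y) unitMeasure :=
  hg.bdd_mul (c := 1) (measurable_leKernel.comp measurable_prodMk_left).aestronglyMeasurable
    (Eventually.of_forall fun y => abs_leKernel_le x y)

theorem intervalIntegrable_of_integrable_unitMeasure {g : ℝ → ℝ} (hg : Integrable g unitMeasure) :
    IntervalIntegrable g volume 0 1 := by
  rw [intervalIntegrable_iff_integrableOn_Icc_of_le zero_le_one]; exact hg

theorem continuousOn_primitive {g : ℝ → ℝ} (hg : Integrable g unitMeasure) :
    ContinuousOn (primitive g) (Icc 0 1) := by
  have h := intervalIntegral.continuousOn_primitive_interval (a := 0) (b := 1) (f := g)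
    (μ := volume) (by rw [uIcc_of_le zero_le_one]; exact hg)
  rw [uIcc_of_le zero_le_one] at h
  exact h.congr fun x hx => primitive_eq_intervalIntegral g hx

/-- Integration by parts in the form of Fubini's theorem. -/
theorem integral_mul_primitive {D ξ : ℝ → ℝ} (hD : Integrable D unitMeasure)
    (hξ : Integrable ξ unitMeasure) :
    ∫ x, D x * primitive ξ x ∂unitMeasure = ∫ y, ξ y * tailIntegral D y ∂unitMeasure := by
  have h_int : Integrable (Function.uncurry fun x y => leKernel x y * (D x * ξ y))
      (unitMeasure.prod unitMeasure) :=
    (hD.mul_prod hξ).bdd_mul (c := 1) measurable_leKernel.aestronglyMeasurable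
      (Eventually.of_forall fun p => abs_leKernel_le p.1 p.2)
  have h := integral_integral_swap h_int
  simp only [primitive, tailIntegral, ← integral_const_mul]
  refine Eq.trans ?_ (h.trans ?_)
  · refine integral_congr_ae (Eventually.of_forall fun x => integral_congr_ae
      (Eventually.of_forall fun y => ?_))
    simp only; ring
  · refine integral_congr_ae (Eventually.of_forall fun x => integral_congr_ae
      (Eventually.of_forall fun y => ?_))
    simp only; ring

end Primitive

/-! ### Convex functions given by their second derivative, and a chain rule. -/

section Convex

variable {ρ : ℝ → ℝ}

/-- The primitive of `ρ` vanishing at `0`. -/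
def firstPrim (ρ : ℝ → ℝ) (a : ℝ) : ℝ := ∫ s in (0 : ℝ)..a, ρ s

/-- The second primitive of `ρ`. -/
def secondPrim (ρ : ℝ → ℝ) (a : ℝ) : ℝ := ∫ s in (0 : ℝ)..a, firstPrim ρ s

theorem hasDerivAt_firstPrim (hρ : Continuous ρ) (a : ℝ) : HasDerivAt (firstPrim ρ) (ρ a) a :=
  intervalIntegral.integral_hasDerivAt_right (hρ.intervalIntegrable _ _)
    (hρ.stronglyMeasurableAtFilter _ _) hρ.continuousAt

theorem continuous_firstPrim (hρ : Continuous ρ) : Continuous (firstPrim ρ) :=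
  continuous_iff_continuousAt.2 fun a => (hasDerivAt_firstPrim hρ a).continuousAt

theorem hasDerivAt_secondPrim (hρ : Continuous ρ) (a : ℝ) :
    HasDerivAt (secondPrim ρ) (firstPrim ρ a) a :=
  intervalIntegral.integral_hasDerivAt_right ((continuous_firstPrim hρ).intervalIntegrable _ _)
    ((continuous_firstPrim hρ).stronglyMeasurableAtFilter _ _) (continuous_firstPrim hρ).continuousAt

theorem continuous_secondPrim (hρ : Continuous ρ) : Continuous (secondPrim ρ) :=
  continuous_iff_continuousAt.2 fun a => (hasDerivAt_secondPrim hρ a).continuousAt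

theorem firstPrim_sub (hρ : Continuous ρ) (a b : ℝ) :
    firstPrim ρ a - firstPrim ρ b = ∫ s in b..a, ρ s :=
  intervalIntegral.integral_interval_sub_left (hρ.intervalIntegrable _ _)
    (hρ.intervalIntegrable _ _)

theorem abs_firstPrim_sub_le (hρ : Continuous ρ) (h0 : ∀ a, 0 ≤ ρ a) (h1 : ∀ a, ρ a ≤ 1)
    (a b : ℝ) : |firstPrim ρ a - firstPrim ρ b| ≤ |a - b| := by
  rw [firstPrim_sub hρ]
  have := intervalIntegral.norm_integral_le_of_norm_le_const (a := b) (b := a) (C := 1) (f := ρ)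
    fun x _ => by rw [Real.norm_eq_abs, abs_of_nonneg (h0 x)]; exact h1 x
  simpa using this

theorem firstPrim_zero : firstPrim ρ 0 = 0 := intervalIntegral.integral_same

theorem abs_firstPrim_le (hρ : Continuous ρ) (h0 : ∀ a, 0 ≤ ρ a) (h1 : ∀ a, ρ a ≤ 1) (a : ℝ) :
    |firstPrim ρ a| ≤ |a| := by
  simpa [firstPrim_zero] using abs_firstPrim_sub_le hρ h0 h1 a 0

theorem monotone_firstPrim (hρ : Continuous ρ) (h0 : ∀ a, 0 ≤ ρ a) : Monotone (firstPrim ρ) :=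
  fun a b hab => by
    rw [← sub_nonneg, firstPrim_sub hρ]
    exact intervalIntegral.integral_nonneg hab fun x _ => h0 x

/-- The tangent line inequality, from monotonicity of the first primitive. The slope is taken at
`a`, which will be the later time, as in an implicit time step. -/
theorem secondPrim_sub_le (hρ : Continuous ρ) (h0 : ∀ a, 0 ≤ ρ a) (a b : ℝ) :
    secondPrim ρ a - secondPrim ρ b ≤ firstPrim ρ a * (a - b) := by
  have hc := continuous_firstPrim hρ
  have e : secondPrim ρ a - secondPrim ρ b = ∫ s in b..a, firstPrim ρ s :=
    intervalIntegral.integral_interval_sub_left (hc.intervalIntegrable _ _)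
      (hc.intervalIntegrable _ _)
  rw [e]
  rcases le_total b a with h | h
  · have := intervalIntegral.integral_mono_on h (hc.intervalIntegrable b a)
      (intervalIntegrable_const (μ := volume) (c := firstPrim ρ a)) fun x hx => monotone_firstPrim hρ h0 hx.2
    rw [intervalIntegral.integral_const, smul_eq_mul] at this
    linarith
  · have := intervalIntegral.integral_mono_on h (intervalIntegrable_const (μ := volume) (c := firstPrim ρ a))
      (hc.intervalIntegrable a b) fun x hx => monotone_firstPrim hρ h0 hx.1
    rw [intervalIntegral.integral_const, smul_eq_mul] at this
    rw [intervalIntegral.integral_symm]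
    linarith

theorem secondPrim_zero : secondPrim ρ 0 = 0 := intervalIntegral.integral_same

theorem secondPrim_nonneg (hρ : Continuous ρ) (h0 : ∀ a, 0 ≤ ρ a) (a : ℝ) :
    0 ≤ secondPrim ρ a := by
  have := secondPrim_sub_le hρ h0 0 a
  rw [firstPrim_zero, secondPrim_zero] at this
  linarith

theorem secondPrim_le_sq (hρ : Continuous ρ) (h0 : ∀ a, 0 ≤ ρ a) (h1 : ∀ a, ρ a ≤ 1) (a : ℝ) :
    secondPrim ρ a ≤ a ^ 2 := by
  have := secondPrim_sub_le hρ h0 a 0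
  rw [secondPrim_zero, sub_zero, sub_zero] at this
  refine this.trans ((le_abs_self _).trans ?_)
  rw [abs_mul, ← sq_abs, sq]
  exact mul_le_mul_of_nonneg_right (abs_firstPrim_le hρ h0 h1 a) (abs_nonneg _)

end Convex

section ChainRule

/-- The chain rule for a `C¹` function with bounded derivative and the primitive of an integrable
function. -/
theorem firstPrim_comp_primitive {ρ : ℝ → ℝ} (hρ : Continuous ρ) (h0 : ∀ a, 0 ≤ ρ a)
    (h1 : ∀ a, ρ a ≤ 1) {g w : ℝ → ℝ} (hg : Integrable g unitMeasure)
    (hw : ∀ x ∈ Icc (0 : ℝ) 1, w x = w 0 + primitive g x) :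
    ∀ x ∈ Icc (0 : ℝ) 1,
      firstPrim ρ (w x) = firstPrim ρ (w 0) + primitive (fun y => ρ (w y) * g y) x := by
  intro x hx
  have hgi := intervalIntegrable_of_integrable_unitMeasure hg
  have hgx : IntervalIntegrable g volume 0 x :=
    hgi.mono_set (by rw [uIcc_of_le hx.1, uIcc_of_le zero_le_one]; exact Icc_subset_Icc_right hx.2)
  let W : ℝ → ℝ := fun y => w 0 + ∫ v in (0 : ℝ)..y, g v
  have hWw : ∀ y ∈ Icc (0 : ℝ) 1, W y = w y := fun y hy => by
    rw [hw y hy, primitive_eq_intervalIntegral g hy]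
  have hac := hgx.absolutelyContinuousOnInterval_intervalIntegral (c := 0) left_mem_uIcc
  -- Composition with a 1-Lipschitz function preserves absolute continuity, so the fundamental
  -- theorem of calculus needs the derivative only almost everywhere.
  have hac' : AbsolutelyContinuousOnInterval (fun y => firstPrim ρ (W y)) 0 x := by
    rw [absolutelyContinuousOnInterval_iff] at hac ⊢
    intro ε hε
    obtain ⟨δ, hδ, h⟩ := hac ε hε
    refine ⟨δ, hδ, fun E hE hs => (Finset.sum_le_sum fun i _ => ?_).trans_lt (h E hE hs)⟩
    rw [Real.dist_eq, Real.dist_eq]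
    refine (abs_firstPrim_sub_le hρ h0 h1 _ _).trans_eq ?_
    simp [W]
  have hder : ∀ᵐ y, y ∈ uIoc 0 x → deriv (fun y => firstPrim ρ (W y)) y = ρ (w y) * g y := by
    filter_upwards [hgx.ae_hasDerivAt_integral] with y hy hyx
    have hyx' : y ∈ Icc (0 : ℝ) 1 := by
      rw [uIoc_of_le hx.1] at hyx
      exact ⟨hyx.1.le, hyx.2.trans hx.2⟩
    have h2 : HasDerivAt W (g y) y :=
      (hy (uIoc_subset_uIcc hyx) 0 left_mem_uIcc).const_add _
    have h3 := ((hasDerivAt_firstPrim hρ (W y)).comp y h2).deriv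
    rw [← hWw y hyx']
    exact h3
  have hftc := hac'.integral_deriv_eq_sub
  rw [intervalIntegral.integral_congr_ae hder, hWw x hx,
    hWw 0 (left_mem_Icc.2 zero_le_one)] at hftc
  rw [primitive_eq_intervalIntegral _ hx, hftc]
  ring

end ChainRule

/-! ### Generalized derivatives and continuous versions. -/

section WeakDerivative

/-- Integration by parts through Fubini: the tail integral of `deriv φ` is `-φ`, and the constant `w
0` contributes nothing because `φ` vanishes at both ends. -/
theorem hasWeakDeriv_primitive {w g : ℝ → ℝ} (hg : Integrable g unitMeasure)
    (hw : ∀ x ∈ Icc (0 : ℝ) 1, w x = w 0 + primitive g x) : HasWeakDeriv w g := by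
  intro φ hφ hc hsupp
  have hz : ∀ x, x ∉ Ioo (0 : ℝ) 1 → φ x = 0 := fun x hx =>
    image_eq_zero_of_notMem_tsupport fun h => hx (hsupp h)
  have hdc : Continuous (deriv φ) := hφ.continuous_deriv (by simp)
  have hdi : Integrable (deriv φ) unitMeasure :=
    hdc.continuousOn.integrableOn_compact isCompact_Icc
  have hφd : Differentiable ℝ φ := hφ.differentiable (by simp)
  have htail : ∀ y ∈ Icc (0 : ℝ) 1, tailIntegral (deriv φ) y = - φ y := fun y hy => by
    rw [tailIntegral_eq_intervalIntegral _ hy, intervalIntegral.integral_deriv_eq_sub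
      (fun x _ => hφd x) (hdc.intervalIntegrable _ _), hz 1 (by simp)]
    ring
  have e : ∫ x, w x * deriv φ x ∂unitMeasure
      = ∫ x, (w 0 * deriv φ x + deriv φ x * primitive g x) ∂unitMeasure :=
    integral_congr_ae (ae_unitMeasure_mem.mono fun x hx => by simp only [hw x hx]; ring)
  have hpi : Integrable (fun x => deriv φ x * primitive g x) unitMeasure :=
    (hdc.continuousOn.mul (continuousOn_primitive hg)).integrableOn_compact isCompact_Icc
  rw [e, integral_add (hdi.const_mul _) hpi, integral_const_mul, integral_mul_primitive hdi hg,
    integral_unitMeasure (deriv φ), intervalIntegral.integral_deriv_eq_sub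
      (fun x _ => hφd x) (hdc.intervalIntegrable _ _), hz 1 (by simp), hz 0 (by simp),
    sub_self, mul_zero, zero_add, ← integral_neg]
  exact integral_congr_ae (ae_unitMeasure_mem.mono fun x hx => by simp only [htail x hx]; ring)

theorem isH1_of_eq_primitive {w g : ℝ → ℝ} (hg : MemLp g 2 unitMeasure)
    (hw : ∀ x ∈ Icc (0 : ℝ) 1, w x = w 0 + primitive g x) : IsH1 w g := by
  have hgi := hg.integrable one_le_two
  have hc : ContinuousOn w (Icc 0 1) :=
    (continuousOn_const.add (continuousOn_primitive hgi)).congr hw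
  obtain ⟨C, hC⟩ := isCompact_Icc.exists_bound_of_continuousOn hc
  exact ⟨MemLp.of_bound (hc.aestronglyMeasurable measurableSet_Icc) C
    (ae_unitMeasure_mem.mono hC), hg, hasWeakDeriv_primitive hgi hw, hc⟩

theorem eqOn_of_ae_eq_unitMeasure {f g : ℝ → ℝ} (hf : ContinuousOn f (Icc 0 1))
    (hg : ContinuousOn g (Icc 0 1)) (h : f =ᵐ[unitMeasure] g) : EqOn f g (Icc 0 1) :=
  Measure.eqOn_Icc_of_ae_eq volume (zero_ne_one) h hf hg

/-- A smooth function with mean zero and support in `(0,1)` is the derivative of such a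
function. -/
theorem exists_deriv_eq_of_integral_eq_zero {η : ℝ → ℝ} (hη : ContDiff ℝ ∞ η)
    (hc : HasCompactSupport η) (hs : tsupport η ⊆ Ioo 0 1) (h0 : ∫ x in (0 : ℝ)..1, η x = 0) :
    ∃ φ : ℝ → ℝ, ContDiff ℝ ∞ φ ∧ HasCompactSupport φ ∧ tsupport φ ⊆ Ioo 0 1 ∧ deriv φ = η := by
  obtain ⟨a, b, ha, hb, hab⟩ : ∃ a b : ℝ, 0 < a ∧ b < 1 ∧ tsupport η ⊆ Icc a b := by
    rcases (tsupport η).eq_empty_or_nonempty with he | hne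
    · exact ⟨1 / 2, 1 / 2, by norm_num, by norm_num, by simp [he]⟩
    · have hK : IsCompact (tsupport η) := hc
      exact ⟨sInf (tsupport η), sSup (tsupport η), (hs (hK.sInf_mem hne)).1,
        (hs (hK.sSup_mem hne)).2, fun x hx =>
          ⟨csInf_le hK.bddBelow hx, le_csSup hK.bddAbove hx⟩⟩
  have hz : ∀ x, x ∉ Icc a b → η x = 0 := fun x hx =>
    image_eq_zero_of_notMem_tsupport fun h => hx (hab h)
  let φ : ℝ → ℝ := fun x => ∫ y in (0 : ℝ)..x, η y
  have hd : ∀ x, HasDerivAt φ (η x) x := fun x =>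
    intervalIntegral.integral_hasDerivAt_right (hη.continuous.intervalIntegrable _ _)
      (hη.continuous.stronglyMeasurableAtFilter _ _) hη.continuous.continuousAt
  have hderiv : deriv φ = η := funext fun x => (hd x).deriv
  have hsub : Function.support φ ⊆ Icc a b := by
    intro x hx
    by_contra hxab
    apply hx
    rcases lt_or_ge x a with h | h
    · refine intervalIntegral.integral_zero_ae (Eventually.of_forall fun y hy => hz y fun hy' => ?_)
      have := hy.2
      have h3 : max 0 x < a := max_lt ha h
      linarith [hy'.1]
    · have hxb : b < x := lt_of_not_ge fun h' => hxab ⟨h, h'⟩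
      -- To the right of the support, the zero mean of `η` makes its primitive vanish.
      have e : φ x = (∫ y in (0 : ℝ)..1, η y) + ∫ y in (1 : ℝ)..x, η y :=
        (intervalIntegral.integral_add_adjacent_intervals
          (hη.continuous.intervalIntegrable _ _) (hη.continuous.intervalIntegrable _ _)).symm
      rw [e, h0, zero_add]
      refine intervalIntegral.integral_zero_ae (Eventually.of_forall fun y hy => hz y fun hy' => ?_)
      have h3 : b < min 1 x := lt_min hb hxb
      linarith [hy.1, hy'.2]
  have htsub : tsupport φ ⊆ Icc a b := closure_minimal hsub isClosed_Icc
  refine ⟨φ, ?_, ?_, fun x hx => ⟨ha.trans_le (htsub hx).1, (htsub hx).2.trans_lt hb⟩, hderiv⟩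
  · rw [contDiff_infty_iff_deriv, hderiv]
    exact ⟨fun x => (hd x).differentiableAt, hη⟩
  · exact isCompact_Icc.of_isClosed_subset (isClosed_tsupport φ) htsub

/-- A continuous function whose generalized derivative vanishes is constant. -/
theorem eq_const_of_forall_integral_mul_deriv_eq_zero {h : ℝ → ℝ} (hc : ContinuousOn h (Icc 0 1))
    (hh : ∀ φ : ℝ → ℝ, ContDiff ℝ ∞ φ → HasCompactSupport φ → tsupport φ ⊆ Ioo 0 1 →
      ∫ x, h x * deriv φ x ∂unitMeasure = 0) : ∀ x ∈ Icc (0 : ℝ) 1, h x = h 0 := by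
  have hmul : ∀ η : ℝ → ℝ, Continuous η → Integrable (fun x => h x * η x) unitMeasure :=
    fun η hη => (hc.mul hη.continuousOn).integrableOn_compact isCompact_Icc
  let bump : ContDiffBump (1 / 2 : ℝ) := ⟨1 / 8, 1 / 4, by norm_num, by norm_num⟩
  let θ : ℝ → ℝ := bump.normed volume
  have hθs : ContDiff ℝ ∞ θ := bump.contDiff_normed
  have hθc : HasCompactSupport θ := bump.hasCompactSupport_normed
  have hθt : tsupport θ ⊆ Ioo 0 1 := by
    rw [bump.tsupport_normed_eq, Real.closedBall_eq_Icc]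
    intro x hx
    simp only [bump, mem_Icc] at hx
    constructor <;> linarith [hx.1, hx.2]
  have toInterval : ∀ η : ℝ → ℝ, tsupport η ⊆ Ioo 0 1 →
      ∫ x, η x = ∫ x in (0 : ℝ)..1, η x := fun η hη => by
    rw [intervalIntegral.integral_of_le zero_le_one]
    refine (setIntegral_eq_integral_of_forall_compl_eq_zero fun x hx => ?_).symm
    exact image_eq_zero_of_notMem_tsupport fun hx' =>
      hx (Ioo_subset_Ioc_self (hη hx'))
  have hθ1 : ∫ x in (0 : ℝ)..1, θ x = 1 := by
    rw [← toInterval θ hθt]; exact bump.integral_normed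
  set c := ∫ x, h x * θ x ∂unitMeasure with hcdef
  have key : ∀ᵐ x ∂(volume : Measure ℝ), x ∈ Ioo (0 : ℝ) 1 → h x - c = 0 := by
    refine isOpen_Ioo.ae_eq_zero_of_integral_contDiff_smul_eq_zero ?_ fun η hη hηc hηs => ?_
    · exact ((hc.sub continuousOn_const).mono Ioo_subset_Icc_self).locallyIntegrableOn
        measurableSet_Ioo
    · set m := ∫ x in (0 : ℝ)..1, η x with hm
      obtain ⟨φ, h1, h2, h3, h4⟩ := exists_deriv_eq_of_integral_eq_zero
        (η := fun x => η x - m * θ x) (hη.sub (contDiff_const.mul hθs))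
        (hηc.sub (hθc.mul_left (f := fun _ => m)))
        ((tsupport_sub _ _).trans (union_subset hηs
          ((tsupport_mul_subset_right (f := fun _ => m)).trans hθt)))
        (by
          rw [intervalIntegral.integral_sub (hη.continuous.intervalIntegrable _ _)
            ((hθs.continuous.intervalIntegrable _ _).const_mul _),
            intervalIntegral.integral_const_mul, hθ1]
          ring)
      have := hh φ h1 h2 h3
      rw [h4] at this
      have e : ∀ x, h x * (η x - m * θ x) = h x * η x - m * (h x * θ x) := fun x => by ring
      simp_rw [e] at this
      rw [integral_sub (hmul η hη.continuous) ((hmul θ hθs.continuous).const_mul _),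
        integral_const_mul, ← hcdef] at this
      have e2 : ∫ x, η x • (h x - c) = ∫ x in (0 : ℝ)..1, η x • (h x - c) := by
        refine toInterval _ ((closure_mono fun x hx => ?_).trans hηs)
        exact fun h0 => hx (by simp [h0])
      rw [e2, ← integral_unitMeasure]
      have e3 : ∀ x, η x • (h x - c) = h x * η x - c * η x := fun x => by
        rw [smul_eq_mul]; ring
      simp_rw [e3]
      have hηi : Integrable η unitMeasure :=
        hη.continuous.continuousOn.integrableOn_compact isCompact_Icc
      rw [integral_sub (hmul η hη.continuous) (hηi.const_mul _), integral_const_mul,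
        integral_unitMeasure η, ← hm]
      linarith
  have hae : h =ᵐ[unitMeasure] fun _ => c := by
    have : unitMeasure = volume.restrict (Ioo 0 1) := by
      rw [unitMeasure]; exact Measure.restrict_congr_set Ioo_ae_eq_Icc.symm
    rw [this, EventuallyEq, ae_restrict_iff' measurableSet_Ioo]
    filter_upwards [key] with x hx hx'
    linarith [hx hx']
  have heq := eqOn_of_ae_eq_unitMeasure hc continuousOn_const hae
  intro x hx
  rw [heq hx, heq (left_mem_Icc.2 zero_le_one)]

/-- The continuous version of an `H¹` function is the primitive of its generalized derivative. -/
theorem IsH1.eq_primitive {w g : ℝ → ℝ} (h : IsH1 w g) :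
    ∀ x ∈ Icc (0 : ℝ) 1, w x = w 0 + primitive g x := by
  have hgi := h.memLp_deriv.integrable one_le_two
  have hP := continuousOn_primitive hgi
  have hconst := eq_const_of_forall_integral_mul_deriv_eq_zero (h.continuousOn.sub hP)
    fun φ h1 h2 h3 => by
      have hdc : Continuous (deriv φ) := h1.continuous_deriv (by simp)
      have hw := h.hasWeakDeriv φ h1 h2 h3
      have hp := hasWeakDeriv_primitive (w := primitive g) hgi
        (fun x _ => by rw [primitive_zero, zero_add]) φ h1 h2 h3
      simp only [Pi.sub_apply, sub_mul]
      rw [integral_sub, hw, hp, sub_self]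
      · exact (h.continuousOn.mul hdc.continuousOn).integrableOn_compact isCompact_Icc
      · exact (hP.mul hdc.continuousOn).integrableOn_compact isCompact_Icc
  intro x hx
  have := hconst x hx
  simp only [Pi.sub_apply, primitive_zero, sub_zero] at this
  linarith

end WeakDerivative

/-! ### Continuity of translations in `L²`. -/

section Translation

/-- Translation in the first variable is continuous in `L²`. -/
theorem continuous_integral_mul_translate {A B : ℝ × ℝ → ℝ} (hA : MemLp A 2 volume)
    (hB : MemLp B 2 volume) :
    Continuous fun r : ℝ => ∫ p : ℝ × ℝ, A p * B (p.1 - r, p.2) := by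
  have hfact : Fact ((2 : ENNReal) ≠ ⊤) := ⟨by simp⟩
  -- `DomAddAct` provides the continuous action of translations on `Lp`; the integral is an inner
  -- product with an orbit of this action.
  have h1 : Continuous fun r : ℝ =>
      inner ℝ (hA.toLp A) (DomAddAct.mk ((-r, 0) : ℝ × ℝ) +ᵥ hB.toLp B) := by
    have hmk : Continuous fun r : ℝ => DomAddAct.mk ((-r, 0) : ℝ × ℝ) :=
      DomAddAct.continuous_mk.comp (by fun_prop)
    exact continuous_const.inner (continuous_vadd.comp (hmk.prodMk continuous_const))
  refine h1.congr fun r => ?_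
  rw [L2.inner_def]
  rw [DomAddAct.mk_vadd_toLp]
  refine integral_congr_ae ?_
  filter_upwards [hA.coeFn_toLp, MemLp.coeFn_toLp
    (hB.comp_measurePreserving (measurePreserving_vadd ((-r, 0) : ℝ × ℝ) volume))] with p h2 h3
  rw [h2]
  refine Eq.trans (congrArg (inner ℝ (A p)) h3) ?_
  have e : ((-r, 0) : ℝ × ℝ) + p = (p.1 - r, p.2) := by
    ext <;> simp [sub_eq_neg_add]
  simp [e, mul_comm]

end Translation

/-! ### Square integrability and Fubini on products. -/

section ProductMeasure

/-- Integrating out one variable is a contraction of `L²`. -/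
theorem memLp_integral_unitMeasure {α : Type*} [MeasurableSpace α] {ν : Measure α} [SFinite ν]
    {F : α → ℝ → ℝ} (hF : MemLp (fun p : α × ℝ => F p.1 p.2) 2 (ν.prod unitMeasure)) :
    MemLp (fun t => ∫ y, F t y ∂unitMeasure) 2 ν ∧
      ∫ t, (∫ y, F t y ∂unitMeasure) ^ 2 ∂ν ≤ ∫ p, F p.1 p.2 ^ 2 ∂(ν.prod unitMeasure) := by
  have hm : AEStronglyMeasurable (fun t => ∫ y, F t y ∂unitMeasure) ν :=
    hF.1.integral_prod_right'
  have hsq := hF.integrable_sq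
  have h_int : Integrable (fun t => ∫ y, F t y ^ 2 ∂unitMeasure) ν := hsq.integral_prod_left
  have hle : ∀ᵐ t ∂ν, (∫ y, F t y ∂unitMeasure) ^ 2 ≤ ∫ y, F t y ^ 2 ∂unitMeasure :=
    (ae_memLp_slice hF).mono fun t ht => sq_integral_le_integral_sq ht
  have h2 : Integrable (fun t => (∫ y, F t y ∂unitMeasure) ^ 2) ν :=
    h_int.mono' (hm.pow 2) (hle.mono fun t ht => by
      rwa [Real.norm_eq_abs, abs_of_nonneg (sq_nonneg _)])
  refine ⟨(memLp_two_iff_integrable_sq hm).2 h2, ?_⟩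
  rw [integral_prod _ hsq]
  exact integral_mono_ae h2 h_int hle

/-- The kernel is bounded by 1 and `unitMeasure` has mass one, so the Volterra operator contracts
`L²`. The preceding contraction is applied with `α × ℝ` as parameter space and the kernel variable
integrated out. -/
theorem memLp_primitive {α : Type*} [MeasurableSpace α] {ν : Measure α} [IsFiniteMeasure ν]
    {F : α → ℝ → ℝ} (hF : MemLp (fun p : α × ℝ => F p.1 p.2) 2 (ν.prod unitMeasure)) :
    MemLp (fun p : α × ℝ => primitive (F p.1) p.2) 2 (ν.prod unitMeasure) ∧
      ∫ p, primitive (F p.1) p.2 ^ 2 ∂(ν.prod unitMeasure)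
        ≤ ∫ p, F p.1 p.2 ^ 2 ∂(ν.prod unitMeasure) := by
  have hmp : MeasurePreserving (fun z : (α × ℝ) × ℝ => (z.1.1, z.2))
      ((ν.prod unitMeasure).prod unitMeasure) (ν.prod unitMeasure) :=
    (measurePreserving_fst (μ := ν) (ν := unitMeasure)).prod (MeasurePreserving.id unitMeasure)
  have h1 : MemLp (fun z : (α × ℝ) × ℝ => F z.1.1 z.2) 2
      ((ν.prod unitMeasure).prod unitMeasure) := hF.comp_measurePreserving hmp
  have hk : Measurable fun z : (α × ℝ) × ℝ => leKernel z.1.2 z.2 :=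
    measurable_leKernel.comp ((measurable_snd.comp measurable_fst).prodMk measurable_snd)
  have h2 : MemLp (fun z : (α × ℝ) × ℝ => leKernel z.1.2 z.2 * F z.1.1 z.2) 2
      ((ν.prod unitMeasure).prod unitMeasure) :=
    h1.of_le (hk.aestronglyMeasurable.mul h1.1) (Eventually.of_forall fun z => by
      rw [norm_mul]
      exact mul_le_of_le_one_left (norm_nonneg _) (abs_leKernel_le _ _))
  obtain ⟨h3, h4⟩ := memLp_integral_unitMeasure
    (F := fun (p : α × ℝ) y => leKernel p.2 y * F p.1 y) h2
  refine ⟨h3, h4.trans ?_⟩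
  have e : ∫ z, F z.1.1 z.2 ^ 2 ∂((ν.prod unitMeasure).prod unitMeasure)
      = ∫ p, F p.1 p.2 ^ 2 ∂(ν.prod unitMeasure) := by
    have h5 : AEStronglyMeasurable (fun p : α × ℝ => F p.1 p.2 ^ 2)
      (((ν.prod unitMeasure).prod unitMeasure).map fun z : (α × ℝ) × ℝ => (z.1.1, z.2)) := by
      rw [hmp.map_eq]; exact hF.1.pow 2
    have h6 := integral_map hmp.aemeasurable h5
    rw [hmp.map_eq] at h6
    exact h6.symm
  rw [← e]
  refine integral_mono h2.integrable_sq h1.integrable_sq fun z => ?_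
  simp only [mul_pow]
  refine mul_le_of_le_one_left (sq_nonneg _) ?_
  rw [← sq_abs]
  exact pow_le_one₀ (abs_nonneg _) (abs_leKernel_le _ _)

theorem integrable_restrict_prod {α : Type*} [MeasurableSpace α] {ν : Measure α} [SFinite ν]
    {F : α × ℝ → ℝ} (hF : Integrable F (ν.prod unitMeasure)) (s : Set α) :
    Integrable F ((ν.restrict s).prod unitMeasure) :=
  hF.mono_measure (Measure.prod_mono Measure.restrict_le_self le_rfl)

theorem intervalIntegral_integral_swap {T t : ℝ} (ht : t ∈ Icc 0 T) {F : ℝ → ℝ → ℝ}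
    (hF : Integrable (fun p : ℝ × ℝ => F p.1 p.2) ((timeMeasure T).prod unitMeasure)) :
    Integrable (fun y => ∫ s in (0 : ℝ)..t, F s y) unitMeasure ∧
    ∫ s in (0 : ℝ)..t, ∫ y, F s y ∂unitMeasure
      = ∫ y, (∫ s in (0 : ℝ)..t, F s y) ∂unitMeasure := by
  have h := integrable_restrict_prod hF (Iic t)
  simp_rw [intervalIntegral_eq_setIntegral_timeMeasure ht]
  exact ⟨h.integral_prod_right, integral_integral_swap h⟩

theorem intervalIntegrable_of_integrable_timeMeasure {T t : ℝ} (ht : t ∈ Icc 0 T) {f : ℝ → ℝ}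
    (hf : Integrable f (timeMeasure T)) : IntervalIntegrable f volume 0 t := by
  rw [intervalIntegrable_iff_integrableOn_Icc_of_le ht.1]
  exact IntegrableOn.mono_set hf (Icc_subset_Icc_right ht.2)

theorem intervalIntegral_congr_timeMeasure {T t : ℝ} (ht : t ∈ Icc 0 T) {f g : ℝ → ℝ}
    (h : ∀ᵐ s ∂timeMeasure T, f s = g s) : ∫ s in (0 : ℝ)..t, f s = ∫ s in (0 : ℝ)..t, g s := by
  rw [intervalIntegral_eq_setIntegral_timeMeasure ht, intervalIntegral_eq_setIntegral_timeMeasure ht]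
  exact integral_congr_ae (ae_restrict_of_ae h)

theorem memLp_comp_fst {T : ℝ} {q : ℝ → ℝ} (hq : MemLp q 2 (timeMeasure T)) :
    MemLp (fun p : ℝ × ℝ => q p.1) 2 ((timeMeasure T).prod unitMeasure) :=
  hq.comp_measurePreserving (measurePreserving_fst (μ := timeMeasure T) (ν := unitMeasure))

theorem memLp_comp_snd (T : ℝ) {q : ℝ → ℝ} (hq : MemLp q 2 unitMeasure) :
    MemLp (fun p : ℝ × ℝ => q p.2) 2 ((timeMeasure T).prod unitMeasure) :=
  hq.comp_snd (timeMeasure T)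

end ProductMeasure

/-! ### Conservation laws integrated in space and time. -/

section EnergyData

/-- A function `w` on `[0,T] × [0,1]` with generalized space derivative `g` that solves
`∂_t w = ∂_x f` weakly, with fluxes `q₁`, `q₀` into `[0,1]` through the end points and with
initial value `w₀`, tested against monomials. -/
structure IsFluxSolution (T : ℝ) (w g f : ℝ → ℝ → ℝ) (q₀ q₁ w₀ : ℝ → ℝ) : Prop where
  memLp : MemLp (fun p : ℝ × ℝ => w p.1 p.2) 2 ((timeMeasure T).prod unitMeasure)
  memLp_deriv : MemLp (fun p : ℝ × ℝ => g p.1 p.2) 2 ((timeMeasure T).prod unitMeasure)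
  memLp_flux : MemLp (fun p : ℝ × ℝ => f p.1 p.2) 2 ((timeMeasure T).prod unitMeasure)
  memLp_left : MemLp q₀ 2 (timeMeasure T)
  memLp_right : MemLp q₁ 2 (timeMeasure T)
  memLp_init : MemLp w₀ 2 unitMeasure
  eq_primitive : ∀ᵐ t ∂timeMeasure T, ∀ x ∈ Icc (0 : ℝ) 1, w t x = w t 0 + primitive (g t) x
  moments : ∀ᵐ t ∂timeMeasure T, ∀ m : ℕ, ∫ x, (w t x - w₀ x) * x ^ m ∂unitMeasure
    = ∫ s in (0 : ℝ)..t, (-(∫ x, f s x * (m * x ^ (m - 1)) ∂unitMeasure) + q₁ s + q₀ s * 0 ^ m)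

theorem primitive_pow (n : ℕ) {x : ℝ} (hx : x ∈ Icc (0 : ℝ) 1) :
    primitive (fun y => (n + 1) * y ^ n) x = x ^ (n + 1) := by
  rw [primitive_eq_intervalIntegral _ hx, intervalIntegral.integral_const_mul, integral_pow]
  have : (n : ℝ) + 1 ≠ 0 := by positivity
  field_simp
  simp

theorem memLp_pow (n : ℕ) : MemLp (fun x : ℝ => x ^ n) 2 unitMeasure :=
  MemLp.of_bound (by fun_prop) 1 (ae_unitMeasure_mem.mono fun x hx => by
    rw [norm_pow, Real.norm_eq_abs, abs_of_nonneg hx.1]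
    exact pow_le_one₀ hx.1 hx.2)

/-- The trace at `0` is square integrable in time. -/
theorem memLp_trace_zero {T : ℝ} {w g : ℝ → ℝ → ℝ}
    (hw : MemLp (fun p : ℝ × ℝ => w p.1 p.2) 2 ((timeMeasure T).prod unitMeasure))
    (hg : MemLp (fun p : ℝ × ℝ => g p.1 p.2) 2 ((timeMeasure T).prod unitMeasure))
    (h : ∀ᵐ t ∂timeMeasure T, ∀ x ∈ Icc (0 : ℝ) 1, w t x = w t 0 + primitive (g t) x) :
    MemLp (fun t => w t 0) 2 (timeMeasure T) := by
  have h1 := (memLp_integral_unitMeasure (F := fun t x => w t x - primitive (g t) x)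
    (hw.sub (memLp_primitive hg).1)).1
  refine h1.ae_eq ?_
  filter_upwards [h] with t ht
  have : ∫ y, (w t y - primitive (g t) y) ∂unitMeasure = ∫ _, w t 0 ∂unitMeasure :=
    integral_congr_ae (ae_unitMeasure_mem.mono fun x hx => by simp only [ht x hx]; ring)
  rw [this]; simp

theorem memLp_trace_one {T : ℝ} {w g : ℝ → ℝ → ℝ}
    (hw : MemLp (fun p : ℝ × ℝ => w p.1 p.2) 2 ((timeMeasure T).prod unitMeasure))
    (hg : MemLp (fun p : ℝ × ℝ => g p.1 p.2) 2 ((timeMeasure T).prod unitMeasure))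
    (h : ∀ᵐ t ∂timeMeasure T, ∀ x ∈ Icc (0 : ℝ) 1, w t x = w t 0 + primitive (g t) x) :
    MemLp (fun t => w t 1) 2 (timeMeasure T) := by
  refine ((memLp_trace_zero hw hg h).add (memLp_integral_unitMeasure hg).1).ae_eq ?_
  filter_upwards [h] with t ht
  rw [ht 1 (right_mem_Icc.2 zero_le_one), primitive_one]
  rfl

variable {T : ℝ} {w g f : ℝ → ℝ → ℝ} {q₀ q₁ w₀ : ℝ → ℝ}

/-- The conservation law integrated over `[0,1]`. -/
theorem IsFluxSolution.integral_eq (h : IsFluxSolution T w g f q₀ q₁ w₀) :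
    ∀ᵐ t ∂timeMeasure T, ∫ x, (w t x - w₀ x) ∂unitMeasure
      = ∫ s in (0 : ℝ)..t, (q₁ s + q₀ s) := by
  filter_upwards [h.moments] with t ht
  simpa using ht 0

/-- The conservation law integrated over `[y,1]`. -/
theorem IsFluxSolution.tailIntegral_eq (h : IsFluxSolution T w g f q₀ q₁ w₀) :
    ∀ᵐ t ∂timeMeasure T, ∀ᵐ y ∂unitMeasure, tailIntegral (fun x => w t x - w₀ x) y
      = ∫ s in (0 : ℝ)..t, (q₁ s - f s y) := by
  filter_upwards [h.moments, ae_timeMeasure_mem T, ae_memLp_slice h.memLp] with t ht htT hwt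
  have hD : MemLp (fun x => w t x - w₀ x) 2 unitMeasure := hwt.sub h.memLp_init
  have hDi := hD.integrable one_le_two
  have hB : MemLp (fun p : ℝ × ℝ => q₁ p.1 - f p.1 p.2) 2 ((timeMeasure T).prod unitMeasure) :=
    (memLp_comp_fst h.memLp_right).sub h.memLp_flux
  have hBint := (intervalIntegral_integral_swap htT (F := fun s y => q₁ s - f s y)
    (hB.integrable one_le_two)).1
  have htail : Integrable (fun y => tailIntegral (fun x => w t x - w₀ x) y) unitMeasure := by
    have : ∀ y ∈ Icc (0 : ℝ) 1, tailIntegral (fun x => w t x - w₀ x) y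
        = ∫ x in y..1, (w t x - w₀ x) := fun y hy => tailIntegral_eq_intervalIntegral _ hy
    have hc : ContinuousOn (fun y => tailIntegral (fun x => w t x - w₀ x) y) (Icc 0 1) := by
      have hP := continuousOn_primitive hDi
      have hii := intervalIntegrable_of_integrable_unitMeasure hDi
      refine (continuousOn_const.sub hP).congr (f := fun y =>
        (∫ x in (0 : ℝ)..1, (w t x - w₀ x)) - primitive (fun x => w t x - w₀ x) y) fun y hy => ?_
      simp only [this y hy, primitive_eq_intervalIntegral _ hy]
      rw [intervalIntegral.integral_interval_sub_left hii]
      exact hii.mono_set (by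
        rw [uIcc_of_le hy.1, uIcc_of_le zero_le_one]; exact Icc_subset_Icc_right hy.2)
    exact hc.integrableOn_compact isCompact_Icc
  have key := ae_eq_zero_of_moments_eq_zero (a := 0) (b := 1)
    (h := fun y => tailIntegral (fun x => w t x - w₀ x) y - ∫ s in (0 : ℝ)..t, (q₁ s - f s y))
    (htail.sub hBint) ?_
  · filter_upwards [key] with y hy
    linarith
  intro n
  have hn : (0 : ℝ) < n + 1 := by positivity
  have hmulI : ∀ {F : ℝ → ℝ}, Integrable F unitMeasure →
      Integrable (fun y => y ^ n * F y) unitMeasure := fun hF =>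
    hF.bdd_mul (c := 1) (by fun_prop) (ae_unitMeasure_mem.mono fun x hx => by
      rw [norm_pow, Real.norm_eq_abs, abs_of_nonneg hx.1]
      exact pow_le_one₀ hx.1 hx.2)
  have hpi : Integrable (fun y : ℝ => ((n : ℝ) + 1) * y ^ n) unitMeasure :=
    ((memLp_pow n).integrable one_le_two).const_mul _
  -- Since `x ^ (n + 1)` is the primitive of `(n + 1) y ^ n`, moment `n + 1` of the increment is a
  -- multiple of moment `n` of its tail integral.
  have e1 : ∫ x, (w t x - w₀ x) * x ^ (n + 1) ∂unitMeasure
      = (n + 1) * ∫ y, y ^ n * tailIntegral (fun x => w t x - w₀ x) y ∂unitMeasure := by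
    rw [← integral_const_mul]
    have := integral_mul_primitive hDi hpi
    simp only [mul_assoc] at this
    rw [← this]
    refine integral_congr_ae (ae_unitMeasure_mem.mono fun x hx => ?_)
    simp only [primitive_pow n hx]
  have hBn : Integrable (fun p : ℝ × ℝ => p.2 ^ n * (q₁ p.1 - f p.1 p.2))
      ((timeMeasure T).prod unitMeasure) :=
    (memLp_comp_snd T (memLp_pow n)).integrable_mul hB
  have e2 := (intervalIntegral_integral_swap htT (F := fun s y => y ^ n * (q₁ s - f s y)) hBn).2
  -- The left flux drops out because `0 ^ (n + 1) = 0`, and `q₁` is `(n + 1)` times the integral of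
  -- `y ^ n q₁`.
  have e3 : ∫ s in (0 : ℝ)..t, (-(∫ x, f s x * ((n + 1 : ℕ) * x ^ (n + 1 - 1)) ∂unitMeasure)
        + q₁ s + q₀ s * 0 ^ (n + 1))
      = (n + 1) * ∫ s in (0 : ℝ)..t, ∫ y, y ^ n * (q₁ s - f s y) ∂unitMeasure := by
    rw [← intervalIntegral.integral_const_mul]
    refine intervalIntegral_congr_timeMeasure htT ?_
    filter_upwards [ae_memLp_slice h.memLp_flux] with s hs
    have hsi := hs.integrable one_le_two
    have hq : ∫ y, y ^ n * q₁ s ∂unitMeasure = q₁ s / (n + 1) := by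
      rw [integral_mul_const, integral_unitMeasure, integral_pow]
      simp; ring
    simp_rw [mul_sub]
    rw [integral_sub (hmulI (integrable_const _)) (hmulI hsi), hq]
    simp only [Nat.add_sub_cancel, Nat.cast_add, Nat.cast_one]
    have : ∫ x, f s x * ((n + 1) * x ^ n) ∂unitMeasure
        = (n + 1) * ∫ x, x ^ n * f s x ∂unitMeasure := by
      rw [← integral_const_mul]
      exact integral_congr_ae (Eventually.of_forall fun x => by simp only; ring)
    rw [this]
    field_simp
    simp
    ring
  have e4 := ht (n + 1)
  rw [e1, e3, e2] at e4
  have e5 := mul_left_cancel₀ hn.ne' e4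
  have e6 : ∀ y : ℝ, ∫ s in (0 : ℝ)..t, y ^ n * (q₁ s - f s y)
      = y ^ n * ∫ s in (0 : ℝ)..t, (q₁ s - f s y) := fun y =>
    intervalIntegral.integral_const_mul _ _
  simp_rw [e6] at e5
  simp_rw [mul_sub]
  have := integral_sub (hmulI htail) (hmulI hBint)
  rw [unitMeasure] at this e5
  rw [this, e5, sub_self]

end EnergyData

/-! ### Translations in time. -/

section Shift

theorem measurableSet_cylinder (T : ℝ) : MeasurableSet (cylinder T) :=
  measurableSet_Icc.prod measurableSet_Icc

/-- Translation of the first variable preserves Lebesgue measure on the plane. -/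
theorem measurePreserving_shift (r : ℝ) :
    MeasurePreserving (fun p : ℝ × ℝ => (p.1 - r, p.2)) volume volume := by
  rw [Measure.volume_eq_prod]
  exact (measurePreserving_sub_right volume r).prod (MeasurePreserving.id volume)

/-- Fubini in `(r, p)`; the shear `(r, p) ↦ (r, p - (r, 0))` preserves the product measure, which
makes the integrand a product of two `L²` functions. -/
theorem integral_mul_intervalIntegral_translate {A B : ℝ × ℝ → ℝ} (hA : MemLp A 2 volume)
    (hB : MemLp B 2 volume) {h : ℝ} (hh : 0 ≤ h) :
    Integrable (fun p => A p * ∫ r in (0 : ℝ)..h, B (p.1 - r, p.2)) volume ∧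
    ∫ p, A p * ∫ r in (0 : ℝ)..h, B (p.1 - r, p.2)
      = ∫ r in (0 : ℝ)..h, ∫ p : ℝ × ℝ, A p * B (p.1 - r, p.2) := by
  let ν : Measure ℝ := volume.restrict (Ioc 0 h)
  have hfin : IsFiniteMeasure ν := ⟨by simp [ν]⟩
  have hmp : MeasurePreserving (fun z : ℝ × (ℝ × ℝ) => (z.1, ((z.2.1 - z.1, z.2.2) : ℝ × ℝ)))
      (ν.prod volume) (ν.prod volume) :=
    (MeasurePreserving.id ν).skew_product (g := fun (r : ℝ) (p : ℝ × ℝ) => ((p.1 - r, p.2) : ℝ × ℝ))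
      (by fun_prop) (Eventually.of_forall fun r => (measurePreserving_shift r).map_eq)
  have hB2 : MemLp (fun z : ℝ × (ℝ × ℝ) => B (z.2.1 - z.1, z.2.2)) 2 (ν.prod volume) :=
    (hB.comp_snd ν).comp_measurePreserving hmp
  have hA2 : MemLp (fun z : ℝ × (ℝ × ℝ) => A z.2) 2 (ν.prod volume) := hA.comp_snd ν
  have h_int : Integrable (Function.uncurry fun (r : ℝ) (p : ℝ × ℝ) => A p * B (p.1 - r, p.2))
      (ν.prod volume) := hA2.integrable_mul hB2
  simp_rw [intervalIntegral.integral_of_le hh, ← integral_const_mul]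
  exact ⟨h_int.integral_prod_right, (integral_integral_swap h_int).symm⟩

theorem memLp_indicator_cylinder {T : ℝ} {F : ℝ × ℝ → ℝ}
    (hF : MemLp F 2 ((timeMeasure T).prod unitMeasure)) :
    MemLp ((cylinder T).indicator F) 2 volume := by
  rw [memLp_indicator_iff_restrict (measurableSet_cylinder T), restrict_cylinder]
  exact hF

theorem integral_cylinder_eq {T : ℝ} (F : ℝ × ℝ → ℝ) :
    ∫ p, F p ∂((timeMeasure T).prod unitMeasure) = ∫ p, (cylinder T).indicator F p := by
  rw [integral_indicator (measurableSet_cylinder T), restrict_cylinder]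

theorem ae_prod_mem_cylinder (T : ℝ) :
    ∀ᵐ p ∂((timeMeasure T).prod unitMeasure), p ∈ cylinder T := by
  rw [← restrict_cylinder]
  exact ae_restrict_mem (measurableSet_cylinder T)

theorem tailIntegral_sub {D E : ℝ → ℝ} (hD : Integrable D unitMeasure)
    (hE : Integrable E unitMeasure) (y : ℝ) :
    tailIntegral (fun x => D x - E x) y = tailIntegral D y - tailIntegral E y := by
  have hk : ∀ {F : ℝ → ℝ}, Integrable F unitMeasure →
      Integrable (fun x => leKernel x y * F x) unitMeasure := fun hF =>
    hF.bdd_mul (c := 1) (measurable_leKernel.comp measurable_prodMk_right).aestronglyMeasurable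
      (Eventually.of_forall fun x => abs_leKernel_le x y)
  simp only [tailIntegral, mul_sub]
  exact integral_sub (hk hD) (hk hE)

theorem hasDerivAt_nonneg_of_nonneg_right {φ : ℝ → ℝ} {c : ℝ} (h : HasDerivAt φ c 0)
    (h0 : φ 0 = 0) (hφ : ∀ x > 0, 0 ≤ φ x) : 0 ≤ c := by
  have h1 := h.hasDerivWithinAt (s := Ioi 0)
  rw [hasDerivWithinAt_iff_tendsto_slope' (by simp)] at h1
  refine ge_of_tendsto h1 ?_
  filter_upwards [self_mem_nhdsWithin] with x hx
  rw [slope_def_field, h0, sub_zero, sub_zero]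
  exact div_nonneg (hφ x hx) (le_of_lt hx)

end Shift

/-! ### The energy inequality. -/

section Energy

variable {T : ℝ} {w g f : ℝ → ℝ → ℝ} {q₀ q₁ w₀ : ℝ → ℝ}

/-- The function `w` extended by its initial value to negative times. -/
def pastExtension (w : ℝ → ℝ → ℝ) (w₀ : ℝ → ℝ) (t x : ℝ) : ℝ := if t < 0 then w₀ x else w t x

theorem intervalIntegral_indicator_Icc {T t : ℝ} (htT : t ≤ T) (b : ℝ → ℝ) :
    ∫ s in (0 : ℝ)..t, (Icc 0 T).indicator b s = if t < 0 then 0 else ∫ s in (0 : ℝ)..t, b s := by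
  split_ifs with ht
  · refine intervalIntegral.integral_zero_ae ?_
    have : ∀ᵐ s : ℝ, s ≠ 0 := by simp [ae_iff]
    filter_upwards [this] with s hs0 hs
    rw [uIoc_of_ge ht.le] at hs
    exact indicator_of_notMem (fun h => hs0 (le_antisymm hs.2 h.1)) _
  · push Not at ht
    refine intervalIntegral.integral_congr fun s hs => ?_
    rw [uIcc_of_le ht] at hs
    exact indicator_of_mem (show s ∈ Icc 0 T from ⟨hs.1, hs.2.trans htT⟩) _

theorem indicator_cylinder_of_mem {T s y : ℝ} (hy : y ∈ Icc (0 : ℝ) 1) (F : ℝ × ℝ → ℝ) :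
    (cylinder T).indicator F (s, y) = (Icc 0 T).indicator (fun s => F (s, y)) s := by
  by_cases hs : s ∈ Icc 0 T
  · rw [indicator_of_mem hs, indicator_of_mem (show (s, y) ∈ cylinder T from ⟨hs, hy⟩)]
  · rw [indicator_of_notMem hs, indicator_of_notMem fun h => hs h.1]

theorem IsFluxSolution.memLp_sub (h : IsFluxSolution T w g f q₀ q₁ w₀) :
    MemLp (fun p : ℝ × ℝ => q₁ p.1 - f p.1 p.2) 2 ((timeMeasure T).prod unitMeasure) :=
  (memLp_comp_fst h.memLp_right).sub h.memLp_flux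

theorem IsFluxSolution.memLp_add (h : IsFluxSolution T w g f q₀ q₁ w₀) :
    MemLp (fun p : ℝ × ℝ => q₁ p.1 + q₀ p.1) 2 ((timeMeasure T).prod unitMeasure) :=
  (memLp_comp_fst h.memLp_right).add (memLp_comp_fst h.memLp_left)

/-- With `w` frozen at `w₀` and the fluxes extended by zero, the integrated laws also hold at
negative times, so the increments over `[t - r, t]` need no separate treatment when `t < r`. -/
theorem IsFluxSolution.pastExtension_eq (h : IsFluxSolution T w g f q₀ q₁ w₀) :
    ∀ᵐ t : ℝ, t ≤ T → Integrable (pastExtension w w₀ t) unitMeasure ∧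
      (∫ x, (pastExtension w w₀ t x - w₀ x) ∂unitMeasure
        = ∫ s in (0 : ℝ)..t, (Icc 0 T).indicator (fun s => q₁ s + q₀ s) s) ∧
      ∀ᵐ y ∂unitMeasure, tailIntegral (fun x => pastExtension w w₀ t x - w₀ x) y
        = ∫ s in (0 : ℝ)..t, (cylinder T).indicator (fun p => q₁ p.1 - f p.1 p.2) (s, y) := by
  have h1 := h.integral_eq
  have h2 := h.tailIntegral_eq
  have h3 := ae_memLp_slice h.memLp
  simp only [timeMeasure] at h1 h2 h3
  rw [ae_restrict_iff' measurableSet_Icc] at h1 h2 h3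
  filter_upwards [h1, h2, h3] with t h1 h2 h3 htT
  rw [intervalIntegral_indicator_Icc htT]
  by_cases ht : t < 0
  · have e : pastExtension w w₀ t = w₀ := funext fun x => by simp [pastExtension, ht]
    simp only [e, ht, if_true, sub_self, integral_zero, true_and]
    refine ⟨h.memLp_init.integrable one_le_two, ?_⟩
    filter_upwards [ae_unitMeasure_mem] with y hy
    simp_rw [indicator_cylinder_of_mem hy]
    rw [intervalIntegral_indicator_Icc htT, if_pos ht]
    simp [tailIntegral]
  · have e : pastExtension w w₀ t = w t := funext fun x => by simp [pastExtension, ht]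
    simp only [e, ht, if_false]
    have htm : t ∈ Icc 0 T := ⟨not_lt.1 ht, htT⟩
    refine ⟨(h3 htm).integrable one_le_two, h1 htm, ?_⟩
    filter_upwards [ae_unitMeasure_mem, h2 htm] with y hy h2
    simp_rw [indicator_cylinder_of_mem hy]
    rw [intervalIntegral_indicator_Icc htT, if_neg ht]
    exact h2

/-- The difference of the laws at `t` and `t - r`. In the variable `t - s` the increment is an
integral over `s ∈ [0, r]` of translated fluxes, the form to which continuity of translations
applies. -/
theorem IsFluxSolution.increment_eq (h : IsFluxSolution T w g f q₀ q₁ w₀) {r : ℝ} (hr : 0 < r) :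
    ∀ᵐ t ∂timeMeasure T, Integrable (fun x => w t x - pastExtension w w₀ (t - r) x) unitMeasure ∧
      (∫ x, (w t x - pastExtension w w₀ (t - r) x) ∂unitMeasure
        = ∫ s in (0 : ℝ)..r, (Icc 0 T).indicator (fun s => q₁ s + q₀ s) (t - s)) ∧
      ∀ᵐ y ∂unitMeasure, tailIntegral (fun x => w t x - pastExtension w w₀ (t - r) x) y
        = ∫ s in (0 : ℝ)..r, (cylinder T).indicator (fun p => q₁ p.1 - f p.1 p.2) (t - s, y) := by
  have h1 := h.pastExtension_eq
  have h2 := (measurePreserving_sub_right volume r).quasiMeasurePreserving.ae h1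
  have hB : ∀ᵐ y ∂unitMeasure, Integrable (fun s => (cylinder T).indicator
      (fun p => q₁ p.1 - f p.1 p.2) (s, y)) volume := by
    have h4 := (h.memLp_sub.integrable one_le_two).swap.prod_right_ae
    filter_upwards [h4, ae_unitMeasure_mem] with y hy hy1
    simp_rw [indicator_cylinder_of_mem hy1]
    exact (integrable_indicator_iff measurableSet_Icc).2 hy
  have hb : Integrable ((Icc 0 T).indicator fun s => q₁ s + q₀ s) volume :=
    (integrable_indicator_iff measurableSet_Icc).2
      ((h.memLp_right.add h.memLp_left).integrable one_le_two)
  rw [timeMeasure, ae_restrict_iff' measurableSet_Icc]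
  filter_upwards [h1, h2] with t h1 h2 ht
  obtain ⟨i1, a1, b1⟩ := h1 ht.2
  obtain ⟨i2, a2, b2⟩ := h2 (by linarith [ht.2])
  have e : pastExtension w w₀ t = w t := funext fun x => by
    simp [pastExtension, not_lt.2 ht.1]
  rw [e] at i1 a1 b1
  have i0 := h.memLp_init.integrable one_le_two
  have j1 : Integrable (fun x => w t x - w₀ x) unitMeasure := i1.sub i0
  have j2 : Integrable (fun x => pastExtension w w₀ (t - r) x - w₀ x) unitMeasure := i2.sub i0
  have e2 : (fun x => w t x - pastExtension w w₀ (t - r) x)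
      = fun x => (w t x - w₀ x) - (pastExtension w w₀ (t - r) x - w₀ x) := by
    ext x; ring
  refine ⟨i1.sub i2, ?_, ?_⟩
  · rw [e2, integral_sub j1 j2, a1, a2, intervalIntegral.integral_comp_sub_left, sub_zero]
    exact intervalIntegral.integral_interval_sub_left hb.intervalIntegrable hb.intervalIntegrable
  · filter_upwards [b1, b2, hB] with y b1 b2 hB
    rw [e2, tailIntegral_sub j1 j2, b1, b2]
    have := intervalIntegral.integral_comp_sub_left (a := 0) (b := r) (fun s =>
      (cylinder T).indicator (fun p => q₁ p.1 - f p.1 p.2) (s, y)) t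
    rw [this, sub_zero]
    exact intervalIntegral.integral_interval_sub_left hB.intervalIntegrable hB.intervalIntegrable

variable {ρ : ℝ → ℝ}

/-- The increment of `w` over a time step, tested against `firstPrim ρ ∘ w`. -/
theorem IsFluxSolution.integral_increment_mul (h : IsFluxSolution T w g f q₀ q₁ w₀)
    (hρ : Continuous ρ) (h0 : ∀ a, 0 ≤ ρ a) (h1 : ∀ a, ρ a ≤ 1) {r : ℝ} (hr : 0 < r) :
    ∀ᵐ t ∂timeMeasure T,
      ∫ x, firstPrim ρ (w t x) * (w t x - pastExtension w w₀ (t - r) x) ∂unitMeasure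
      = ∫ y, (firstPrim ρ (w t 0) * (∫ s in (0 : ℝ)..r, (cylinder T).indicator
            (fun p => q₁ p.1 + q₀ p.1) (t - s, y))
          + ρ (w t y) * g t y * ∫ s in (0 : ℝ)..r, (cylinder T).indicator
            (fun p => q₁ p.1 - f p.1 p.2) (t - s, y)) ∂unitMeasure := by
  filter_upwards [h.increment_eq hr, h.eq_primitive, ae_memLp_slice h.memLp_deriv]
    with t ⟨i1, a1, b1⟩ hp hg
  have hgi := hg.integrable one_le_two
  have hwc : ContinuousOn (w t) (Icc 0 1) :=
    (continuousOn_const.add (continuousOn_primitive hgi)).congr hp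
  have hξ : Integrable (fun y => ρ (w t y) * g t y) unitMeasure :=
    hgi.bdd_mul (c := 1)
      ((hρ.comp_continuousOn hwc).aestronglyMeasurable measurableSet_Icc)
      (Eventually.of_forall fun x => by
        rw [Real.norm_eq_abs, abs_of_nonneg (h0 _)]; exact h1 _)
  set D := fun x => w t x - pastExtension w w₀ (t - r) x with hD
  -- By the chain rule `firstPrim ρ ∘ w t` is a constant plus the primitive of `ρ(w) g`. The
  -- constant sees only the total mass of `D`, and the primitive sees its tail integrals.
  have e1 : ∫ x, firstPrim ρ (w t x) * D x ∂unitMeasure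
      = ∫ x, (firstPrim ρ (w t 0) * D x
        + D x * primitive (fun y => ρ (w t y) * g t y) x) ∂unitMeasure :=
    integral_congr_ae (ae_unitMeasure_mem.mono fun x hx => by
      simp only [firstPrim_comp_primitive hρ h0 h1 hgi hp x hx]; ring)
  have hDP : Integrable (fun x => D x * primitive (fun y => ρ (w t y) * g t y) x) unitMeasure := by
    obtain ⟨C, hC⟩ := isCompact_Icc.exists_bound_of_continuousOn (continuousOn_primitive hξ)
    exact i1.mul_bdd (c := C)
      ((continuousOn_primitive hξ).aestronglyMeasurable measurableSet_Icc)
      (ae_unitMeasure_mem.mono hC)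
  have hξt : Integrable (fun y => ρ (w t y) * g t y * tailIntegral D y) unitMeasure := by
    refine hξ.mul_bdd (c := ∫ x, |D x| ∂unitMeasure) ?_ (Eventually.of_forall fun y => ?_)
    · have hm : AEStronglyMeasurable (fun z : ℝ × ℝ => leKernel z.2 z.1 * D z.2)
          (unitMeasure.prod unitMeasure) :=
        (measurable_leKernel.comp measurable_swap).aestronglyMeasurable.mul
          i1.aestronglyMeasurable.comp_snd
      exact hm.integral_prod_right'
    · refine abs_integral_le_integral_abs.trans (integral_mono_of_nonneg
        (Eventually.of_forall fun x => abs_nonneg _) i1.abs (Eventually.of_forall fun x => ?_))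
      simp only [abs_mul]
      exact mul_le_of_le_one_left (abs_nonneg _) (abs_leKernel_le x y)
  rw [e1, integral_add (i1.const_mul _) hDP, integral_const_mul, a1, integral_mul_primitive i1 hξ]
  have e2 : ∫ y, (firstPrim ρ (w t 0) * (∫ s in (0 : ℝ)..r, (cylinder T).indicator
            (fun p => q₁ p.1 + q₀ p.1) (t - s, y))
          + ρ (w t y) * g t y * ∫ s in (0 : ℝ)..r, (cylinder T).indicator
            (fun p => q₁ p.1 - f p.1 p.2) (t - s, y)) ∂unitMeasure
      = ∫ y, (firstPrim ρ (w t 0) * (∫ s in (0 : ℝ)..r,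
          (Icc 0 T).indicator (fun s => q₁ s + q₀ s) (t - s))
        + ρ (w t y) * g t y * tailIntegral D y) ∂unitMeasure := by
    refine integral_congr_ae ?_
    filter_upwards [ae_unitMeasure_mem, b1] with y hy b1
    simp only [b1, indicator_cylinder_of_mem hy]
  rw [e2, integral_add (integrable_const _) hξt]
  simp

theorem memLp_firstPrim_comp {α : Type*} [MeasurableSpace α] {μ : Measure α} {F : α → ℝ}
    (hρ : Continuous ρ) (h0 : ∀ a, 0 ≤ ρ a) (h1 : ∀ a, ρ a ≤ 1) (hF : MemLp F 2 μ) :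
    MemLp (fun p => firstPrim ρ (F p)) 2 μ :=
  hF.of_le ((continuous_firstPrim hρ).comp_aestronglyMeasurable hF.1)
    (Eventually.of_forall fun _ => abs_firstPrim_le hρ h0 h1 _)

theorem integrable_secondPrim_comp {α : Type*} [MeasurableSpace α] {μ : Measure α} {F : α → ℝ}
    (hρ : Continuous ρ) (h0 : ∀ a, 0 ≤ ρ a) (h1 : ∀ a, ρ a ≤ 1) (hF : MemLp F 2 μ) :
    Integrable (fun p => secondPrim ρ (F p)) μ :=
  hF.integrable_sq.mono' ((continuous_secondPrim hρ).comp_aestronglyMeasurable hF.1)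
    (Eventually.of_forall fun p => by
      rw [Real.norm_eq_abs, abs_of_nonneg (secondPrim_nonneg hρ h0 _)]
      exact secondPrim_le_sq hρ h0 h1 _)

theorem memLp_exp_mul {T K : ℝ} (hK : 0 ≤ K) {F : ℝ × ℝ → ℝ}
    (hF : MemLp F 2 ((timeMeasure T).prod unitMeasure)) :
    MemLp (fun p => Real.exp (-(K * p.1)) * F p) 2 ((timeMeasure T).prod unitMeasure) := by
  refine hF.of_le (AEStronglyMeasurable.mul (by fun_prop) hF.1) ?_
  filter_upwards [ae_prod_mem_cylinder T] with p hp
  rw [norm_mul, Real.norm_eq_abs, abs_of_pos (Real.exp_pos _)]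
  refine mul_le_of_le_one_left (norm_nonneg _) (Real.exp_le_one_iff.2 ?_)
  have := mul_nonneg hK hp.1.1
  linarith

theorem integrable_exp_mul {T K : ℝ} (hK : 0 ≤ K) {F : ℝ × ℝ → ℝ}
    (hF : Integrable F ((timeMeasure T).prod unitMeasure)) :
    Integrable (fun p => Real.exp (-(K * p.1)) * F p) ((timeMeasure T).prod unitMeasure) := by
  refine hF.bdd_mul (c := 1) (by fun_prop) ?_
  filter_upwards [ae_prod_mem_cylinder T] with p hp
  rw [Real.norm_eq_abs, abs_of_pos (Real.exp_pos _)]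
  refine Real.exp_le_one_iff.2 ?_
  have := mul_nonneg hK hp.1.1
  linarith

theorem memLp_pastExtension_shift (h : IsFluxSolution T w g f q₀ q₁ w₀) {r : ℝ} (hr : 0 < r) :
    MemLp (fun p : ℝ × ℝ => pastExtension w w₀ (p.1 - r) p.2) 2
      ((timeMeasure T).prod unitMeasure) := by
  have h1 : MemLp (fun p : ℝ × ℝ => (cylinder T).indicator (fun p => w p.1 p.2) (p.1 - r, p.2)) 2
      ((timeMeasure T).prod unitMeasure) := by
    rw [← restrict_cylinder]
    exact ((memLp_indicator_cylinder h.memLp).comp_measurePreserving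
      (measurePreserving_shift r)).restrict _
  have hs : MeasurableSet {p : ℝ × ℝ | p.1 < r} := measurableSet_lt measurable_fst measurable_const
  have h2 := (memLp_comp_snd T h.memLp_init).indicator hs
  refine (h1.add h2).ae_eq ?_
  filter_upwards [ae_prod_mem_cylinder T] with p hp
  by_cases hpr : p.1 < r
  · have : (p.1 - r, p.2) ∉ cylinder T := fun h' => by
      have := h'.1.1; simp only at this; linarith
    simp [pastExtension, hpr, this]
  · have : (p.1 - r, p.2) ∈ cylinder T :=
      ⟨⟨by simp only; linarith, by simp only; linarith [hp.1.2]⟩, hp.2⟩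
    simp [pastExtension, hpr, this]

/-- The discrete energy inequality. -/
theorem IsFluxSolution.discrete_energy_le (h : IsFluxSolution T w g f q₀ q₁ w₀)
    (hρ : Continuous ρ) (h0 : ∀ a, 0 ≤ ρ a) (h1 : ∀ a, ρ a ≤ 1)
    (hinit : ∀ᵐ x ∂unitMeasure, secondPrim ρ (w₀ x) = 0) {K r : ℝ} (hK : 0 ≤ K) (hr : 0 < r) :
    (1 - Real.exp (-(K * r))) * ∫ p, Real.exp (-(K * p.1)) * secondPrim ρ (w p.1 p.2)
        ∂((timeMeasure T).prod unitMeasure)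
      ≤ ∫ p, Real.exp (-(K * p.1)) *
          (firstPrim ρ (w p.1 p.2) * (w p.1 p.2 - pastExtension w w₀ (p.1 - r) p.2))
        ∂((timeMeasure T).prod unitMeasure) := by
  have hP := memLp_pastExtension_shift h hr
  have iΨ := integrable_exp_mul hK (integrable_secondPrim_comp hρ h0 h1 h.memLp)
  have iΨP := integrable_exp_mul hK (integrable_secondPrim_comp hρ h0 h1 hP)
  have iD := integrable_exp_mul hK
    ((memLp_firstPrim_comp hρ h0 h1 h.memLp).integrable_mul (h.memLp.sub hP))
  -- A shift by `r` turns the weight into `e^{-Kr}` times itself. Times below `r` contribute nothing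
  -- since `secondPrim ρ` vanishes on `w₀`, and nonnegativity allows the part of the shifted
  -- cylinder beyond `T` to be added.
  have hpast : ∫ p, Real.exp (-(K * p.1)) * secondPrim ρ (pastExtension w w₀ (p.1 - r) p.2)
        ∂((timeMeasure T).prod unitMeasure)
      ≤ Real.exp (-(K * r)) * ∫ p, Real.exp (-(K * p.1)) * secondPrim ρ (w p.1 p.2)
        ∂((timeMeasure T).prod unitMeasure) := by
    set V : ℝ × ℝ → ℝ := (cylinder T).indicator
      fun p => Real.exp (-(K * p.1)) * secondPrim ρ (w p.1 p.2) with hV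
    have hVn : ∀ p, 0 ≤ V p := fun p => indicator_nonneg (fun _ _ =>
      mul_nonneg (Real.exp_pos _).le (secondPrim_nonneg hρ h0 _)) p
    have hVi : Integrable V volume := by
      rw [hV, integrable_indicator_iff (measurableSet_cylinder T), IntegrableOn,
        restrict_cylinder]
      exact iΨ
    have hVs : Integrable (fun p : ℝ × ℝ => V (p.1 - r, p.2)) volume :=
      (measurePreserving_shift r).integrable_comp_of_integrable hVi
    have e1 : ∫ p : ℝ × ℝ, V (p.1 - r, p.2) = ∫ p, V p := by
      have hmp := measurePreserving_shift r
      have := integral_map hmp.aemeasurable (f := V) (by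
        rw [hmp.map_eq]; exact hVi.aestronglyMeasurable)
      rw [hmp.map_eq] at this
      exact this.symm
    rw [integral_cylinder_eq (F := fun p => Real.exp (-(K * p.1)) * secondPrim ρ (w p.1 p.2)),
      ← hV, ← e1]
    have hinit' : ∀ᵐ p ∂((timeMeasure T).prod unitMeasure), secondPrim ρ (w₀ p.2) = 0 :=
      Measure.quasiMeasurePreserving_snd.ae hinit
    have e2 : ∫ p, Real.exp (-(K * p.1)) * secondPrim ρ (pastExtension w w₀ (p.1 - r) p.2)
        ∂((timeMeasure T).prod unitMeasure)
        = ∫ p, Real.exp (-(K * r)) * V (p.1 - r, p.2) ∂((timeMeasure T).prod unitMeasure) := by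
      refine integral_congr_ae ?_
      filter_upwards [ae_prod_mem_cylinder T, hinit'] with p hp hp0
      by_cases hpr : p.1 < r
      · have : (p.1 - r, p.2) ∉ cylinder T := fun h' => by
          have := h'.1.1; simp only at this; linarith
        simp [pastExtension, hpr, hV, this, hp0]
      · have : (p.1 - r, p.2) ∈ cylinder T :=
          ⟨⟨by simp only; linarith, by simp only; linarith [hp.1.2]⟩, hp.2⟩
        simp only [pastExtension, hV, indicator_of_mem this, sub_neg, hpr, if_false]
        rw [← mul_assoc, ← Real.exp_add]
        congr 2; ring
    rw [e2, integral_const_mul]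
    refine mul_le_mul_of_nonneg_left ?_ (Real.exp_pos _).le
    rw [← restrict_cylinder]
    exact setIntegral_le_integral hVs (Eventually.of_forall fun p => hVn _)
  have hmono : ∫ p, (Real.exp (-(K * p.1)) * secondPrim ρ (w p.1 p.2)
        - Real.exp (-(K * p.1)) * secondPrim ρ (pastExtension w w₀ (p.1 - r) p.2))
        ∂((timeMeasure T).prod unitMeasure)
      ≤ ∫ p, Real.exp (-(K * p.1)) *
          (firstPrim ρ (w p.1 p.2) * (w p.1 p.2 - pastExtension w w₀ (p.1 - r) p.2))
        ∂((timeMeasure T).prod unitMeasure) := by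
    refine integral_mono (iΨ.sub iΨP) iD fun p => ?_
    simp only [← mul_sub]
    exact mul_le_mul_of_nonneg_left (secondPrim_sub_le hρ h0 _ _) (Real.exp_pos _).le
  rw [integral_sub iΨ iΨP] at hmono
  linarith

/-- The energy inequality for a convex function with bounded second derivative `ρ`. -/
theorem IsFluxSolution.energy_le (h : IsFluxSolution T w g f q₀ q₁ w₀)
    (hρ : Continuous ρ) (h0 : ∀ a, 0 ≤ ρ a) (h1 : ∀ a, ρ a ≤ 1)
    (hinit : ∀ᵐ x ∂unitMeasure, secondPrim ρ (w₀ x) = 0) {K : ℝ} (hK : 0 ≤ K) :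
    K * ∫ p, Real.exp (-(K * p.1)) * secondPrim ρ (w p.1 p.2) ∂((timeMeasure T).prod unitMeasure)
      ≤ ∫ p, Real.exp (-(K * p.1)) * (q₁ p.1 * firstPrim ρ (w p.1 1)
          + q₀ p.1 * firstPrim ρ (w p.1 0) - f p.1 p.2 * (ρ (w p.1 p.2) * g p.1 p.2))
        ∂((timeMeasure T).prod unitMeasure) := by
  set Q := (timeMeasure T).prod unitMeasure with hQ
  set Y := ∫ p, Real.exp (-(K * p.1)) * secondPrim ρ (w p.1 p.2) ∂Q with hY
  have hw0 := memLp_trace_zero h.memLp h.memLp_deriv h.eq_primitive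
  have hw1 := memLp_trace_one h.memLp h.memLp_deriv h.eq_primitive
  have hξ : MemLp (fun p : ℝ × ℝ => ρ (w p.1 p.2) * g p.1 p.2) 2 Q :=
    h.memLp_deriv.of_le ((hρ.comp_aestronglyMeasurable h.memLp.1).mul h.memLp_deriv.1)
      (Eventually.of_forall fun p => by
        rw [norm_mul, Real.norm_eq_abs, abs_of_nonneg (h0 _)]
        exact mul_le_of_le_one_left (norm_nonneg _) (h1 _))
  have hf0 : MemLp (fun p : ℝ × ℝ => firstPrim ρ (w p.1 0)) 2 Q :=
    memLp_firstPrim_comp hρ h0 h1 (memLp_comp_fst hw0)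
  have hf1 : MemLp (fun p : ℝ × ℝ => firstPrim ρ (w p.1 1)) 2 Q :=
    memLp_firstPrim_comp hρ h0 h1 (memLp_comp_fst hw1)
  set A₁ : ℝ × ℝ → ℝ := (cylinder T).indicator
    fun p => Real.exp (-(K * p.1)) * firstPrim ρ (w p.1 0) with hA₁
  set A₂ : ℝ × ℝ → ℝ := (cylinder T).indicator
    fun p => Real.exp (-(K * p.1)) * (ρ (w p.1 p.2) * g p.1 p.2) with hA₂
  set B₁ : ℝ × ℝ → ℝ := (cylinder T).indicator fun p => q₁ p.1 + q₀ p.1 with hB₁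
  set B₂ : ℝ × ℝ → ℝ := (cylinder T).indicator fun p => q₁ p.1 - f p.1 p.2 with hB₂
  have mA₁ : MemLp A₁ 2 volume := memLp_indicator_cylinder (memLp_exp_mul hK hf0)
  have mA₂ : MemLp A₂ 2 volume := memLp_indicator_cylinder (memLp_exp_mul hK hξ)
  have mB₁ : MemLp B₁ 2 volume := memLp_indicator_cylinder h.memLp_add
  have mB₂ : MemLp B₂ 2 volume := memLp_indicator_cylinder h.memLp_sub
  -- The correlation of the test quantities with the fluxes at lag `r`. The discrete inequality
  -- reads `(1 - e^{-Kr}) Y ≤ ∫₀^r Γ`, with equality at `r = 0`, so comparing derivatives there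
  -- gives `K Y ≤ Γ 0`.
  let Γ : ℝ → ℝ := fun r => (∫ p : ℝ × ℝ, A₁ p * B₁ (p.1 - r, p.2))
    + ∫ p : ℝ × ℝ, A₂ p * B₂ (p.1 - r, p.2)
  have c₁ := continuous_integral_mul_translate mA₁ mB₁
  have c₂ := continuous_integral_mul_translate mA₂ mB₂
  have hΓ : Continuous Γ := c₁.add c₂
  have step : ∀ r > 0, (1 - Real.exp (-(K * r))) * Y ≤ ∫ s in (0 : ℝ)..r, Γ s := by
    intro r hr
    refine (h.discrete_energy_le hρ h0 h1 hinit hK hr).trans_eq ?_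
    have iD : Integrable (fun p : ℝ × ℝ => Real.exp (-(K * p.1)) *
        (firstPrim ρ (w p.1 p.2) * (w p.1 p.2 - pastExtension w w₀ (p.1 - r) p.2))) Q :=
      integrable_exp_mul hK ((memLp_firstPrim_comp hρ h0 h1 h.memLp).integrable_mul
        (h.memLp.sub (memLp_pastExtension_shift h hr)))
    obtain ⟨k₁, s₁⟩ := integral_mul_intervalIntegral_translate mA₁ mB₁ hr.le
    obtain ⟨k₂, s₂⟩ := integral_mul_intervalIntegral_translate mA₂ mB₂ hr.le
    have hsum : ∫ s in (0 : ℝ)..r, Γ s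
        = ∫ p, (A₁ p * (∫ s in (0 : ℝ)..r, B₁ (p.1 - s, p.2))
          + A₂ p * ∫ s in (0 : ℝ)..r, B₂ (p.1 - s, p.2)) := by
      rw [integral_add k₁ k₂, s₁, s₂]
      exact intervalIntegral.integral_add (c₁.intervalIntegrable _ _) (c₂.intervalIntegrable _ _)
    let Z : ℝ × ℝ → ℝ := fun p => Real.exp (-(K * p.1)) *
      (firstPrim ρ (w p.1 0) * (∫ s in (0 : ℝ)..r, B₁ (p.1 - s, p.2))
        + ρ (w p.1 p.2) * g p.1 p.2 * ∫ s in (0 : ℝ)..r, B₂ (p.1 - s, p.2))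
    have hZ : (fun p => A₁ p * (∫ s in (0 : ℝ)..r, B₁ (p.1 - s, p.2))
          + A₂ p * ∫ s in (0 : ℝ)..r, B₂ (p.1 - s, p.2)) = (cylinder T).indicator Z := by
      ext p
      by_cases hp : p ∈ cylinder T
      · simp only [hA₁, hA₂, indicator_of_mem hp, Z]; ring
      · simp only [hA₁, hA₂, indicator_of_notMem hp]; ring
    have iZ : Integrable Z Q := by
      have := k₁.add k₂
      have e : ((fun p => A₁ p * (∫ s in (0 : ℝ)..r, B₁ (p.1 - s, p.2)))
          + fun p => A₂ p * ∫ s in (0 : ℝ)..r, B₂ (p.1 - s, p.2)) = (cylinder T).indicator Z := hZ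
      rw [e, integrable_indicator_iff (measurableSet_cylinder T), IntegrableOn,
        restrict_cylinder] at this
      exact this
    rw [hsum, hZ, ← integral_cylinder_eq, integral_prod _ iD, integral_prod _ iZ]
    refine integral_congr_ae ?_
    filter_upwards [h.integral_increment_mul hρ h0 h1 hr] with t ht
    simp only [Z, integral_const_mul]
    exact congrArg _ ht
  have hd : HasDerivAt (fun r => (∫ s in (0 : ℝ)..r, Γ s) - (1 - Real.exp (-(K * r))) * Y)
      (Γ 0 - K * Y) 0 := by
    have d1 : HasDerivAt (fun r => ∫ s in (0 : ℝ)..r, Γ s) (Γ 0) 0 :=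
      intervalIntegral.integral_hasDerivAt_right (hΓ.intervalIntegrable _ _)
        (hΓ.stronglyMeasurableAtFilter _ _) hΓ.continuousAt
    have d2 : HasDerivAt (fun r : ℝ => Real.exp (-(K * r))) (-K) 0 := by
      have := (((hasDerivAt_id (0 : ℝ)).const_mul K).neg).exp
      simpa using this
    have := d1.fun_sub ((d2.const_sub 1).mul_const Y)
    simpa using this
  have hle := hasDerivAt_nonneg_of_nonneg_right hd (by simp) fun r hr =>
    sub_nonneg.2 (step r hr)
  refine (sub_nonneg.1 hle).trans_eq ?_
  have mp := mA₁.integrable_mul mB₁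
  have mp2 := mA₂.integrable_mul mB₂
  have iξq : Integrable (fun p : ℝ × ℝ => Real.exp (-(K * p.1)) *
      (q₁ p.1 * (ρ (w p.1 p.2) * g p.1 p.2))) Q :=
    integrable_exp_mul hK ((memLp_comp_fst h.memLp_right).integrable_mul hξ)
  have iother : Integrable (fun p : ℝ × ℝ => Real.exp (-(K * p.1)) *
      ((q₁ p.1 + q₀ p.1) * firstPrim ρ (w p.1 0) - f p.1 p.2 * (ρ (w p.1 p.2) * g p.1 p.2))) Q :=
    integrable_exp_mul hK ((h.memLp_add.integrable_mul hf0).sub (h.memLp_flux.integrable_mul hξ))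
  have iq1 : Integrable (fun p : ℝ × ℝ => Real.exp (-(K * p.1)) *
      (q₁ p.1 * (firstPrim ρ (w p.1 1) - firstPrim ρ (w p.1 0)))) Q :=
    integrable_exp_mul hK ((memLp_comp_fst h.memLp_right).integrable_mul (hf1.sub hf0))
  have hΓ0 : Γ 0 = ∫ p, (Real.exp (-(K * p.1)) * (q₁ p.1 * (ρ (w p.1 p.2) * g p.1 p.2))
      + Real.exp (-(K * p.1)) * ((q₁ p.1 + q₀ p.1) * firstPrim ρ (w p.1 0)
        - f p.1 p.2 * (ρ (w p.1 p.2) * g p.1 p.2))) ∂Q := by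
    have : Γ 0 = ∫ p, (A₁ p * B₁ p + A₂ p * B₂ p) := by
      simp only [Γ, sub_zero, Prod.mk.eta]
      exact (integral_add mp mp2).symm
    rw [this, hQ, integral_cylinder_eq]
    refine integral_congr_ae (Eventually.of_forall fun p => ?_)
    by_cases hp : p ∈ cylinder T
    · simp only [hA₁, hA₂, hB₁, hB₂, indicator_of_mem hp]; ring
    · simp only [hA₁, hA₂, hB₁, hB₂, indicator_of_notMem hp]; ring
  rw [hΓ0, integral_add iξq iother]
  -- The space integral of `ρ(w) g` is the difference of `firstPrim ρ (w)` between the end points;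
  -- this moves `q₁` from the left trace to the right one.
  have e1 : ∫ p : ℝ × ℝ, Real.exp (-(K * p.1)) * (q₁ p.1 * (ρ (w p.1 p.2) * g p.1 p.2)) ∂Q
      = ∫ p : ℝ × ℝ, Real.exp (-(K * p.1)) *
        (q₁ p.1 * (firstPrim ρ (w p.1 1) - firstPrim ρ (w p.1 0))) ∂Q := by
    rw [integral_prod _ iξq, integral_prod _ iq1]
    refine integral_congr_ae ?_
    filter_upwards [h.eq_primitive, ae_memLp_slice h.memLp_deriv] with t hp hg
    simp only [integral_const_mul]
    have := firstPrim_comp_primitive hρ h0 h1 (hg.integrable one_le_two) hp 1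
      (right_mem_Icc.2 zero_le_one)
    rw [primitive_one] at this
    rw [this]; simp
  rw [e1, ← integral_add iq1 iother]
  exact integral_congr_ae (Eventually.of_forall fun p => by simp only; ring)

end Energy

/-! ### Regularity and integrability of test functions. -/

section Cylinder

variable {T : ℝ}

theorem isCompact_cylinder (T : ℝ) : IsCompact (cylinder T) := isCompact_Icc.prod isCompact_Icc

theorem exists_bound_of_continuousOn_cylinder {F : ℝ × ℝ → ℝ} (hF : ContinuousOn F (cylinder T)) :
    ∃ C, 0 ≤ C ∧ ∀ p ∈ cylinder T, |F p| ≤ C := by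
  obtain ⟨C, hC⟩ := (isCompact_cylinder T).exists_bound_of_continuousOn hF
  exact ⟨max C 0, le_max_right _ _, fun p hp => (hC p hp).trans (le_max_left _ _)⟩

theorem aestronglyMeasurable_of_continuousOn_cylinder {F : ℝ × ℝ → ℝ}
    (hF : ContinuousOn F (cylinder T)) :
    AEStronglyMeasurable F ((timeMeasure T).prod unitMeasure) := by
  rw [← restrict_cylinder]
  exact hF.aestronglyMeasurable (measurableSet_cylinder T)

theorem memLp_of_continuousOn_cylinder {F : ℝ × ℝ → ℝ} (hF : ContinuousOn F (cylinder T)) :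
    MemLp F 2 ((timeMeasure T).prod unitMeasure) := by
  obtain ⟨C, -, hC⟩ := exists_bound_of_continuousOn_cylinder hF
  exact MemLp.of_bound (aestronglyMeasurable_of_continuousOn_cylinder hF) C
    ((ae_prod_mem_cylinder T).mono hC)

theorem memLp_timeMeasure_of_continuousOn {F : ℝ → ℝ} (hF : ContinuousOn F (Icc 0 T)) :
    MemLp F 2 (timeMeasure T) := by
  obtain ⟨C, hC⟩ := isCompact_Icc.exists_bound_of_continuousOn hF
  exact MemLp.of_bound (hF.aestronglyMeasurable measurableSet_Icc) C ((ae_timeMeasure_mem T).mono hC)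

theorem memLp_unitMeasure_of_continuousOn {F : ℝ → ℝ} (hF : ContinuousOn F (Icc 0 1)) :
    MemLp F 2 unitMeasure := by
  obtain ⟨C, hC⟩ := isCompact_Icc.exists_bound_of_continuousOn hF
  exact MemLp.of_bound (hF.aestronglyMeasurable measurableSet_Icc) C (ae_unitMeasure_mem.mono hC)

theorem continuousOn_slice_left {F : ℝ × ℝ → ℝ} (hF : ContinuousOn F (cylinder T)) {t : ℝ}
    (ht : t ∈ Icc 0 T) : ContinuousOn (fun x => F (t, x)) (Icc 0 1) :=
  hF.comp (by fun_prop) fun _ hx => ⟨ht, hx⟩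

theorem continuousOn_slice_right {F : ℝ × ℝ → ℝ} (hF : ContinuousOn F (cylinder T)) {x : ℝ}
    (hx : x ∈ Icc (0 : ℝ) 1) : ContinuousOn (fun t => F (t, x)) (Icc 0 T) :=
  hF.comp (by fun_prop) fun _ ht => ⟨ht, hx⟩

theorem IsC.continuousOn {m n : ℕ} {G : ℝ → ℝ → ℝ} (h : IsC T m n G) :
    ContinuousOn (fun p : ℝ × ℝ => G p.1 p.2) (cylinder T) := by
  simpa using h.space_continuous 0 (Nat.zero_le _)

theorem IsC.continuousOn_spaceDeriv {m n : ℕ} {G : ℝ → ℝ → ℝ} (h : IsC T m n G) (hn : 1 ≤ n) :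
    ContinuousOn (fun p : ℝ × ℝ => spaceDeriv G p.1 p.2) (cylinder T) := by
  have := h.space_continuous 1 hn
  simp only [iteratedDerivWithin_one] at this
  exact this

theorem IsC.continuousOn_timeDeriv {m n : ℕ} {G : ℝ → ℝ → ℝ} (h : IsC T m n G) (hm : 1 ≤ m) :
    ContinuousOn (fun p : ℝ × ℝ => timeDeriv T G p.1 p.2) (cylinder T) := by
  have := h.time_continuous 1 hm
  simp only [iteratedDerivWithin_one] at this
  exact this

theorem IsC.hasDerivWithinAt_time {m n : ℕ} {G : ℝ → ℝ → ℝ} (h : IsC T m n G) (hm : 1 ≤ m)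
    {t x : ℝ} (ht : t ∈ Icc 0 T) (hx : x ∈ Icc (0 : ℝ) 1) :
    HasDerivWithinAt (fun s => G s x) (timeDeriv T G t x) (Icc 0 T) t :=
  (((h.time_contDiff x hx).differentiableOn
    (by exact_mod_cast Nat.one_le_iff_ne_zero.1 hm)) t ht).hasDerivWithinAt

theorem IsC.hasDerivWithinAt_space {m n : ℕ} {G : ℝ → ℝ → ℝ} (h : IsC T m n G) (hn : 1 ≤ n)
    {t x : ℝ} (ht : t ∈ Icc 0 T) (hx : x ∈ Icc (0 : ℝ) 1) :
    HasDerivWithinAt (G t) (spaceDeriv G t x) (Icc 0 1) x :=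
  (((h.space_contDiff t ht).differentiableOn
    (by exact_mod_cast Nat.one_le_iff_ne_zero.1 hn)) x hx).hasDerivWithinAt

theorem IsC.eq_primitive {m n : ℕ} {G : ℝ → ℝ → ℝ} (h : IsC T m n G) (hn : 1 ≤ n) {t : ℝ}
    (ht : t ∈ Icc 0 T) : ∀ x ∈ Icc (0 : ℝ) 1, G t x = G t 0 + primitive (spaceDeriv G t) x := by
  intro x hx
  have hc := continuousOn_slice_left (h.continuousOn_spaceDeriv hn) ht
  have hsub : Icc 0 x ⊆ Icc (0 : ℝ) 1 := Icc_subset_Icc_right hx.2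
  rw [primitive_eq_intervalIntegral _ hx, intervalIntegral.integral_eq_sub_of_hasDerivAt_of_le hx.1
    (f := G t)]
  · ring
  · exact ((h.space_contDiff t ht).continuousOn).mono hsub
  · intro y hy
    exact (h.hasDerivWithinAt_space hn ht (hsub (Ioo_subset_Icc_self hy))).hasDerivAt
      (Icc_mem_nhds hy.1 (hy.2.trans_le hx.2))
  · exact ContinuousOn.intervalIntegrable (by rw [uIcc_of_le hx.1]; exact hc.mono hsub)

theorem isC_pow (m : ℕ) : IsC T 1 2 fun _ x => x ^ m := by
  refine ⟨fun x _ => contDiffOn_const, fun t _ => (contDiff_id.pow m).contDiffOn, ?_, ?_⟩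
  · intro j _
    simp only [iteratedDerivWithin_const]
    split_ifs
    · fun_prop
    · exact continuousOn_const
  · intro k _
    have h := (ContDiffOn.continuousOn_iteratedDerivWithin (m := k) (n := k)
      ((contDiff_id.pow m).contDiffOn (s := Icc (0 : ℝ) 1)) le_rfl (uniqueDiffOn_Icc one_pos))
    exact h.comp (by fun_prop) fun p hp => hp.2

theorem timeDeriv_const (G : ℝ → ℝ) (t x : ℝ) : timeDeriv T (fun _ x => G x) t x = 0 := by
  simp [timeDeriv]

theorem spaceDeriv_pow (m : ℕ) (t : ℝ) {x : ℝ} (hx : x ∈ Icc (0 : ℝ) 1) :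
    spaceDeriv (fun _ x => x ^ m) t x = m * x ^ (m - 1) :=
  (hasDerivAt_pow m x).hasDerivWithinAt.derivWithin (uniqueDiffOn_Icc one_pos x hx)

end Cylinder

/-! ### The weak identity as an integrated rate. -/

section Rate

variable {T : ℝ} {u g f : ℝ → ℝ → ℝ} {q₀ q₁ γ : ℝ → ℝ}

/-- The time derivative of `∫ u_s G_s` prescribed by the weak form of a conservation law with flux
`-f` and boundary fluxes `q₀`, `q₁`. -/
def weakRate (T : ℝ) (u f : ℝ → ℝ → ℝ) (q₀ q₁ : ℝ → ℝ) (G : ℝ → ℝ → ℝ) (s : ℝ) : ℝ :=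
  (∫ x, u s x * timeDeriv T G s x ∂unitMeasure) - (∫ x, f s x * spaceDeriv G s x ∂unitMeasure)
    + (q₁ s * G s 1 + q₀ s * G s 0)

theorem integrable_boundary (hq₀ : MemLp q₀ 2 (timeMeasure T)) (hq₁ : MemLp q₁ 2 (timeMeasure T))
    {m n : ℕ} {G : ℝ → ℝ → ℝ} (hG : IsC T m n G) :
    Integrable (fun s => q₁ s * G s 1 + q₀ s * G s 0) (timeMeasure T) :=
  (hq₁.integrable_mul (memLp_timeMeasure_of_continuousOn
      (continuousOn_slice_right hG.continuousOn (right_mem_Icc.2 zero_le_one)))).add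
    (hq₀.integrable_mul (memLp_timeMeasure_of_continuousOn
      (continuousOn_slice_right hG.continuousOn (left_mem_Icc.2 zero_le_one))))

theorem integrable_mul_timeDeriv
    (hu : MemLp (fun p : ℝ × ℝ => u p.1 p.2) 2 ((timeMeasure T).prod unitMeasure))
    {G : ℝ → ℝ → ℝ} (hG : IsC T 1 2 G) :
    Integrable (fun p : ℝ × ℝ => u p.1 p.2 * timeDeriv T G p.1 p.2)
      ((timeMeasure T).prod unitMeasure) :=
  hu.integrable_mul (memLp_of_continuousOn_cylinder (hG.continuousOn_timeDeriv le_rfl))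

theorem integrable_mul_spaceDeriv
    (hf : MemLp (fun p : ℝ × ℝ => f p.1 p.2) 2 ((timeMeasure T).prod unitMeasure))
    {G : ℝ → ℝ → ℝ} (hG : IsC T 1 2 G) :
    Integrable (fun p : ℝ × ℝ => f p.1 p.2 * spaceDeriv G p.1 p.2)
      ((timeMeasure T).prod unitMeasure) :=
  hf.integrable_mul (memLp_of_continuousOn_cylinder (hG.continuousOn_spaceDeriv one_le_two))

theorem integrable_weakRate
    (hu : MemLp (fun p : ℝ × ℝ => u p.1 p.2) 2 ((timeMeasure T).prod unitMeasure))
    (hf : MemLp (fun p : ℝ × ℝ => f p.1 p.2) 2 ((timeMeasure T).prod unitMeasure))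
    (hq₀ : MemLp q₀ 2 (timeMeasure T)) (hq₁ : MemLp q₁ 2 (timeMeasure T))
    {G : ℝ → ℝ → ℝ} (hG : IsC T 1 2 G) :
    Integrable (weakRate T u f q₀ q₁ G) (timeMeasure T) :=
  ((integrable_mul_timeDeriv hu hG).integral_prod_left.sub
    (integrable_mul_spaceDeriv hf hG).integral_prod_left).add (integrable_boundary hq₀ hq₁ hG)

/-- The full flux `∇u - 2 σ(u) ∇H`. -/
def driftFlux (H u g : ℝ → ℝ → ℝ) (s x : ℝ) : ℝ :=
  g s x - 2 * mobility (u s x) * spaceDeriv H s x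

/-- The identity defining weak solutions, in terms of `weakRate`. -/
theorem weakIdentity_iff {α β A B : ℝ} {H : ℝ → ℝ → ℝ}
    (hu : MemLp (fun p : ℝ × ℝ => u p.1 p.2) 2 ((timeMeasure T).prod unitMeasure))
    (hf : MemLp (fun p : ℝ × ℝ => driftFlux H u g p.1 p.2) 2 ((timeMeasure T).prod unitMeasure))
    (hq₀ : MemLp (fun s => boundaryFlux α A (u s 0) (H s 0)) 2 (timeMeasure T))
    (hq₁ : MemLp (fun s => boundaryFlux β B (u s 1) (H s 1)) 2 (timeMeasure T))
    {G : ℝ → ℝ → ℝ} (hG : IsC T 1 2 G) {t : ℝ} (ht : t ∈ Icc 0 T) :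
    WeakIdentity α β A B T H γ u g t G ↔
      (∫ x, u t x * G t x ∂unitMeasure) - (∫ x, γ x * G 0 x ∂unitMeasure)
        = ∫ s in (0 : ℝ)..t, weakRate T u (driftFlux H u g)
          (fun s => boundaryFlux α A (u s 0) (H s 0)) (fun s => boundaryFlux β B (u s 1) (H s 1))
          G s := by
  have i1 := intervalIntegrable_of_integrable_timeMeasure ht
    (integrable_mul_timeDeriv hu hG).integral_prod_left
  have i2 := intervalIntegrable_of_integrable_timeMeasure ht
    (integrable_mul_spaceDeriv hf hG).integral_prod_left
  have i3 := intervalIntegrable_of_integrable_timeMeasure ht (integrable_boundary hq₀ hq₁ hG)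
  have e : ∀ s x, -(g s x * spaceDeriv G s x)
      + 2 * mobility (u s x) * spaceDeriv H s x * spaceDeriv G s x
      = -(driftFlux H u g s x * spaceDeriv G s x) := fun s x => by
    rw [driftFlux]; ring
  simp only [WeakIdentity, weakRate, e, integral_neg]
  rw [intervalIntegral.integral_add (i1.sub i2) i3, intervalIntegral.integral_sub i1 i2,
    intervalIntegral.integral_neg]
  constructor <;> intro h <;> linarith

theorem weakRate_pow (m : ℕ) (s : ℝ) :
    weakRate T u f q₀ q₁ (fun _ x => x ^ m) s
      = -(∫ x, f s x * (m * x ^ (m - 1)) ∂unitMeasure) + q₁ s + q₀ s * 0 ^ m := by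
  have : ∫ x, f s x * spaceDeriv (fun _ x => x ^ m) s x ∂unitMeasure
      = ∫ x, f s x * (m * x ^ (m - 1)) ∂unitMeasure :=
    integral_congr_ae (ae_unitMeasure_mem.mono fun x hx => by simp only [spaceDeriv_pow m s hx])
  rw [weakRate, this]
  simp only [timeDeriv_const, mul_zero, integral_zero, one_pow, mul_one]
  ring

theorem isFluxSolution_of_weakRate
    (hu : MemLp (fun p : ℝ × ℝ => u p.1 p.2) 2 ((timeMeasure T).prod unitMeasure))
    (hg : MemLp (fun p : ℝ × ℝ => g p.1 p.2) 2 ((timeMeasure T).prod unitMeasure))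
    (hf : MemLp (fun p : ℝ × ℝ => f p.1 p.2) 2 ((timeMeasure T).prod unitMeasure))
    (hq₀ : MemLp q₀ 2 (timeMeasure T)) (hq₁ : MemLp q₁ 2 (timeMeasure T))
    (hγ : MemLp γ 2 unitMeasure)
    (hp : ∀ᵐ t ∂timeMeasure T, ∀ x ∈ Icc (0 : ℝ) 1, u t x = u t 0 + primitive (g t) x)
    (hG : ∀ G, IsC T 1 2 G → ∀ᵐ t ∂timeMeasure T,
      (∫ x, u t x * G t x ∂unitMeasure) - (∫ x, γ x * G 0 x ∂unitMeasure)
        = ∫ s in (0 : ℝ)..t, weakRate T u f q₀ q₁ G s) :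
    IsFluxSolution T u g f q₀ q₁ γ := by
  refine ⟨hu, hg, hf, hq₀, hq₁, hγ, hp, ?_⟩
  -- Only countably many test functions are used, so one null set of times serves them all.
  have h := ae_all_iff.2 fun m : ℕ => hG _ (isC_pow m)
  filter_upwards [h, ae_memLp_slice hu] with t ht hut m
  simp_rw [← weakRate_pow (T := T) (u := u)]
  rw [← ht m, ← integral_sub (integrable_mul_of_memLp_two hut (memLp_pow m))
    (integrable_mul_of_memLp_two hγ (memLp_pow m))]
  exact integral_congr_ae (Eventually.of_forall fun x => by simp [sub_mul])

theorem IsFluxSolution.sub {v g' f' : ℝ → ℝ → ℝ} {p₀ p₁ γ' : ℝ → ℝ}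
    (h : IsFluxSolution T u g f q₀ q₁ γ) (h' : IsFluxSolution T v g' f' p₀ p₁ γ') :
    IsFluxSolution T (fun t x => u t x - v t x) (fun t x => g t x - g' t x)
      (fun t x => f t x - f' t x) (fun t => q₀ t - p₀ t) (fun t => q₁ t - p₁ t)
      (fun x => γ x - γ' x) := by
  refine ⟨h.memLp.sub h'.memLp, h.memLp_deriv.sub h'.memLp_deriv, h.memLp_flux.sub h'.memLp_flux,
    h.memLp_left.sub h'.memLp_left, h.memLp_right.sub h'.memLp_right,
    h.memLp_init.sub h'.memLp_init, ?_, ?_⟩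
  · filter_upwards [h.eq_primitive, h'.eq_primitive, ae_memLp_slice h.memLp_deriv,
      ae_memLp_slice h'.memLp_deriv] with t h1 h2 h3 h4 x hx
    have e : primitive (fun y => g t y - g' t y) x = primitive (g t) x - primitive (g' t) x := by
      simp only [primitive, mul_sub]
      exact integral_sub (integrable_leKernel_mul (h3.integrable one_le_two) x)
        (integrable_leKernel_mul (h4.integrable one_le_two) x)
    rw [h1 x hx, h2 x hx, e]; ring
  · filter_upwards [h.moments, h'.moments, ae_memLp_slice h.memLp, ae_memLp_slice h'.memLp,
      ae_timeMeasure_mem T] with t h1 h2 h3 h4 ht m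
    have h_int : ∀ {f : ℝ → ℝ → ℝ} {q₀ q₁ : ℝ → ℝ},
        MemLp (fun p : ℝ × ℝ => f p.1 p.2) 2 ((timeMeasure T).prod unitMeasure) →
        MemLp q₀ 2 (timeMeasure T) → MemLp q₁ 2 (timeMeasure T) →
        Integrable (fun s => -(∫ x, f s x * (m * x ^ (m - 1)) ∂unitMeasure) + q₁ s + q₀ s * 0 ^ m)
          (timeMeasure T) := fun hf h0 h1 => by
      have i1 := (hf.integrable_mul ((memLp_comp_snd T (memLp_pow (m - 1))).const_mul
        (m : ℝ))).integral_prod_left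
      exact (i1.neg.add (h1.integrable one_le_two)).add ((h0.integrable one_le_two).mul_const _)
    have j1 := intervalIntegrable_of_integrable_timeMeasure ht
      (h_int h.memLp_flux h.memLp_left h.memLp_right)
    have j2 := intervalIntegrable_of_integrable_timeMeasure ht
      (h_int h'.memLp_flux h'.memLp_left h'.memLp_right)
    have e1 : ∫ x, (u t x - v t x - (γ x - γ' x)) * x ^ m ∂unitMeasure
        = ∫ x, (u t x - γ x) * x ^ m ∂unitMeasure - ∫ x, (v t x - γ' x) * x ^ m ∂unitMeasure := by
      have k1 : Integrable (fun x => (u t x - γ x) * x ^ m) unitMeasure :=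
        (h3.sub h.memLp_init).integrable_mul (memLp_pow m)
      have k2 : Integrable (fun x => (v t x - γ' x) * x ^ m) unitMeasure :=
        (h4.sub h'.memLp_init).integrable_mul (memLp_pow m)
      rw [← integral_sub k1 k2]
      refine integral_congr_ae (Eventually.of_forall fun x => ?_)
      simp only; ring
    rw [e1, h1 m, h2 m, ← intervalIntegral.integral_sub j1 j2]
    refine intervalIntegral_congr_timeMeasure ht ?_
    filter_upwards [ae_memLp_slice h.memLp_flux, ae_memLp_slice h'.memLp_flux] with s k1 k2
    have e2 : ∫ x, (f s x - f' s x) * (m * x ^ (m - 1)) ∂unitMeasure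
        = ∫ x, f s x * (m * x ^ (m - 1)) ∂unitMeasure
          - ∫ x, f' s x * (m * x ^ (m - 1)) ∂unitMeasure := by
      simp only [sub_mul]
      exact integral_sub (k1.integrable_mul ((memLp_pow (m - 1)).const_mul (m : ℝ)))
        (k2.integrable_mul ((memLp_pow (m - 1)).const_mul (m : ℝ)))
    rw [e2]; ring

end Rate

/-! ### The boundary flux as an affine function of the density. -/

section BoundaryFlux

/-- The rate at which the boundary flux relaxes. -/
def boundaryRate (ϱ D M : ℝ) : ℝ := D⁻¹ * (ϱ * Real.exp M + (1 - ϱ) * Real.exp (-M))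

theorem boundaryFlux_eq (ϱ D a M : ℝ) :
    boundaryFlux ϱ D a M = D⁻¹ * ϱ * Real.exp M - boundaryRate ϱ D M * a := by
  rw [boundaryFlux, boundaryRate]; ring

/-- The negative slope makes the Robin terms dissipative in the energy estimate for a difference. -/
theorem boundaryFlux_sub (ϱ D a b M : ℝ) :
    boundaryFlux ϱ D a M - boundaryFlux ϱ D b M = -(boundaryRate ϱ D M * (a - b)) := by
  rw [boundaryFlux_eq, boundaryFlux_eq]; ring

theorem boundaryRate_pos {ϱ D : ℝ} (h0 : 0 < ϱ) (h1 : ϱ < 1) (hD : 0 < D) (M : ℝ) :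
    0 < boundaryRate ϱ D M := by
  have : 0 < 1 - ϱ := by linarith
  unfold boundaryRate
  positivity

theorem memLp_continuousOn_mul {T : ℝ} {k a : ℝ → ℝ} (hk : ContinuousOn k (Icc 0 T))
    (ha : MemLp a 2 (timeMeasure T)) : MemLp (fun s => k s * a s) 2 (timeMeasure T) := by
  obtain ⟨C, hC⟩ := isCompact_Icc.exists_bound_of_continuousOn hk
  refine ha.of_le_mul (c := C) ((hk.aestronglyMeasurable measurableSet_Icc).mul ha.1) ?_
  filter_upwards [ae_timeMeasure_mem T] with s hs
  rw [norm_mul]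
  exact mul_le_mul_of_nonneg_right (hC s hs) (norm_nonneg _)

theorem continuousOn_boundaryRate {T ϱ D : ℝ} {M : ℝ → ℝ} (hM : ContinuousOn M (Icc 0 T)) :
    ContinuousOn (fun s => boundaryRate ϱ D (M s)) (Icc 0 T) := by
  unfold boundaryRate
  fun_prop

theorem memLp_boundaryFlux {T ϱ D : ℝ} {a M : ℝ → ℝ} (ha : MemLp a 2 (timeMeasure T))
    (hM : ContinuousOn M (Icc 0 T)) :
    MemLp (fun s => boundaryFlux ϱ D (a s) (M s)) 2 (timeMeasure T) := by
  simp_rw [boundaryFlux_eq]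
  exact (memLp_timeMeasure_of_continuousOn (by fun_prop)).sub
    (memLp_continuousOn_mul (continuousOn_boundaryRate hM) ha)

theorem memLp_of_forall_mem_Icc {γ : ℝ → ℝ} (hγm : AEMeasurable γ (volume.restrict (Icc 0 1)))
    (hγ : ∀ x ∈ Icc (0 : ℝ) 1, γ x ∈ Icc (0 : ℝ) 1) : MemLp γ 2 unitMeasure :=
  MemLp.of_bound hγm.aestronglyMeasurable 1 (ae_unitMeasure_mem.mono fun x hx => by
    rw [Real.norm_eq_abs, abs_of_nonneg (hγ x hx).1]; exact (hγ x hx).2)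

theorem memLp_driftFlux {T : ℝ} {H u g : ℝ → ℝ → ℝ} (hH : IsC T 0 1 H)
    (hu : MemLp (fun p : ℝ × ℝ => u p.1 p.2) 2 ((timeMeasure T).prod unitMeasure))
    (hg : MemLp (fun p : ℝ × ℝ => g p.1 p.2) 2 ((timeMeasure T).prod unitMeasure))
    (h : ∀ᵐ p ∂((timeMeasure T).prod unitMeasure), u p.1 p.2 ∈ Icc (0 : ℝ) 1) :
    MemLp (fun p : ℝ × ℝ => driftFlux H u g p.1 p.2) 2 ((timeMeasure T).prod unitMeasure) := by
  have hH' := memLp_of_continuousOn_cylinder (hH.continuousOn_spaceDeriv le_rfl)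
  refine hg.sub (hH'.of_le_mul (c := 2) ?_ ?_)
  · have hm : Continuous mobility := by unfold mobility; fun_prop
    exact ((hm.comp_aestronglyMeasurable hu.1).const_mul 2).mul hH'.1
  · filter_upwards [h] with p hp
    rw [norm_mul, norm_mul, Real.norm_ofNat]
    refine mul_le_mul_of_nonneg_right ?_ (norm_nonneg _)
    refine mul_le_of_le_one_right zero_le_two ?_
    rw [mobility, norm_mul, Real.norm_eq_abs, Real.norm_eq_abs, abs_of_nonneg hp.1,
      abs_of_nonneg (by linarith [hp.2])]
    nlinarith [hp.1, hp.2]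

end BoundaryFlux

/-! ### Uniqueness. -/

section Uniqueness

variable {α β A B T : ℝ} {H : ℝ → ℝ → ℝ} {γ : ℝ → ℝ} {u v : ℝ → ℝ → ℝ}

theorem firstPrim_one (a : ℝ) : firstPrim (fun _ => 1) a = a := by simp [firstPrim]

theorem secondPrim_one (a : ℝ) : secondPrim (fun _ => 1) a = a ^ 2 / 2 := by
  simp [secondPrim, firstPrim_one, integral_id]

theorem abs_mobility_sub_le {a b : ℝ} (ha : a ∈ Icc (0 : ℝ) 1) (hb : b ∈ Icc (0 : ℝ) 1) :
    |mobility a - mobility b| ≤ |a - b| := by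
  have : mobility a - mobility b = (a - b) * (1 - a - b) := by unfold mobility; ring
  rw [this, abs_mul]
  refine mul_le_of_le_one_right (abs_nonneg _) (abs_le.2 ⟨?_, ?_⟩) <;>
    linarith [ha.1, ha.2, hb.1, hb.2]

/-- A weak solution is a solution of a conservation law. -/
theorem IsWeakSolution.exists_isFluxSolution (hH : IsC T 0 1 H)
    (hγ : MemLp γ 2 unitMeasure) (h : IsWeakSolution α β A B T H γ u) :
    ∃ g, IsFluxSolution T u g (driftFlux H u g) (fun s => boundaryFlux α A (u s 0) (H s 0))
        (fun s => boundaryFlux β B (u s 1) (H s 1)) γ ∧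
      ∀ t ∈ Ioc 0 T, ∀ G, IsC T 1 2 G →
        (∫ x, u t x * G t x ∂unitMeasure) - (∫ x, γ x * G 0 x ∂unitMeasure)
          = ∫ s in (0 : ℝ)..t, weakRate T u (driftFlux H u g)
            (fun s => boundaryFlux α A (u s 0) (H s 0))
            (fun s => boundaryFlux β B (u s 1) (H s 1)) G s := by
  obtain ⟨g, hL, hw⟩ := h.weak
  have hu := hL.memLp
  have hg := hL.memLp_deriv
  have hI := h.mem_Icc
  rw [restrict_cylinder] at hu hg hI
  have hp : ∀ᵐ t ∂timeMeasure T, ∀ x ∈ Icc (0 : ℝ) 1, u t x = u t 0 + primitive (g t) x :=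
    hL.isH1.mono fun t ht => ht.eq_primitive
  have hf := memLp_driftFlux hH hu hg hI
  have hq₀ : MemLp (fun s => boundaryFlux α A (u s 0) (H s 0)) 2 (timeMeasure T) :=
    memLp_boundaryFlux (memLp_trace_zero hu hg hp)
      (continuousOn_slice_right hH.continuousOn (left_mem_Icc.2 zero_le_one))
  have hq₁ : MemLp (fun s => boundaryFlux β B (u s 1) (H s 1)) 2 (timeMeasure T) :=
    memLp_boundaryFlux (memLp_trace_one hu hg hp)
      (continuousOn_slice_right hH.continuousOn (right_mem_Icc.2 zero_le_one))
  have key : ∀ t ∈ Ioc 0 T, ∀ G, IsC T 1 2 G →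
        (∫ x, u t x * G t x ∂unitMeasure) - (∫ x, γ x * G 0 x ∂unitMeasure)
          = ∫ s in (0 : ℝ)..t, weakRate T u (driftFlux H u g)
            (fun s => boundaryFlux α A (u s 0) (H s 0))
            (fun s => boundaryFlux β B (u s 1) (H s 1)) G s := fun t ht G hG =>
    (weakIdentity_iff hu hf hq₀ hq₁ hG (Ioc_subset_Icc_self ht)).1 (hw t ht G hG)
  refine ⟨g, isFluxSolution_of_weakRate hu hg hf hq₀ hq₁ hγ hp fun G hG => ?_, key⟩
  have h0 : ∀ᵐ t ∂timeMeasure T, t ≠ 0 := ae_restrict_of_ae (by simp [ae_iff])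
  filter_upwards [ae_timeMeasure_mem T, h0] with t ht h0
  exact key t ⟨lt_of_le_of_ne ht.1 h0.symm, ht.2⟩ G hG

/-- The energy inequality with `ρ = 1` for the difference. The boundary terms are nonpositive, and
Young's inequality absorbs the drift into the diffusion at the cost of `C²` times the squared
difference. -/
theorem IsWeakSolution.ae_eq (hα : 0 < α) (hα1 : α < 1) (hβ0 : 0 < β) (hβ : β < 1)
    (hA : 0 < A) (hB : 0 < B) (hH : IsC T 0 1 H) (hγ : MemLp γ 2 unitMeasure)
    (hu : IsWeakSolution α β A B T H γ u) (hv : IsWeakSolution α β A B T H γ v) :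
    ∀ᵐ p ∂((timeMeasure T).prod unitMeasure), u p.1 p.2 = v p.1 p.2 := by
  obtain ⟨g, hfu, -⟩ := hu.exists_isFluxSolution hH hγ
  obtain ⟨g', hfv, -⟩ := hv.exists_isFluxSolution hH hγ
  have hs := hfu.sub hfv
  have huI := hu.mem_Icc
  have hvI := hv.mem_Icc
  rw [restrict_cylinder] at huI hvI
  obtain ⟨C, hC0, hC⟩ := exists_bound_of_continuousOn_cylinder (hH.continuousOn_spaceDeriv le_rfl)
  -- The estimate becomes `(K / 2) Y ≤ C² Y` with `K / 2 = C² + 1`, hence `Y = 0`.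
  set K := 2 * C ^ 2 + 2 with hKdef
  have hK : 0 ≤ K := by positivity
  have hen := hs.energy_le (ρ := fun _ => 1) continuous_const (fun _ => zero_le_one)
    (fun _ => le_rfl) (Eventually.of_forall fun x => by simp [secondPrim_one]) hK
  simp only [firstPrim_one, secondPrim_one, one_mul] at hen
  set Q := (timeMeasure T).prod unitMeasure
  have hw2 : Integrable (fun p : ℝ × ℝ => Real.exp (-(K * p.1)) * (u p.1 p.2 - v p.1 p.2) ^ 2) Q :=
    integrable_exp_mul hK hs.memLp.integrable_sq
  have hw0 := memLp_comp_fst (memLp_trace_zero hs.memLp hs.memLp_deriv hs.eq_primitive)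
  have hw1 := memLp_comp_fst (memLp_trace_one hs.memLp hs.memLp_deriv hs.eq_primitive)
  have hrhs := integrable_exp_mul hK ((((memLp_comp_fst hs.memLp_right).integrable_mul hw1).add
    ((memLp_comp_fst hs.memLp_left).integrable_mul hw0)).sub
    (hs.memLp_flux.integrable_mul hs.memLp_deriv))
  have hle : ∫ p, Real.exp (-(K * p.1)) *
        ((boundaryFlux β B (u p.1 1) (H p.1 1) - boundaryFlux β B (v p.1 1) (H p.1 1))
            * (u p.1 1 - v p.1 1)
          + (boundaryFlux α A (u p.1 0) (H p.1 0) - boundaryFlux α A (v p.1 0) (H p.1 0))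
            * (u p.1 0 - v p.1 0)
          - (driftFlux H u g p.1 p.2 - driftFlux H v g' p.1 p.2) * (g p.1 p.2 - g' p.1 p.2)) ∂Q
      ≤ ∫ p, C ^ 2 * (Real.exp (-(K * p.1)) * (u p.1 p.2 - v p.1 p.2) ^ 2) ∂Q := by
    refine integral_mono_ae hrhs (hw2.const_mul _) ?_
    filter_upwards [huI, hvI, ae_prod_mem_cylinder T] with p hpu hpv hp
    rw [mul_left_comm]
    refine mul_le_mul_of_nonneg_left ?_ (Real.exp_pos _).le
    rw [boundaryFlux_sub, boundaryFlux_sub, driftFlux, driftFlux]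
    set a := u p.1 p.2 - v p.1 p.2 with ha
    set d := g p.1 p.2 - g' p.1 p.2 with hd
    set S := spaceDeriv H p.1 p.2
    have k1 : 0 ≤ boundaryRate β B (H p.1 1) * (u p.1 1 - v p.1 1) ^ 2 :=
      mul_nonneg (boundaryRate_pos hβ0 hβ hB _).le (sq_nonneg _)
    have k0 : 0 ≤ boundaryRate α A (H p.1 0) * (u p.1 0 - v p.1 0) ^ 2 :=
      mul_nonneg (boundaryRate_pos hα hα1 hA _).le (sq_nonneg _)
    have k2 : ((mobility (u p.1 p.2) - mobility (v p.1 p.2)) * S) ^ 2 ≤ C ^ 2 * a ^ 2 := by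
      rw [← sq_abs, abs_mul, mul_pow, mul_comm, ← sq_abs a]
      exact mul_le_mul (pow_le_pow_left₀ (abs_nonneg _) (hC p hp) 2)
        (pow_le_pow_left₀ (abs_nonneg _) (abs_mobility_sub_le hpu hpv) 2) (by positivity)
        (by positivity)
    nlinarith [sq_nonneg ((mobility (u p.1 p.2) - mobility (v p.1 p.2)) * S - d)]
  have hfin := hen.trans hle
  rw [integral_const_mul] at hfin
  have e : ∫ p : ℝ × ℝ, Real.exp (-(K * p.1)) * ((u p.1 p.2 - v p.1 p.2) ^ 2 / 2) ∂Q
      = (∫ p : ℝ × ℝ, Real.exp (-(K * p.1)) * (u p.1 p.2 - v p.1 p.2) ^ 2 ∂Q) / 2 := by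
    rw [← integral_div]
    exact integral_congr_ae (Eventually.of_forall fun p => by simp only; ring)
  rw [e] at hfin
  have hnn : ∀ p : ℝ × ℝ, 0 ≤ Real.exp (-(K * p.1)) * (u p.1 p.2 - v p.1 p.2) ^ 2 := fun p =>
    mul_nonneg (Real.exp_pos _).le (sq_nonneg _)
  have hz : ∫ p : ℝ × ℝ, Real.exp (-(K * p.1)) * (u p.1 p.2 - v p.1 p.2) ^ 2 ∂Q = 0 := by
    refine le_antisymm ?_ (integral_nonneg hnn)
    rw [hKdef] at hfin ⊢
    nlinarith
  rw [integral_eq_zero_iff_of_nonneg hnn hw2] at hz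
  filter_upwards [hz] with p hp
  have := (mul_eq_zero.1 hp).resolve_left (Real.exp_pos _).ne'
  exact sub_eq_zero.1 (pow_eq_zero_iff two_ne_zero |>.1 this)

/-- At positive times each moment of `u t - v t` equals the primitive of a difference of rates,
which is continuous in `t`. It vanishes for almost every `t`, hence everywhere, and moments
determine the profile. -/
theorem IsWeakSolution.ae_eq_at (hα : 0 < α) (hα1 : α < 1) (hβ0 : 0 < β) (hβ : β < 1)
    (hA : 0 < A) (hB : 0 < B) (hT : 0 < T) (hH : IsC T 0 1 H) (hγ : MemLp γ 2 unitMeasure)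
    (hu : IsWeakSolution α β A B T H γ u) (hv : IsWeakSolution α β A B T H γ v) :
    ∀ t ∈ Ioc 0 T, ∀ᵐ x ∂(volume.restrict (Icc (0 : ℝ) 1)), u t x = v t x := by
  have huv := hu.ae_eq hα hα1 hβ0 hβ hA hB hH hγ hv
  obtain ⟨g, hfu, hwu⟩ := hu.exists_isFluxSolution hH hγ
  obtain ⟨g', hfv, hwv⟩ := hv.exists_isFluxSolution hH hγ
  have hslice : ∀ᵐ t ∂timeMeasure T, ∀ᵐ x ∂unitMeasure, u t x = v t x := Measure.ae_ae_of_ae_prod huv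
  have h0 : ∀ᵐ t ∂timeMeasure T, t ≠ 0 := ae_restrict_of_ae (by simp [ae_iff])
  intro t ht
  have htI := Ioc_subset_Icc_self ht
  have hmu := hu.memLp t htI
  have hmv := hv.memLp t htI
  have key := ae_eq_zero_of_moments_eq_zero (a := 0) (b := 1) (h := fun x => u t x - v t x)
    ((hmu.sub hmv).integrable one_le_two) ?_
  · filter_upwards [key] with x hx using sub_eq_zero.1 hx
  intro m
  set Ru := weakRate T u (driftFlux H u g) (fun s => boundaryFlux α A (u s 0) (H s 0))
    (fun s => boundaryFlux β B (u s 1) (H s 1)) (fun _ x => x ^ m)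
  set Rv := weakRate T v (driftFlux H v g') (fun s => boundaryFlux α A (v s 0) (H s 0))
    (fun s => boundaryFlux β B (v s 1) (H s 1)) (fun _ x => x ^ m)
  have iRu : Integrable Ru (timeMeasure T) :=
    integrable_weakRate hfu.memLp hfu.memLp_flux hfu.memLp_left hfu.memLp_right (isC_pow m)
  have iRv : Integrable Rv (timeMeasure T) :=
    integrable_weakRate hfv.memLp hfv.memLp_flux hfv.memLp_left hfv.memLp_right (isC_pow m)
  have hcont : ContinuousOn (fun s => ∫ r in (0 : ℝ)..s, (Ru r - Rv r)) (Icc 0 T) := by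
    have := intervalIntegral.continuousOn_primitive_interval (a := 0) (b := T)
      (f := fun r => Ru r - Rv r) (μ := volume) (by
        rw [uIcc_of_le hT.le]; exact iRu.sub iRv)
    rwa [uIcc_of_le hT.le] at this
  have hdiff : ∀ s ∈ Ioc 0 T, ∫ x, x ^ m * (u s x - v s x) ∂unitMeasure
      = ∫ r in (0 : ℝ)..s, (Ru r - Rv r) := fun s hs => by
    have hsI := Ioc_subset_Icc_self hs
    rw [intervalIntegral.integral_sub (intervalIntegrable_of_integrable_timeMeasure hsI iRu)
      (intervalIntegrable_of_integrable_timeMeasure hsI iRv), ← hwu s hs _ (isC_pow m),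
      ← hwv s hs _ (isC_pow m)]
    simp_rw [mul_sub, mul_comm _ (u s _), mul_comm _ (v s _)]
    rw [integral_sub (integrable_mul_of_memLp_two (hu.memLp s hsI) (memLp_pow m))
      (integrable_mul_of_memLp_two (hv.memLp s hsI) (memLp_pow m))]
    ring
  have hzero := Measure.eqOn_Icc_of_ae_eq volume hT.ne
    (f := fun s => ∫ r in (0 : ℝ)..s, (Ru r - Rv r)) (g := fun _ => 0) (by
      filter_upwards [hslice, h0, ae_timeMeasure_mem T] with s hs hs0 hsI
      rw [← hdiff s ⟨lt_of_le_of_ne hsI.1 hs0.symm, hsI.2⟩]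
      exact integral_eq_zero_of_ae (hs.mono fun x hx => by simp [hx])) hcont continuousOn_const
  exact (hdiff t ht).trans (hzero htI)

end Uniqueness

/-! ### Operations on test functions. -/

section TestFunctions

variable {T : ℝ} {m n : ℕ} {G G' : ℝ → ℝ → ℝ}

theorem IsC.add (hT : 0 < T) (h : IsC T m n G) (h' : IsC T m n G') : IsC T m n (G + G') := by
  refine ⟨fun x hx => (h.time_contDiff x hx).add (h'.time_contDiff x hx),
    fun t ht => (h.space_contDiff t ht).add (h'.space_contDiff t ht), fun j hj => ?_,
    fun k hk => ?_⟩
  · refine ((h.time_continuous j hj).add (h'.time_continuous j hj)).congr fun p hp => ?_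
    exact iteratedDerivWithin_fun_add hp.1 (uniqueDiffOn_Icc hT)
      ((h.time_contDiff p.2 hp.2 p.1 hp.1).of_le (by exact_mod_cast hj))
      ((h'.time_contDiff p.2 hp.2 p.1 hp.1).of_le (by exact_mod_cast hj))
  · refine ((h.space_continuous k hk).add (h'.space_continuous k hk)).congr fun p hp => ?_
    exact iteratedDerivWithin_fun_add hp.2 (uniqueDiffOn_Icc one_pos)
      ((h.space_contDiff p.1 hp.1 p.2 hp.2).of_le (by exact_mod_cast hk))
      ((h'.space_contDiff p.1 hp.1 p.2 hp.2).of_le (by exact_mod_cast hk))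

theorem IsC.const_smul (hT : 0 < T) (c : ℝ) (h : IsC T m n G) : IsC T m n (c • G) := by
  refine ⟨fun x hx => contDiffOn_const.mul (h.time_contDiff x hx),
    fun t ht => contDiffOn_const.mul (h.space_contDiff t ht), fun j hj => ?_, fun k hk => ?_⟩
  · refine ((continuousOn_const (c := c)).mul (h.time_continuous j hj)).congr fun p hp => ?_
    exact iteratedDerivWithin_const_mul hp.1 (uniqueDiffOn_Icc hT) c
      ((h.time_contDiff p.2 hp.2 p.1 hp.1).of_le (by exact_mod_cast hj))
  · refine ((continuousOn_const (c := c)).mul (h.space_continuous k hk)).congr fun p hp => ?_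
    exact iteratedDerivWithin_const_mul hp.2 (uniqueDiffOn_Icc one_pos) c
      ((h.space_contDiff p.1 hp.1 p.2 hp.2).of_le (by exact_mod_cast hk))

theorem isC_zero : IsC T m n 0 := by
  refine ⟨fun x _ => contDiffOn_const, fun t _ => contDiffOn_const, fun j _ => ?_, fun k _ => ?_⟩
  · simp only [Pi.zero_apply, iteratedDerivWithin_const]
    split_ifs <;> exact continuousOn_const
  · have : ∀ p : ℝ × ℝ, iteratedDerivWithin k ((0 : ℝ → ℝ → ℝ) p.1) (Icc 0 1) p.2 = 0 := fun p => by
      exact (iteratedDerivWithin_const (n := k) (c := (0 : ℝ))).trans (ite_self _)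
    simp_rw [this]
    exact continuousOn_const

theorem timeDeriv_add (h : IsC T 1 n G) (h' : IsC T 1 n G') {t x : ℝ} (hT : 0 < T)
    (ht : t ∈ Icc 0 T) (hx : x ∈ Icc (0 : ℝ) 1) :
    timeDeriv T (G + G') t x = timeDeriv T G t x + timeDeriv T G' t x :=
  ((h.hasDerivWithinAt_time le_rfl ht hx).add
    (h'.hasDerivWithinAt_time le_rfl ht hx)).derivWithin (uniqueDiffOn_Icc hT t ht)

theorem timeDeriv_smul (c : ℝ) (h : IsC T 1 n G) {t x : ℝ} (hT : 0 < T)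
    (ht : t ∈ Icc 0 T) (hx : x ∈ Icc (0 : ℝ) 1) :
    timeDeriv T (c • G) t x = c * timeDeriv T G t x :=
  ((h.hasDerivWithinAt_time le_rfl ht hx).const_mul c).derivWithin (uniqueDiffOn_Icc hT t ht)

theorem spaceDeriv_add (h : IsC T m 2 G) (h' : IsC T m 2 G') {t x : ℝ}
    (ht : t ∈ Icc 0 T) (hx : x ∈ Icc (0 : ℝ) 1) :
    spaceDeriv (G + G') t x = spaceDeriv G t x + spaceDeriv G' t x :=
  ((h.hasDerivWithinAt_space one_le_two ht hx).add
    (h'.hasDerivWithinAt_space one_le_two ht hx)).derivWithin (uniqueDiffOn_Icc one_pos x hx)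

theorem spaceDeriv_smul (c : ℝ) (h : IsC T m 2 G) {t x : ℝ}
    (ht : t ∈ Icc 0 T) (hx : x ∈ Icc (0 : ℝ) 1) :
    spaceDeriv (c • G) t x = c * spaceDeriv G t x :=
  ((h.hasDerivWithinAt_space one_le_two ht hx).const_mul c).derivWithin
    (uniqueDiffOn_Icc one_pos x hx)

theorem timeDeriv_mul_time (h : IsC T 1 n G) {χ : ℝ → ℝ} (hχ : ContDiff ℝ ∞ χ) {t x : ℝ}
    (hT : 0 < T) (ht : t ∈ Icc 0 T) (hx : x ∈ Icc (0 : ℝ) 1) :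
    timeDeriv T (fun t x => χ t * G t x) t x = deriv χ t * G t x + χ t * timeDeriv T G t x :=
  ((hχ.differentiable (by simp) t).hasDerivAt.hasDerivWithinAt.fun_mul
    (h.hasDerivWithinAt_time le_rfl ht hx)).derivWithin (uniqueDiffOn_Icc hT t ht)

theorem spaceDeriv_mul_time (h : IsC T m 2 G) (χ : ℝ → ℝ) {t x : ℝ}
    (ht : t ∈ Icc 0 T) (hx : x ∈ Icc (0 : ℝ) 1) :
    spaceDeriv (fun t x => χ t * G t x) t x = χ t * spaceDeriv G t x :=
  ((h.hasDerivWithinAt_space one_le_two ht hx).const_mul (χ t)).derivWithin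
    (uniqueDiffOn_Icc one_pos x hx)

theorem IsC.mul_time (hT : 0 < T) (h : IsC T 1 2 G) {χ : ℝ → ℝ} (hχ : ContDiff ℝ ∞ χ) :
    IsC T 1 2 fun t x => χ t * G t x := by
  have hχc : Continuous χ := hχ.continuous
  have hχd : Continuous (deriv χ) := hχ.continuous_deriv (by simp)
  refine ⟨fun x hx => (hχ.of_le (by simp)).contDiffOn.mul (h.time_contDiff x hx),
    fun t ht => contDiffOn_const.mul (h.space_contDiff t ht), fun j hj => ?_, fun k hk => ?_⟩
  · interval_cases j
    · simp only [iteratedDerivWithin_zero]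
      exact (hχc.comp continuous_fst).continuousOn.mul h.continuousOn
    · simp only [iteratedDerivWithin_one]
      refine ContinuousOn.congr (((hχd.comp continuous_fst).continuousOn.mul h.continuousOn).add
        ((hχc.comp continuous_fst).continuousOn.mul (h.continuousOn_timeDeriv le_rfl)))
        fun p hp => ?_
      exact timeDeriv_mul_time h hχ hT hp.1 hp.2
  · refine ContinuousOn.congr ((hχc.comp continuous_fst).continuousOn.mul
      (h.space_continuous k hk)) fun p hp => ?_
    exact iteratedDerivWithin_const_mul hp.2 (uniqueDiffOn_Icc one_pos) (χ p.1)
      ((h.space_contDiff p.1 hp.1 p.2 hp.2).of_le (by exact_mod_cast hk))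

end TestFunctions

/-! ### From test functions vanishing at the final time to almost every time. -/

section TimeSlices

variable {T : ℝ} {u g f : ℝ → ℝ → ℝ} {q₀ q₁ γ : ℝ → ℝ}

theorem weakRate_mul_time (hT : 0 < T)
    (hu : MemLp (fun p : ℝ × ℝ => u p.1 p.2) 2 ((timeMeasure T).prod unitMeasure))
    {G : ℝ → ℝ → ℝ} (hG : IsC T 1 2 G) {χ : ℝ → ℝ} (hχ : ContDiff ℝ ∞ χ) :
    ∀ᵐ s ∂timeMeasure T, weakRate T u f q₀ q₁ (fun t x => χ t * G t x) s
      = deriv χ s * (∫ x, u s x * G s x ∂unitMeasure) + χ s * weakRate T u f q₀ q₁ G s := by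
  filter_upwards [ae_timeMeasure_mem T, ae_memLp_slice hu] with s hs hus
  have mG := memLp_unitMeasure_of_continuousOn (continuousOn_slice_left hG.continuousOn hs)
  have mG' := memLp_unitMeasure_of_continuousOn
    (continuousOn_slice_left (hG.continuousOn_timeDeriv le_rfl) hs)
  have e1 : ∫ x, u s x * timeDeriv T (fun t x => χ t * G t x) s x ∂unitMeasure
      = deriv χ s * (∫ x, u s x * G s x ∂unitMeasure)
        + χ s * ∫ x, u s x * timeDeriv T G s x ∂unitMeasure := by
    rw [← integral_const_mul, ← integral_const_mul, ← integral_add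
      ((integrable_mul_of_memLp_two hus mG).const_mul _)
      ((integrable_mul_of_memLp_two hus mG').const_mul _)]
    refine integral_congr_ae (ae_unitMeasure_mem.mono fun x hx => ?_)
    simp only [timeDeriv_mul_time hG hχ hT hs hx]; ring
  have e2 : ∫ x, f s x * spaceDeriv (fun t x => χ t * G t x) s x ∂unitMeasure
      = χ s * ∫ x, f s x * spaceDeriv G s x ∂unitMeasure := by
    rw [← integral_const_mul]
    refine integral_congr_ae (ae_unitMeasure_mem.mono fun x hx => ?_)
    simp only [spaceDeriv_mul_time hG χ hs hx]; ring
  simp only [weakRate, e1, e2]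
  ring

/-- Integration by parts; one factor vanishes at `T` and the other at `0`. -/
theorem intervalIntegral_mul_primitive_eq (hT : 0 < T) {R : ℝ → ℝ}
    (hR : Integrable R (timeMeasure T)) (n : ℕ) :
    ∫ s in (0 : ℝ)..T, (T ^ (n + 1) - s ^ (n + 1)) * R s
      = ∫ s in (0 : ℝ)..T, ((n + 1) * s ^ n) * ∫ r in (0 : ℝ)..s, R r := by
  have hRi := intervalIntegrable_of_integrable_timeMeasure (right_mem_Icc.2 hT.le) hR
  have hac := hRi.absolutelyContinuousOnInterval_intervalIntegral (c := 0) left_mem_uIcc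
  have hχ : AbsolutelyContinuousOnInterval (fun s : ℝ => T ^ (n + 1) - s ^ (n + 1)) 0 T :=
    ContDiffOn.absolutelyContinuousOnInterval (by fun_prop)
  have hparts := hχ.integral_mul_deriv_eq_deriv_mul hac
  have hd : ∀ s : ℝ, deriv (fun s : ℝ => T ^ (n + 1) - s ^ (n + 1)) s = -((n + 1) * s ^ n) :=
    fun s => by simp
  have e1 : ∫ s in (0 : ℝ)..T, (T ^ (n + 1) - s ^ (n + 1)) * deriv (fun x => ∫ v in (0 : ℝ)..x, R v) s
      = ∫ s in (0 : ℝ)..T, (T ^ (n + 1) - s ^ (n + 1)) * R s := by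
    refine intervalIntegral.integral_congr_ae ?_
    filter_upwards [hRi.ae_hasDerivAt_integral] with s hs hs'
    rw [(hs (uIoc_subset_uIcc hs') 0 left_mem_uIcc).deriv]
  rw [← e1, hparts]
  simp only [hd, sub_self, zero_mul, intervalIntegral.integral_same, mul_zero, neg_mul,
    intervalIntegral.integral_neg]
  ring

/-- If the weak identity holds for all test functions vanishing at the final time, then it holds
at almost every time. -/
theorem ae_weakRate_of_forall_vanishing (hT : 0 < T)
    (hu : MemLp (fun p : ℝ × ℝ => u p.1 p.2) 2 ((timeMeasure T).prod unitMeasure))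
    (hf : MemLp (fun p : ℝ × ℝ => f p.1 p.2) 2 ((timeMeasure T).prod unitMeasure))
    (hq₀ : MemLp q₀ 2 (timeMeasure T)) (hq₁ : MemLp q₁ 2 (timeMeasure T))
    (h : ∀ G, IsC T 1 2 G → (∀ x ∈ Icc (0 : ℝ) 1, G T x = 0) →
      -(∫ x, γ x * G 0 x ∂unitMeasure) = ∫ s in (0 : ℝ)..T, weakRate T u f q₀ q₁ G s)
    {G : ℝ → ℝ → ℝ} (hG : IsC T 1 2 G) : ∀ᵐ t ∂timeMeasure T,
      (∫ x, u t x * G t x ∂unitMeasure) - (∫ x, γ x * G 0 x ∂unitMeasure)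
        = ∫ s in (0 : ℝ)..t, weakRate T u f q₀ q₁ G s := by
  set R := weakRate T u f q₀ q₁ G
  set c := ∫ x, γ x * G 0 x ∂unitMeasure
  have iR : Integrable R (timeMeasure T) := integrable_weakRate hu hf hq₀ hq₁ hG
  have ih : Integrable (fun t => ∫ x, u t x * G t x ∂unitMeasure) (timeMeasure T) :=
    (hu.integrable_mul (memLp_of_continuousOn_cylinder hG.continuousOn)).integral_prod_left
  have hTm := right_mem_Icc.2 hT.le
  have iP : Integrable (fun t => ∫ s in (0 : ℝ)..t, R s) (timeMeasure T) := by
    have := intervalIntegral.continuousOn_primitive_interval (a := 0) (b := T)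
      (f := R) (μ := volume) (by rw [uIcc_of_le hT.le]; exact iR)
    rw [uIcc_of_le hT.le] at this
    exact this.integrableOn_compact isCompact_Icc
  have key := ae_eq_zero_of_moments_eq_zero (a := 0) (b := T)
    (h := fun t => (∫ x, u t x * G t x ∂unitMeasure) - c - ∫ s in (0 : ℝ)..t, R s)
    ((ih.sub (integrable_const _)).sub iP) ?_
  · filter_upwards [key] with t ht
    linarith
  intro n
  have hn : (0 : ℝ) < n + 1 := by positivity
  -- `χ G` is admissible because `χ T = 0`, and `χ' = -(n + 1) s ^ n` extracts the `n`-th time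
  -- moment of the defect in the identity.
  let χ : ℝ → ℝ := fun s => T ^ (n + 1) - s ^ (n + 1)
  have hχ : ContDiff ℝ ∞ χ := by fun_prop
  have hχd : ∀ s, deriv χ s = -((n + 1) * s ^ n) := fun s => by simp [χ]
  have h1 := h _ (hG.mul_time hT hχ) fun x _ => by simp [χ]
  rw [intervalIntegral_congr_timeMeasure hTm (weakRate_mul_time hT hu hG hχ)] at h1
  have hbdd : ∀ {F k : ℝ → ℝ}, Integrable F (timeMeasure T) → Continuous k →
      Integrable (fun s => k s * F s) (timeMeasure T) := fun {F k} hF hk => by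
    obtain ⟨C, hC⟩ := isCompact_Icc.exists_bound_of_continuousOn (hk.continuousOn (s := Icc 0 T))
    exact hF.bdd_mul (c := C) hk.aestronglyMeasurable ((ae_timeMeasure_mem T).mono hC)
  have j1 : IntervalIntegrable (fun s => deriv χ s * ∫ x, u s x * G s x ∂unitMeasure) volume 0 T :=
    intervalIntegrable_of_integrable_timeMeasure hTm
      (hbdd ih (hχ.continuous_deriv (by simp)))
  have j2 : IntervalIntegrable (fun s => χ s * R s) volume 0 T :=
    intervalIntegrable_of_integrable_timeMeasure hTm (hbdd iR hχ.continuous)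
  rw [intervalIntegral.integral_add j1 j2, intervalIntegral_mul_primitive_eq hT iR n] at h1
  have e0 : ∫ x, γ x * (χ 0 * G 0 x) ∂unitMeasure = T ^ (n + 1) * c := by
    rw [← integral_const_mul]
    refine integral_congr_ae (Eventually.of_forall fun x => ?_)
    simp only [χ]; ring
  rw [e0] at h1
  have e1 : ∫ s in (0 : ℝ)..T, deriv χ s * ∫ x, u s x * G s x ∂unitMeasure
      = -((n + 1) * ∫ s in (0 : ℝ)..T, s ^ n * ∫ x, u s x * G s x ∂unitMeasure) := by
    rw [← intervalIntegral.integral_const_mul, ← intervalIntegral.integral_neg]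
    refine intervalIntegral.integral_congr fun s _ => ?_
    simp only [hχd]; ring
  have e2 : ∫ s in (0 : ℝ)..T, ((n + 1) * s ^ n) * ∫ r in (0 : ℝ)..s, R r
      = (n + 1) * ∫ s in (0 : ℝ)..T, s ^ n * ∫ r in (0 : ℝ)..s, R r := by
    rw [← intervalIntegral.integral_const_mul]
    exact intervalIntegral.integral_congr fun s _ => by ring
  have e3 : ∫ s in (0 : ℝ)..T, s ^ n * c = T ^ (n + 1) * c / (n + 1) := by
    rw [intervalIntegral.integral_mul_const, integral_pow]
    simp; ring
  rw [e1, e2] at h1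
  have i1 := intervalIntegrable_of_integrable_timeMeasure hTm (hbdd ih (continuous_pow n))
  have i2 := intervalIntegrable_of_integrable_timeMeasure hTm
    (hbdd (integrable_const c) (continuous_pow n))
  have i3 := intervalIntegrable_of_integrable_timeMeasure hTm (hbdd iP (continuous_pow n))
  have e4 : ∫ t, t ^ n * ((∫ x, u t x * G t x ∂unitMeasure) - c - ∫ s in (0 : ℝ)..t, R s)
      ∂timeMeasure T = (∫ s in (0 : ℝ)..T, s ^ n * ∫ x, u s x * G s x ∂unitMeasure)
        - (∫ s in (0 : ℝ)..T, s ^ n * c) - ∫ s in (0 : ℝ)..T, s ^ n * ∫ r in (0 : ℝ)..s, R r := by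
    rw [integral_timeMeasure hT.le, ← intervalIntegral.integral_sub i1 i2,
      ← intervalIntegral.integral_sub (i1.sub i2) i3]
    exact intervalIntegral.integral_congr fun s _ => by ring
  refine e4.trans ?_
  rw [e3]
  field_simp
  linarith

end TimeSlices

/-! ### Truncated mobility and the maximum principle. -/

section Truncation

/-- The mobility, extended by zero outside `[0,1]`. -/
def truncMobility (a : ℝ) : ℝ := mobility (max 0 (min a 1))

theorem truncMobility_of_mem {a : ℝ} (ha : a ∈ Icc (0 : ℝ) 1) : truncMobility a = mobility a := by
  rw [truncMobility, min_eq_left ha.2, max_eq_right ha.1]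

theorem truncMobility_of_nonpos {a : ℝ} (ha : a ≤ 0) : truncMobility a = 0 := by
  rw [truncMobility, max_eq_left ((min_le_left _ _).trans ha), mobility, zero_mul]

theorem truncMobility_of_one_le {a : ℝ} (ha : 1 ≤ a) : truncMobility a = 0 := by
  rw [truncMobility, min_eq_right ha, max_eq_right zero_le_one, mobility, sub_self, mul_zero]

theorem clip_mem (a : ℝ) : max 0 (min a 1) ∈ Icc (0 : ℝ) 1 :=
  ⟨le_max_left _ _, max_le zero_le_one (min_le_right _ _)⟩

theorem abs_truncMobility_le (a : ℝ) : |truncMobility a| ≤ 1 := by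
  have h := clip_mem a
  rw [truncMobility, mobility, abs_le]
  constructor <;> nlinarith [h.1, h.2]

theorem abs_truncMobility_sub_le (a b : ℝ) : |truncMobility a - truncMobility b| ≤ |a - b| := by
  refine (abs_mobility_sub_le (clip_mem a) (clip_mem b)).trans ?_
  refine (abs_max_sub_max_le_max 0 _ 0 _).trans ?_
  rw [sub_zero, abs_zero, max_eq_right (abs_nonneg _)]
  refine (abs_min_sub_min_le_max a 1 b 1).trans ?_
  rw [sub_self, abs_zero, max_eq_left (abs_nonneg _)]

theorem continuous_truncMobility : Continuous truncMobility := by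
  unfold truncMobility mobility; fun_prop

/-- The flux with truncated mobility. -/
def truncFlux (H u g : ℝ → ℝ → ℝ) (s x : ℝ) : ℝ :=
  g s x - 2 * truncMobility (u s x) * spaceDeriv H s x

theorem memLp_truncFlux {T : ℝ} {H u g : ℝ → ℝ → ℝ} (hH : IsC T 0 1 H)
    (hu : MemLp (fun p : ℝ × ℝ => u p.1 p.2) 2 ((timeMeasure T).prod unitMeasure))
    (hg : MemLp (fun p : ℝ × ℝ => g p.1 p.2) 2 ((timeMeasure T).prod unitMeasure)) :
    MemLp (fun p : ℝ × ℝ => truncFlux H u g p.1 p.2) 2 ((timeMeasure T).prod unitMeasure) := by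
  have hH' := memLp_of_continuousOn_cylinder (hH.continuousOn_spaceDeriv le_rfl)
  refine hg.sub (hH'.of_le_mul (c := 2) ?_ (Eventually.of_forall fun p => ?_))
  · exact ((continuous_truncMobility.comp_aestronglyMeasurable hu.1).const_mul 2).mul hH'.1
  · rw [norm_mul, norm_mul, Real.norm_ofNat]
    refine mul_le_mul_of_nonneg_right ?_ (norm_nonneg _)
    exact mul_le_of_le_one_right zero_le_two (abs_truncMobility_le _)

end Truncation

section MaximumPrinciple

variable {α β A B T : ℝ} {H u g : ℝ → ℝ → ℝ} {γ : ℝ → ℝ}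

theorem firstPrim_eq_zero {ρ : ℝ → ℝ} {a : ℝ} (h : ∀ s ∈ uIcc 0 a, ρ s = 0) :
    firstPrim ρ a = 0 := by
  rw [firstPrim, intervalIntegral.integral_congr (g := fun _ => 0) h]; simp

theorem secondPrim_eq_zero {ρ : ℝ → ℝ} {a : ℝ} (h : ∀ s ∈ uIcc 0 a, firstPrim ρ s = 0) :
    secondPrim ρ a = 0 := firstPrim_eq_zero h

/-- `hmob` removes the drift where `ρ` acts, leaving `-ρ(u) g² ≤ 0` in the interior, and `hflux`
gives the boundary terms their sign. With `K = 1`, the nonnegative energy then has nonpositive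
integral. -/
theorem secondPrim_comp_eq_zero {ρ : ℝ → ℝ} (hα : 0 < α) (hα1 : α < 1) (hβ0 : 0 < β) (hβ : β < 1)
    (hA : 0 < A) (hB : 0 < B)
    (h : IsFluxSolution T u g (truncFlux H u g) (fun s => boundaryFlux α A (u s 0) (H s 0))
      (fun s => boundaryFlux β B (u s 1) (H s 1)) γ)
    (hρ : Continuous ρ) (h0 : ∀ a, 0 ≤ ρ a) (h1 : ∀ a, ρ a ≤ 1)
    (hmob : ∀ a, truncMobility a * ρ a = 0)
    (hflux : ∀ ϱ D a M : ℝ, 0 < ϱ → ϱ < 1 → 0 < D → boundaryFlux ϱ D a M * firstPrim ρ a ≤ 0)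
    (hinit : ∀ᵐ x ∂unitMeasure, secondPrim ρ (γ x) = 0) :
    ∀ᵐ p ∂((timeMeasure T).prod unitMeasure), secondPrim ρ (u p.1 p.2) = 0 := by
  have hen := h.energy_le hρ h0 h1 hinit zero_le_one
  have hneg : ∫ p, Real.exp (-(1 * p.1)) * (boundaryFlux β B (u p.1 1) (H p.1 1) *
        firstPrim ρ (u p.1 1) + boundaryFlux α A (u p.1 0) (H p.1 0) * firstPrim ρ (u p.1 0)
        - truncFlux H u g p.1 p.2 * (ρ (u p.1 p.2) * g p.1 p.2))
        ∂((timeMeasure T).prod unitMeasure) ≤ 0 := by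
    refine integral_nonpos fun p => ?_
    refine mul_nonpos_of_nonneg_of_nonpos (Real.exp_pos _).le ?_
    have k1 := hflux β B (u p.1 1) (H p.1 1) hβ0 hβ hB
    have k0 := hflux α A (u p.1 0) (H p.1 0) hα hα1 hA
    have k2 : truncFlux H u g p.1 p.2 * (ρ (u p.1 p.2) * g p.1 p.2)
        = ρ (u p.1 p.2) * g p.1 p.2 ^ 2
          - 2 * (truncMobility (u p.1 p.2) * ρ (u p.1 p.2)) * spaceDeriv H p.1 p.2 * g p.1 p.2 := by
      rw [truncFlux]; ring
    rw [k2, hmob]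
    have k3 := mul_nonneg (h0 (u p.1 p.2)) (sq_nonneg (g p.1 p.2))
    linarith
  have hz := hen.trans hneg
  rw [one_mul] at hz
  have hnn : ∀ p : ℝ × ℝ, 0 ≤ Real.exp (-(1 * p.1)) * secondPrim ρ (u p.1 p.2) := fun p =>
    mul_nonneg (Real.exp_pos _).le (secondPrim_nonneg hρ h0 _)
  have hz' := le_antisymm hz (integral_nonneg hnn)
  rw [integral_eq_zero_iff_of_nonneg hnn
    (integrable_exp_mul zero_le_one (integrable_secondPrim_comp hρ h0 h1 h.memLp))] at hz'
  filter_upwards [hz'] with p hp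
  exact (mul_eq_zero.1 hp).resolve_left (Real.exp_pos _).ne'

/-- The maximum principle: a solution with truncated mobility takes values in `[0,1]`. -/
theorem ae_mem_Icc_of_truncFlux (hα : 0 < α) (hα1 : α < 1) (hβ0 : 0 < β) (hβ : β < 1)
    (hA : 0 < A) (hB : 0 < B) (hγ : ∀ x ∈ Icc (0 : ℝ) 1, γ x ∈ Icc (0 : ℝ) 1)
    (h : IsFluxSolution T u g (truncFlux H u g) (fun s => boundaryFlux α A (u s 0) (H s 0))
      (fun s => boundaryFlux β B (u s 1) (H s 1)) γ) :
    ∀ᵐ p ∂((timeMeasure T).prod unitMeasure), u p.1 p.2 ∈ Icc (0 : ℝ) 1 := by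
  have lower : ∀ᵐ p ∂((timeMeasure T).prod unitMeasure), 0 ≤ u p.1 p.2 := by
    -- A negative part, capped because the energy inequality asks for `ρ ≤ 1`. Below `0` the
    -- truncated mobility vanishes and the boundary flux is positive, against a negative `firstPrim
    -- ρ`.
    let ρ : ℝ → ℝ := fun a => min (max (-a) 0) 1
    have hρ : Continuous ρ := by fun_prop
    have h0 : ∀ a, 0 ≤ ρ a := fun a => le_min (le_max_right _ _) zero_le_one
    have h1 : ∀ a, ρ a ≤ 1 := fun a => min_le_right _ _
    have hz : ∀ a, 0 ≤ a → ρ a = 0 := fun a ha => by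
      simp only [ρ]
      rw [max_eq_right (by linarith), min_eq_left zero_le_one]
    have hfz : ∀ a, 0 ≤ a → firstPrim ρ a = 0 := fun a ha =>
      firstPrim_eq_zero fun s hs => hz s (by rw [uIcc_of_le ha] at hs; exact hs.1)
    have hflt : ∀ a, a < 0 → firstPrim ρ a < 0 := fun a ha => by
      have : 0 < ∫ s in a..0, ρ s :=
        intervalIntegral.intervalIntegral_pos_of_pos_on (hρ.intervalIntegrable _ _)
          (fun s hs => lt_min (lt_max_of_lt_left (by linarith [hs.2])) one_pos) ha
      rw [firstPrim, intervalIntegral.integral_symm]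
      linarith
    have key := secondPrim_comp_eq_zero hα hα1 hβ0 hβ hA hB h hρ h0 h1
      (fun a => by
        rcases le_total a 0 with ha | ha
        · rw [truncMobility_of_nonpos ha, zero_mul]
        · rw [hz a ha, mul_zero])
      (fun ϱ D a M p0 p1 pD => by
        rcases lt_or_ge a 0 with ha | ha
        · refine mul_nonpos_of_nonneg_of_nonpos ?_ (hflt a ha).le
          rw [boundaryFlux_eq]
          have := mul_pos (boundaryRate_pos p0 p1 pD M) (neg_pos.2 ha)
          have h2 : 0 < D⁻¹ * ϱ * Real.exp M := by positivity
          linarith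
        · rw [hfz a ha, mul_zero])
      (ae_unitMeasure_mem.mono fun x hx => secondPrim_eq_zero fun s hs => hfz s (by
        rw [uIcc_of_le (hγ x hx).1] at hs; exact hs.1))
    filter_upwards [key] with p hp
    by_contra hneg
    push Not at hneg
    -- If `secondPrim ρ` vanished at a negative value `u`, the tangent inequality between `u / 2`
    -- and `u` would make it negative at `u / 2`.
    have h2 := secondPrim_sub_le hρ h0 (u p.1 p.2 / 2) (u p.1 p.2)
    have h3 := secondPrim_nonneg hρ h0 (u p.1 p.2 / 2)
    have h4 := hflt (u p.1 p.2 / 2) (by linarith)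
    rw [hp] at h2
    nlinarith
  have upper : ∀ᵐ p ∂((timeMeasure T).prod unitMeasure), u p.1 p.2 ≤ 1 := by
    -- The mirror image: above `1` the mobility vanishes again, and the boundary flux is negative.
    let ρ : ℝ → ℝ := fun a => min (max (a - 1) 0) 1
    have hρ : Continuous ρ := by fun_prop
    have h0 : ∀ a, 0 ≤ ρ a := fun a => le_min (le_max_right _ _) zero_le_one
    have h1 : ∀ a, ρ a ≤ 1 := fun a => min_le_right _ _
    have hz : ∀ a, a ≤ 1 → ρ a = 0 := fun a ha => by
      simp only [ρ]
      rw [max_eq_right (by linarith), min_eq_left zero_le_one]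
    have hfz : ∀ a, a ≤ 1 → firstPrim ρ a = 0 := fun a ha =>
      firstPrim_eq_zero fun s hs => hz s (hs.2.trans (max_le zero_le_one ha))
    have hflt : ∀ a, 1 < a → 0 < firstPrim ρ a := fun a ha => by
      have : 0 < ∫ s in (1 : ℝ)..a, ρ s :=
        intervalIntegral.intervalIntegral_pos_of_pos_on (hρ.intervalIntegrable _ _)
          (fun s hs => lt_min (lt_max_of_lt_left (by linarith [hs.1])) one_pos) ha
      have e := firstPrim_sub hρ a 1
      rw [hfz 1 le_rfl] at e
      linarith
    have key := secondPrim_comp_eq_zero hα hα1 hβ0 hβ hA hB h hρ h0 h1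
      (fun a => by
        rcases le_total a 1 with ha | ha
        · rw [hz a ha, mul_zero]
        · rw [truncMobility_of_one_le ha, zero_mul])
      (fun ϱ D a M p0 p1 pD => by
        rcases lt_or_ge 1 a with ha | ha
        · refine mul_nonpos_of_nonpos_of_nonneg ?_ (hflt a ha).le
          rw [boundaryFlux]
          refine mul_nonpos_of_nonneg_of_nonpos (inv_pos.2 pD).le ?_
          have k1 : 0 < (a - 1) * ϱ * Real.exp M :=
            mul_pos (mul_pos (by linarith) p0) (Real.exp_pos _)
          have k2 : 0 < a * (1 - ϱ) * Real.exp (-M) :=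
            mul_pos (mul_pos (by linarith) (by linarith)) (Real.exp_pos _)
          linarith
        · rw [hfz a ha, mul_zero])
      (ae_unitMeasure_mem.mono fun x hx => secondPrim_eq_zero fun s hs => hfz s (by
        rw [uIcc_of_le (hγ x hx).1] at hs; exact hs.2.trans (hγ x hx).2))
    filter_upwards [key] with p hp
    by_contra hneg
    push Not at hneg
    have h2 := secondPrim_sub_le hρ h0 ((1 + u p.1 p.2) / 2) (u p.1 p.2)
    have h3 := secondPrim_nonneg hρ h0 ((1 + u p.1 p.2) / 2)
    have h4 := hflt ((1 + u p.1 p.2) / 2) (by linarith)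
    rw [hp] at h2
    nlinarith
  filter_upwards [lower, upper] with p h1 h2 using ⟨h1, h2⟩

end MaximumPrinciple

/-! ### A profile at every time. -/

section Slices

variable {T : ℝ}

/-- The test functions of class `C^{1,2}`. -/
def testSpace (T : ℝ) (hT : 0 < T) : Submodule ℝ (ℝ → ℝ → ℝ) where
  carrier := {G | IsC T 1 2 G}
  add_mem' h h' := h.add hT h'
  zero_mem' := isC_zero
  smul_mem' c _ h := h.const_smul hT c

theorem IsC.memLp_slice {m n : ℕ} {G : ℝ → ℝ → ℝ} (hG : IsC T m n G) {t : ℝ} (ht : t ∈ Icc 0 T) :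
    MemLp (G t) 2 unitMeasure :=
  memLp_unitMeasure_of_continuousOn (continuousOn_slice_left hG.continuousOn ht)

/-- Evaluation of a test function at a time, as an element of `L²`. -/
def sliceMap (hT : 0 < T) {t : ℝ} (ht : t ∈ Icc 0 T) :
    testSpace T hT →ₗ[ℝ] Lp ℝ 2 unitMeasure where
  toFun G := (IsC.memLp_slice G.2 ht).toLp (G.1 t)
  map_add' _ _ := rfl
  map_smul' _ _ := rfl

theorem inner_toLp_eq {α : Type*} [MeasurableSpace α] {μ : Measure α} {f g : α → ℝ}
    (hf : MemLp f 2 μ) (hg : MemLp g 2 μ) :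
    inner ℝ (hf.toLp f) (hg.toLp g) = ∫ x, f x * g x ∂μ := by
  rw [L2.inner_def]
  refine integral_congr_ae ?_
  filter_upwards [hf.coeFn_toLp, hg.coeFn_toLp] with x h1 h2
  rw [h1, h2]
  simp [mul_comm]

theorem continuousOn_integral_sq {m n : ℕ} {G : ℝ → ℝ → ℝ} (hG : IsC T m n G) :
    ContinuousOn (fun t => ∫ x, G t x ^ 2 ∂unitMeasure) (Icc 0 T) := by
  obtain ⟨C, -, hC⟩ := exists_bound_of_continuousOn_cylinder hG.continuousOn
  refine continuousOn_of_dominated (bound := fun _ => C ^ 2)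
    (fun t ht => ((hG.memLp_slice ht).1.pow 2)) (fun t ht => ?_) (integrable_const _) ?_
  · filter_upwards [ae_unitMeasure_mem] with x hx
    rw [norm_pow]
    exact pow_le_pow_left₀ (norm_nonneg _) (hC (t, x) ⟨ht, hx⟩) 2
  · filter_upwards [ae_unitMeasure_mem] with x hx
    exact (continuousOn_slice_right hG.continuousOn hx).pow 2

theorem le_of_ae_le_of_continuousOn (hT : 0 < T) {a b : ℝ → ℝ} (ha : ContinuousOn a (Icc 0 T))
    (hb : ContinuousOn b (Icc 0 T)) (h : ∀ᵐ t ∂timeMeasure T, a t ≤ b t) :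
    ∀ t ∈ Icc 0 T, a t ≤ b t := by
  have := Measure.eqOn_Icc_of_ae_eq volume hT.ne (f := fun t => max (a t) (b t)) (g := b)
    (h.mono fun t ht => max_eq_right ht) (ha.sup hb) hb
  exact fun t ht => max_eq_right_iff.1 (this ht)

theorem eq_of_ae_eq_of_continuousOn (hT : 0 < T) {a b : ℝ → ℝ} (ha : ContinuousOn a (Icc 0 T))
    (hb : ContinuousOn b (Icc 0 T)) (h : ∀ᵐ t ∂timeMeasure T, a t = b t) :
    ∀ t ∈ Icc 0 T, a t = b t := fun _ ht =>
  Measure.eqOn_Icc_of_ae_eq volume hT.ne h ha hb ht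

/-- If `∫ u_t G_t` has a continuous version `Λ G` for every test function `G`, then every time has
a profile representing `Λ`. -/
theorem exists_slice (hT : 0 < T) {u : ℝ → ℝ → ℝ} {Λ : (ℝ → ℝ → ℝ) → ℝ → ℝ}
    (hu : MemLp (fun p : ℝ × ℝ => u p.1 p.2) 2 ((timeMeasure T).prod unitMeasure))
    (hI : ∀ᵐ p ∂((timeMeasure T).prod unitMeasure), u p.1 p.2 ∈ Icc (0 : ℝ) 1)
    (hc : ∀ G, IsC T 1 2 G → ContinuousOn (Λ G) (Icc 0 T))
    (hΛ : ∀ G, IsC T 1 2 G → ∀ᵐ t ∂timeMeasure T, ∫ x, u t x * G t x ∂unitMeasure = Λ G t)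
    {t : ℝ} (ht : t ∈ Icc 0 T) :
    ∃ v : ℝ → ℝ, MemLp v 2 unitMeasure ∧
      ∀ G, IsC T 1 2 G → ∫ x, v x * G t x ∂unitMeasure = Λ G t := by
  have hus := ae_memLp_slice hu
  have hIs : ∀ᵐ t ∂timeMeasure T, ∀ᵐ x ∂unitMeasure, u t x ∈ Icc (0 : ℝ) 1 :=
    Measure.ae_ae_of_ae_prod hI
  -- For almost every time the bound follows from `0 ≤ u ≤ 1`; both sides are continuous in time, so
  -- it holds at the given `t`. Linearity of `Λ` at `t` is obtained likewise, and Riesz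
  -- representation applies.
  have hbound : ∀ G, IsC T 1 2 G → Λ G t ^ 2 ≤ ∫ x, G t x ^ 2 ∂unitMeasure := fun G hG => by
    refine le_of_ae_le_of_continuousOn hT ((hc G hG).pow 2) (continuousOn_integral_sq hG) ?_ t ht
    filter_upwards [hΛ G hG, hus, hIs, ae_timeMeasure_mem T] with s h1 h2 h3 hs
    rw [Pi.pow_apply, ← h1]
    have mG := hG.memLp_slice hs
    have mu : MemLp (fun x => u s x * G s x) 2 unitMeasure :=
      mG.of_le (h2.1.mul mG.1) (h3.mono fun x hx => by
        rw [norm_mul]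
        refine mul_le_of_le_one_left (norm_nonneg _) ?_
        rw [Real.norm_eq_abs, abs_of_nonneg hx.1]; exact hx.2)
    refine (sq_integral_le_integral_sq mu).trans (integral_mono_ae mu.integrable_sq
      mG.integrable_sq (h3.mono fun x hx => ?_))
    simp only [mul_pow]
    exact mul_le_of_le_one_left (sq_nonneg _) (pow_le_one₀ hx.1 hx.2)
  have hadd : ∀ G G', IsC T 1 2 G → IsC T 1 2 G' → Λ (G + G') t = Λ G t + Λ G' t :=
    fun G G' hG hG' => by
      refine eq_of_ae_eq_of_continuousOn hT (hc _ (hG.add hT hG')) ((hc G hG).add (hc G' hG')) ?_ t ht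
      filter_upwards [hΛ G hG, hΛ G' hG', hΛ _ (hG.add hT hG'), hus, ae_timeMeasure_mem T]
        with s h1 h2 h3 h4 hs
      simp only [Pi.add_apply] at h3 ⊢
      rw [← h1, ← h2, ← h3, ← integral_add (integrable_mul_of_memLp_two h4 (hG.memLp_slice hs))
        (integrable_mul_of_memLp_two h4 (hG'.memLp_slice hs))]
      simp_rw [mul_add]
  have hsmul : ∀ (c : ℝ) G, IsC T 1 2 G → Λ (c • G) t = c * Λ G t := fun c G hG => by
    refine eq_of_ae_eq_of_continuousOn hT (hc _ (hG.const_smul hT c))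
      (continuousOn_const.mul (hc G hG)) ?_ t ht
    filter_upwards [hΛ G hG, hΛ _ (hG.const_smul hT c)] with s h1 h2
    simp only [Pi.smul_apply, smul_eq_mul, Pi.mul_apply] at h2 ⊢
    rw [← h1, ← h2, ← integral_const_mul]
    exact integral_congr_ae (Eventually.of_forall fun x => by simp only; ring)
  let l : testSpace T hT →ₗ[ℝ] ℝ :=
    { toFun := fun G => Λ G.1 t
      map_add' := fun G G' => hadd G.1 G'.1 G.2 G'.2
      map_smul' := fun c G => hsmul c G.1 G.2 }
  obtain ⟨v, -, -, hv⟩ := exists_mem_closure_range_inner_eq (sliceMap hT ht) l zero_le_one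
    fun G => by
      rw [one_mul]
      refine abs_le_of_sq_le_sq (?_ : _ ≤ _) (norm_nonneg _)
      rw [← real_inner_self_eq_norm_sq]
      refine (hbound G.1 G.2).trans_eq (Eq.trans ?_
        (inner_toLp_eq (IsC.memLp_slice G.2 ht) (IsC.memLp_slice G.2 ht)).symm)
      simp_rw [sq]
  refine ⟨v, Lp.memLp v, fun G hG => ?_⟩
  have := hv ⟨G, hG⟩
  have e : inner ℝ v (sliceMap hT ht ⟨G, hG⟩) = ∫ x, v x * G t x ∂unitMeasure := by
    have h2 := inner_toLp_eq (Lp.memLp v) (hG.memLp_slice ht)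
    rw [Lp.toLp_coeFn] at h2
    exact h2
  rw [← e, this]
  rfl

end Slices

/-! ### From the truncated problem to weak solutions. -/

section FromTruncated

variable {α β A B T : ℝ} {H u g : ℝ → ℝ → ℝ} {γ : ℝ → ℝ}

/-- A solution of the problem with truncated mobility yields a weak solution. -/
theorem exists_isWeakSolution_of_truncated (hα : 0 < α) (hα1 : α < 1) (hβ0 : 0 < β) (hβ : β < 1)
    (hA : 0 < A) (hB : 0 < B) (hT : 0 < T) (hH : IsC T 0 1 H)
    (hγ : ∀ x ∈ Icc (0 : ℝ) 1, γ x ∈ Icc (0 : ℝ) 1) (hγm : MemLp γ 2 unitMeasure)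
    (hu : MemLp (fun p : ℝ × ℝ => u p.1 p.2) 2 ((timeMeasure T).prod unitMeasure))
    (hg : MemLp (fun p : ℝ × ℝ => g p.1 p.2) 2 ((timeMeasure T).prod unitMeasure))
    (hp : ∀ᵐ t ∂timeMeasure T, ∀ x ∈ Icc (0 : ℝ) 1, u t x = u t 0 + primitive (g t) x)
    (h : ∀ G, IsC T 1 2 G → (∀ x ∈ Icc (0 : ℝ) 1, G T x = 0) →
      -(∫ x, γ x * G 0 x ∂unitMeasure) = ∫ s in (0 : ℝ)..T, weakRate T u (truncFlux H u g)
        (fun s => boundaryFlux α A (u s 0) (H s 0)) (fun s => boundaryFlux β B (u s 1) (H s 1)) G s) :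
    ∃ v, IsWeakSolution α β A B T H γ v := by
  have hf := memLp_truncFlux hH hu hg
  have hq₀ : MemLp (fun s => boundaryFlux α A (u s 0) (H s 0)) 2 (timeMeasure T) :=
    memLp_boundaryFlux (memLp_trace_zero hu hg hp)
      (continuousOn_slice_right hH.continuousOn (left_mem_Icc.2 zero_le_one))
  have hq₁ : MemLp (fun s => boundaryFlux β B (u s 1) (H s 1)) 2 (timeMeasure T) :=
    memLp_boundaryFlux (memLp_trace_one hu hg hp)
      (continuousOn_slice_right hH.continuousOn (right_mem_Icc.2 zero_le_one))
  have hae := fun G (hG : IsC T 1 2 G) => ae_weakRate_of_forall_vanishing hT hu hf hq₀ hq₁ h hG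
  have hI := ae_mem_Icc_of_truncFlux hα hα1 hβ0 hβ hA hB hγ
    (isFluxSolution_of_weakRate hu hg hf hq₀ hq₁ hγm hp hae)
  set R := weakRate T u (truncFlux H u g) (fun s => boundaryFlux α A (u s 0) (H s 0))
    (fun s => boundaryFlux β B (u s 1) (H s 1)) with hR
  let Λ : (ℝ → ℝ → ℝ) → ℝ → ℝ := fun G t =>
    -- The value that the weak identity prescribes for `∫ u_t G_t`, continuous in `t`.
    (∫ x, γ x * G 0 x ∂unitMeasure) + ∫ s in (0 : ℝ)..t, R G s
  have hΛ : ∀ G, IsC T 1 2 G → ∀ᵐ t ∂timeMeasure T, ∫ x, u t x * G t x ∂unitMeasure = Λ G t :=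
    fun G hG => (hae G hG).mono fun t ht => by simp only [Λ]; linarith
  have hc : ∀ G, IsC T 1 2 G → ContinuousOn (Λ G) (Icc 0 T) := fun G hG => by
    have := intervalIntegral.continuousOn_primitive_interval (a := 0) (b := T)
      (f := R G) (μ := volume) (by
        rw [uIcc_of_le hT.le]; exact integrable_weakRate hu hf hq₀ hq₁ hG)
    rw [uIcc_of_le hT.le] at this
    exact continuousOn_const.add this
  have hex : ∀ t, ∃ v : ℝ → ℝ, t ∈ Icc 0 T → MemLp v 2 unitMeasure ∧
      ∀ G, IsC T 1 2 G → ∫ x, v x * G t x ∂unitMeasure = Λ G t := fun t => by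
    by_cases ht : t ∈ Icc 0 T
    · obtain ⟨v, hv⟩ := exists_slice hT hu hI hc hΛ ht
      exact ⟨v, fun _ => hv⟩
    · exact ⟨0, fun h => absurd h ht⟩
  choose w hw using hex
  have hws : ∀ᵐ t ∂timeMeasure T, u t =ᵐ[unitMeasure] w t := by
    have hmom : ∀ᵐ t ∂timeMeasure T, ∀ m : ℕ, ∫ x, u t x * x ^ m ∂unitMeasure
        = Λ (fun _ x => x ^ m) t := ae_all_iff.2 fun m => hΛ _ (isC_pow m)
    filter_upwards [hmom, ae_memLp_slice hu, ae_timeMeasure_mem T] with t ht hut htm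
    obtain ⟨h1, h2⟩ := hw t htm
    have key := ae_eq_zero_of_moments_eq_zero (a := 0) (b := 1) (h := fun x => u t x - w t x)
      ((hut.sub h1).integrable one_le_two) fun m => ?_
    · filter_upwards [key] with x hx using sub_eq_zero.1 hx
    · simp_rw [mul_sub, mul_comm (_ ^ m)]
      refine (integral_sub (integrable_mul_of_memLp_two hut (memLp_pow m))
        (integrable_mul_of_memLp_two h1 (memLp_pow m))).trans ?_
      exact sub_eq_zero.2 ((ht m).trans (h2 _ (isC_pow m)).symm)
  classical
  -- For almost every `t` this is literally `u t`, which keeps the continuous version and its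
  -- traces; the remaining times receive the profile `w t` for which the identity holds.
  let v : ℝ → ℝ → ℝ := fun t => if u t =ᵐ[unitMeasure] w t then u t else w t
  have hvw : ∀ t, v t =ᵐ[unitMeasure] w t := fun t => by
    simp only [v]
    split_ifs with h
    exacts [h, EventuallyEq.rfl]
  have hvu : ∀ᵐ t ∂timeMeasure T, v t = u t := hws.mono fun t ht => if_pos ht
  have hvu' : ∀ᵐ p ∂((timeMeasure T).prod unitMeasure), v p.1 = u p.1 :=
    Measure.quasiMeasurePreserving_fst.ae hvu
  have hvm : MemLp (fun p : ℝ × ℝ => v p.1 p.2) 2 ((timeMeasure T).prod unitMeasure) :=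
    hu.ae_eq (hvu'.mono fun p hp => by simp only [hp])
  have hvI : ∀ᵐ p ∂((timeMeasure T).prod unitMeasure), v p.1 p.2 ∈ Icc (0 : ℝ) 1 := by
    filter_upwards [hvu', hI] with p h1 h2
    rwa [h1]
  refine ⟨v, fun t ht => (hw t ht).1.ae_eq (hvw t).symm, by rwa [restrict_cylinder], g,
    ⟨by rwa [restrict_cylinder], by rwa [restrict_cylinder], ?_⟩, fun t ht G hG => ?_⟩
  · change ∀ᵐ t ∂timeMeasure T, _
    filter_upwards [hvu, hp, ae_memLp_slice hg] with t h1 h2 h3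
    rw [h1]
    exact isH1_of_eq_primitive h3 h2
  · have htI := Ioc_subset_Icc_self ht
    have hv₀ : MemLp (fun s => boundaryFlux α A (v s 0) (H s 0)) 2 (timeMeasure T) :=
      hq₀.ae_eq (hvu.mono fun s hs => by simp only [hs])
    have hv₁ : MemLp (fun s => boundaryFlux β B (v s 1) (H s 1)) 2 (timeMeasure T) :=
      hq₁.ae_eq (hvu.mono fun s hs => by simp only [hs])
    rw [weakIdentity_iff hvm (memLp_driftFlux hH hvm hg hvI) hv₀ hv₁ hG htI]
    have e1 : ∫ x, v t x * G t x ∂unitMeasure = Λ G t := by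
      rw [← (hw t htI).2 G hG]
      exact integral_congr_ae ((hvw t).mono fun x hx => by simp only [hx])
    rw [e1, add_sub_cancel_left]
    refine intervalIntegral_congr_timeMeasure htI ?_
    have hIs : ∀ᵐ t ∂timeMeasure T, ∀ᵐ x ∂unitMeasure, u t x ∈ Icc (0 : ℝ) 1 :=
      Measure.ae_ae_of_ae_prod hI
    filter_upwards [hvu, hIs] with s hs hsI
    -- The values lie in `[0,1]`, where the truncation does nothing.
    have e2 : ∫ x, truncFlux H u g s x * spaceDeriv G s x ∂unitMeasure
        = ∫ x, driftFlux H v g s x * spaceDeriv G s x ∂unitMeasure :=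
      integral_congr_ae (hsI.mono fun x hx => by
        simp only [truncFlux, driftFlux, hs, truncMobility_of_mem hx])
    simp only [hR, weakRate, e2, hs]

end FromTruncated

/-! ### Finite products of `L²` spaces, and averaging and primitive operators. -/

section HilbertSpace

variable {X : Type*} [MeasurableSpace X] {μ : Measure X} {ι : Type*}

/-- A finite family of square integrable functions, as an element of a Hilbert space. -/
def familyToLp (f : ι → X → ℝ) (hf : ∀ j, MemLp (f j) 2 μ) : PiLp 2 fun _ : ι => Lp ℝ 2 μ :=
  WithLp.toLp 2 fun j => (hf j).toLp (f j)

theorem coeFn_familyToLp (f : ι → X → ℝ) (hf : ∀ j, MemLp (f j) 2 μ) (j : ι) :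
    familyToLp f hf j =ᵐ[μ] f j := (hf j).coeFn_toLp

theorem inner_familyToLp [Fintype ι] {f g : ι → X → ℝ} (hf : ∀ j, MemLp (f j) 2 μ)
    (hg : ∀ j, MemLp (g j) 2 μ) :
    inner ℝ (familyToLp f hf) (familyToLp g hg) = ∫ x, ∑ j, f j x * g j x ∂μ := by
  rw [PiLp.inner_apply]
  refine Eq.trans (Finset.sum_congr rfl fun j _ => inner_toLp_eq (hf j) (hg j)) ?_
  exact (integral_finsetSum _ fun j _ => integrable_mul_of_memLp_two (hf j) (hg j)).symm

theorem familyToLp_coeFn (e : PiLp 2 fun _ : ι => Lp ℝ 2 μ) :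
    familyToLp (fun j => e j) (fun j => Lp.memLp (e j)) = e := by
  ext1 j
  exact Lp.toLp_coeFn (e j) (Lp.memLp (e j))

/-- A linear family of square integrable functions, as a linear map to a Hilbert space. -/
def familyMap {Φ : Type*} [AddCommGroup Φ] [Module ℝ Φ] (a : Φ → ι → X → ℝ)
    (ha : ∀ φ j, MemLp (a φ j) 2 μ) (hadd : ∀ φ ψ j, a (φ + ψ) j =ᵐ[μ] a φ j + a ψ j)
    (hsmul : ∀ (c : ℝ) φ j, a (c • φ) j =ᵐ[μ] c • a φ j) :
    Φ →ₗ[ℝ] PiLp 2 fun _ : ι => Lp ℝ 2 μ where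
  toFun φ := familyToLp (a φ) (ha φ)
  map_add' φ ψ := by
    ext1 j
    exact (MemLp.toLp_congr (ha _ j) ((ha φ j).add (ha ψ j)) (hadd φ ψ j)).trans
      (MemLp.toLp_add (ha φ j) (ha ψ j))
  map_smul' c φ := by
    ext1 j
    exact (MemLp.toLp_congr (ha _ j) ((ha φ j).const_smul c) (hsmul c φ j)).trans
      (MemLp.toLp_const_smul c (ha φ j))

theorem norm_sq_toLp_eq {f : X → ℝ} (hf : MemLp f 2 μ) : ‖hf.toLp f‖ ^ 2 = ∫ x, f x ^ 2 ∂μ := by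
  rw [← real_inner_self_eq_norm_sq, inner_toLp_eq]
  simp_rw [sq]

/-- A linear operation on square integrable functions that does not increase the `L²` norm is a
continuous linear map of `L²`. -/
theorem exists_continuousLinearMap_of_integral_sq_le (S : (X → ℝ) → X → ℝ)
    (hS : ∀ f, MemLp f 2 μ → MemLp (S f) 2 μ ∧ ∫ x, S f x ^ 2 ∂μ ≤ ∫ x, f x ^ 2 ∂μ)
    (hcongr : ∀ f g, f =ᵐ[μ] g → S f =ᵐ[μ] S g)
    (hadd : ∀ f g, MemLp f 2 μ → MemLp g 2 μ → S (f + g) =ᵐ[μ] S f + S g)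
    (hsmul : ∀ (c : ℝ) f, S (c • f) =ᵐ[μ] c • S f) :
    ∃ L : Lp ℝ 2 μ →L[ℝ] Lp ℝ 2 μ, ∀ f, L f =ᵐ[μ] S f := by
  have hm : ∀ f : Lp ℝ 2 μ, MemLp (S f) 2 μ := fun f => (hS f (Lp.memLp f)).1
  let L₀ : Lp ℝ 2 μ →ₗ[ℝ] Lp ℝ 2 μ :=
    { toFun := fun f => (hm f).toLp (S f)
      map_add' := fun f g => by
        refine (MemLp.toLp_congr (hm _) ((hm f).add (hm g)) ?_).trans (MemLp.toLp_add _ _)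
        exact (hcongr _ _ (Lp.coeFn_add f g)).trans (hadd _ _ (Lp.memLp f) (Lp.memLp g))
      map_smul' := fun c f => by
        refine (MemLp.toLp_congr (hm _) ((hm f).const_smul c) ?_).trans
          (MemLp.toLp_const_smul c _)
        exact (hcongr _ _ (Lp.coeFn_smul c f)).trans (hsmul c _) }
  refine ⟨L₀.mkContinuous 1 fun f => ?_, fun f => (hm f).coeFn_toLp⟩
  rw [one_mul]
  refine abs_le_of_sq_le_sq' ?_ (norm_nonneg _) |>.2
  have h1 := norm_sq_toLp_eq (hm f)
  have h2 := norm_sq_toLp_eq (Lp.memLp f)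
  rw [Lp.toLp_coeFn] at h2
  rw [h2]
  exact h1.trans_le (hS f (Lp.memLp f)).2

end HilbertSpace

section Operators

variable {T : ℝ}

theorem ae_slice_eq {f g : ℝ × ℝ → ℝ} (h : f =ᵐ[(timeMeasure T).prod unitMeasure] g) :
    ∀ᵐ p ∂((timeMeasure T).prod unitMeasure), ∀ᵐ y ∂unitMeasure, f (p.1, y) = g (p.1, y) :=
  Measure.quasiMeasurePreserving_fst.ae (Measure.ae_ae_of_ae_prod h)

theorem ae_memLp_slice_fst {f : ℝ × ℝ → ℝ} (h : MemLp f 2 ((timeMeasure T).prod unitMeasure)) :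
    ∀ᵐ p ∂((timeMeasure T).prod unitMeasure), MemLp (fun y => f (p.1, y)) 2 unitMeasure :=
  Measure.quasiMeasurePreserving_fst.ae (ae_memLp_slice (f := fun t y => f (t, y)) h)

/-- Integration in space, as an operator on `L²`. -/
theorem exists_averageOp (T : ℝ) :
    ∃ L : Lp ℝ 2 ((timeMeasure T).prod unitMeasure) →L[ℝ] Lp ℝ 2 ((timeMeasure T).prod unitMeasure),
      ∀ f, L f =ᵐ[(timeMeasure T).prod unitMeasure] fun p => ∫ y, f (p.1, y) ∂unitMeasure := by
  refine exists_continuousLinearMap_of_integral_sq_le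
    (fun f p => ∫ y, f (p.1, y) ∂unitMeasure) (fun f hf => ?_) (fun f g h => ?_)
    (fun f g hf hg => ?_) (fun c f => ?_)
  · obtain ⟨h1, h2⟩ := memLp_integral_unitMeasure (F := fun t y => f (t, y)) hf
    refine ⟨memLp_comp_fst h1, le_trans (le_of_eq ?_) h2⟩
    rw [integral_prod _ (memLp_comp_fst h1).integrable_sq]
    simp
  · filter_upwards [ae_slice_eq h] with p hp using integral_congr_ae hp
  · filter_upwards [ae_memLp_slice_fst hf, ae_memLp_slice_fst hg] with p h1 h2
    exact integral_add (h1.integrable one_le_two) (h2.integrable one_le_two)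
  · exact Eventually.of_forall fun p => integral_const_mul c _

/-- The primitive in space, as an operator on `L²`. -/
theorem exists_primitiveOp (T : ℝ) :
    ∃ L : Lp ℝ 2 ((timeMeasure T).prod unitMeasure) →L[ℝ] Lp ℝ 2 ((timeMeasure T).prod unitMeasure),
      ∀ f, L f =ᵐ[(timeMeasure T).prod unitMeasure] fun p => primitive (fun y => f (p.1, y)) p.2 := by
  refine exists_continuousLinearMap_of_integral_sq_le
    (fun f p => primitive (fun y => f (p.1, y)) p.2) (fun f hf => ?_) (fun f g h => ?_)
    (fun f g hf hg => ?_) (fun c f => ?_)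
  · exact memLp_primitive (F := fun t y => f (t, y)) hf
  · filter_upwards [ae_slice_eq h] with p hp using primitive_congr hp _
  · filter_upwards [ae_memLp_slice_fst hf, ae_memLp_slice_fst hg] with p h1 h2
    simp only [primitive, Pi.add_apply, mul_add]
    exact integral_add (integrable_leKernel_mul (h1.integrable one_le_two) _)
      (integrable_leKernel_mul (h2.integrable one_le_two) _)
  · refine Eventually.of_forall fun p => ?_
    simp only [primitive, Pi.smul_apply, smul_eq_mul, mul_left_comm _ c]
    exact integral_const_mul c _

end Operators

/-! ### The parabolic operator in Lions' setting. -/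

section Lions

variable {T : ℝ}

/-- The test functions of class `C^{1,2}` that vanish at the final time. -/
def vanishingSpace (T : ℝ) (hT : 0 < T) : Submodule ℝ (ℝ → ℝ → ℝ) where
  carrier := {G | IsC T 1 2 G ∧ ∀ x ∈ Icc (0 : ℝ) 1, G T x = 0}
  add_mem' h h' := ⟨h.1.add hT h'.1, fun x hx => by
    simp only [Pi.add_apply, h.2 x hx, h'.2 x hx, add_zero]⟩
  zero_mem' := ⟨isC_zero, fun _ _ => rfl⟩
  smul_mem' c _ h := ⟨h.1.const_smul hT c, fun x hx => by
    simp only [Pi.smul_apply, h.2 x hx, smul_zero]⟩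

/-- A function on the cylinder, scaled by `r`, with its space derivative and its traces. -/
def jet (r : ℝ) (G : ℝ → ℝ → ℝ) : Fin 4 → ℝ × ℝ → ℝ :=
  ![fun p => r * G p.1 p.2, fun p => spaceDeriv G p.1 p.2, fun p => G p.1 1, fun p => G p.1 0]

/-- The image of a test function under the formal adjoint of the parabolic operator, paired with
`jet`. -/
def dualJet (T r : ℝ) (c₀ c₁ : ℝ → ℝ) (G : ℝ → ℝ → ℝ) : Fin 4 → ℝ × ℝ → ℝ :=
  ![fun p => r⁻¹ * -timeDeriv T G p.1 p.2 + r * G p.1 p.2, fun p => spaceDeriv G p.1 p.2,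
    fun p => c₁ p.1 * G p.1 1, fun p => c₀ p.1 * G p.1 0]

theorem IsC.memLp_trace {m n : ℕ} {G : ℝ → ℝ → ℝ} (hG : IsC T m n G) {x : ℝ}
    (hx : x ∈ Icc (0 : ℝ) 1) : MemLp (fun t => G t x) 2 (timeMeasure T) :=
  memLp_timeMeasure_of_continuousOn (continuousOn_slice_right hG.continuousOn hx)

theorem memLp_jet (r : ℝ) {G : ℝ → ℝ → ℝ} (hG : IsC T 1 2 G) (j : Fin 4) :
    MemLp (jet r G j) 2 ((timeMeasure T).prod unitMeasure) := by
  fin_cases j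
  · exact (memLp_of_continuousOn_cylinder hG.continuousOn).const_mul r
  · exact memLp_of_continuousOn_cylinder (hG.continuousOn_spaceDeriv one_le_two)
  · exact memLp_comp_fst (hG.memLp_trace (right_mem_Icc.2 zero_le_one))
  · exact memLp_comp_fst (hG.memLp_trace (left_mem_Icc.2 zero_le_one))

theorem memLp_dualJet (r : ℝ) {c₀ c₁ : ℝ → ℝ} (h₀ : ContinuousOn c₀ (Icc 0 T))
    (h₁ : ContinuousOn c₁ (Icc 0 T)) {G : ℝ → ℝ → ℝ} (hG : IsC T 1 2 G) (j : Fin 4) :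
    MemLp (dualJet T r c₀ c₁ G j) 2 ((timeMeasure T).prod unitMeasure) := by
  fin_cases j
  · exact ((memLp_of_continuousOn_cylinder (hG.continuousOn_timeDeriv le_rfl)).neg.const_mul _).add
      ((memLp_of_continuousOn_cylinder hG.continuousOn).const_mul r)
  · exact memLp_of_continuousOn_cylinder (hG.continuousOn_spaceDeriv one_le_two)
  · exact memLp_comp_fst (memLp_continuousOn_mul h₁ (hG.memLp_trace (right_mem_Icc.2 zero_le_one)))
  · exact memLp_comp_fst (memLp_continuousOn_mul h₀ (hG.memLp_trace (left_mem_Icc.2 zero_le_one)))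

/-- `jet`, as a linear map to a Hilbert space. -/
def jetMap (hT : 0 < T) (r : ℝ) : vanishingSpace T hT →ₗ[ℝ]
    PiLp 2 fun _ : Fin 4 => Lp ℝ 2 ((timeMeasure T).prod unitMeasure) :=
  familyMap (fun G => jet r G.1) (fun G => memLp_jet r G.2.1)
    (fun G G' j => by
      filter_upwards [ae_prod_mem_cylinder T] with p hp
      have := spaceDeriv_add G.2.1 G'.2.1 hp.1 hp.2
      fin_cases j
      · exact mul_add r _ _
      · exact this
      · rfl
      · rfl)
    (fun c G j => by
      filter_upwards [ae_prod_mem_cylinder T] with p hp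
      have := spaceDeriv_smul c G.2.1 hp.1 hp.2
      fin_cases j
      · exact mul_left_comm r c _
      · exact this
      · rfl
      · rfl)

/-- `dualJet`, as a linear map to a Hilbert space. -/
def dualJetMap (hT : 0 < T) (r : ℝ) {c₀ c₁ : ℝ → ℝ} (h₀ : ContinuousOn c₀ (Icc 0 T))
    (h₁ : ContinuousOn c₁ (Icc 0 T)) : vanishingSpace T hT →ₗ[ℝ]
    PiLp 2 fun _ : Fin 4 => Lp ℝ 2 ((timeMeasure T).prod unitMeasure) :=
  familyMap (fun G => dualJet T r c₀ c₁ G.1) (fun G => memLp_dualJet r h₀ h₁ G.2.1)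
    (fun G G' j => by
      filter_upwards [ae_prod_mem_cylinder T] with p hp
      have h1 := spaceDeriv_add G.2.1 G'.2.1 hp.1 hp.2
      have h2 := timeDeriv_add G.2.1 G'.2.1 hT hp.1 hp.2
      fin_cases j
      · change r⁻¹ * -timeDeriv T (G.1 + G'.1) p.1 p.2 + r * (G.1 p.1 p.2 + G'.1 p.1 p.2)
          = (r⁻¹ * -timeDeriv T G.1 p.1 p.2 + r * G.1 p.1 p.2)
            + (r⁻¹ * -timeDeriv T G'.1 p.1 p.2 + r * G'.1 p.1 p.2)
        rw [h2]; ring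
      · exact h1
      · exact mul_add (c₁ p.1) _ _
      · exact mul_add (c₀ p.1) _ _)
    (fun c G j => by
      filter_upwards [ae_prod_mem_cylinder T] with p hp
      have h1 := spaceDeriv_smul c G.2.1 hp.1 hp.2
      have h2 := timeDeriv_smul c G.2.1 hT hp.1 hp.2
      fin_cases j
      · change r⁻¹ * -timeDeriv T (c • G.1) p.1 p.2 + r * (c * G.1 p.1 p.2)
          = c * (r⁻¹ * -timeDeriv T G.1 p.1 p.2 + r * G.1 p.1 p.2)
        rw [h2]; ring
      · exact h1
      · exact mul_left_comm (c₁ p.1) c _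
      · exact mul_left_comm (c₀ p.1) c _)

/-- For fixed `x` the integrand is the time derivative of `-G² / 2`, and `G` vanishes at `T`. -/
theorem integral_mul_neg_timeDeriv (hT : 0 < T) {G : ℝ → ℝ → ℝ} (hG : IsC T 1 2 G)
    (h : ∀ x ∈ Icc (0 : ℝ) 1, G T x = 0) :
    ∫ p : ℝ × ℝ, G p.1 p.2 * -timeDeriv T G p.1 p.2 ∂((timeMeasure T).prod unitMeasure)
      = (∫ x, G 0 x ^ 2 ∂unitMeasure) / 2 := by
  have hi := (memLp_of_continuousOn_cylinder hG.continuousOn).integrable_mul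
    (memLp_of_continuousOn_cylinder (hG.continuousOn_timeDeriv le_rfl)).neg
  refine (integral_prod_symm _ hi).trans ?_
  rw [← integral_div]
  refine integral_congr_ae (ae_unitMeasure_mem.mono fun x hx => ?_)
  change ∫ t, G t x * -timeDeriv T G t x ∂timeMeasure T = G 0 x ^ 2 / 2
  have hc := continuousOn_slice_right hG.continuousOn hx
  have hd := continuousOn_slice_right (hG.continuousOn_timeDeriv le_rfl) hx
  rw [integral_timeMeasure hT.le, intervalIntegral.integral_eq_sub_of_hasDerivAt_of_le hT.le
    (f := fun t => -(G t x ^ 2 / 2))]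
  · rw [h x hx]; ring
  · exact ((hc.pow 2).div_const 2).neg
  · intro t ht
    have := (hG.hasDerivWithinAt_time le_rfl (Ioo_subset_Icc_self ht) hx).hasDerivAt
      (Icc_mem_nhds ht.1 ht.2)
    refine (((this.pow 2).div_const 2).neg).congr_deriv ?_
    norm_num
    ring
  · refine ContinuousOn.intervalIntegrable ?_
    rw [uIcc_of_le hT.le]
    exact hc.mul hd.neg

/-- The factors `r` and `r⁻¹` cancel in the time derivative term, while the two factors `r` produce
the zero-order term `r² G²`, which is the square of the first component. -/
theorem inner_jetMap_dualJetMap (hT : 0 < T) {r : ℝ} (hr : r ≠ 0) {c₀ c₁ : ℝ → ℝ}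
    (h₀ : ContinuousOn c₀ (Icc 0 T)) (h₁ : ContinuousOn c₁ (Icc 0 T)) (G : vanishingSpace T hT) :
    inner ℝ (jetMap hT r G) (dualJetMap hT r h₀ h₁ G) = (∫ x, G.1 0 x ^ 2 ∂unitMeasure) / 2
      + ∫ p, (jet r G.1 0 p ^ 2 + jet r G.1 1 p ^ 2 + c₁ p.1 * jet r G.1 2 p ^ 2
        + c₀ p.1 * jet r G.1 3 p ^ 2) ∂((timeMeasure T).prod unitMeasure) := by
  have hG := G.2.1
  have hi := (memLp_of_continuousOn_cylinder hG.continuousOn).integrable_mul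
    (memLp_of_continuousOn_cylinder (hG.continuousOn_timeDeriv le_rfl)).neg
  have m := memLp_jet r hG
  have d := memLp_dualJet r h₀ h₁ hG
  have j2 : Integrable (fun p : ℝ × ℝ => c₁ p.1 * jet r G.1 2 p ^ 2)
      ((timeMeasure T).prod unitMeasure) :=
    ((m 2).integrable_mul (d 2)).congr (Eventually.of_forall fun p => by
      change G.1 p.1 1 * (c₁ p.1 * G.1 p.1 1) = c₁ p.1 * G.1 p.1 1 ^ 2; ring)
  have j3 : Integrable (fun p : ℝ × ℝ => c₀ p.1 * jet r G.1 3 p ^ 2)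
      ((timeMeasure T).prod unitMeasure) :=
    ((m 3).integrable_mul (d 3)).congr (Eventually.of_forall fun p => by
      change G.1 p.1 0 * (c₀ p.1 * G.1 p.1 0) = c₀ p.1 * G.1 p.1 0 ^ 2; ring)
  rw [← integral_mul_neg_timeDeriv hT hG G.2.2]
  refine (inner_familyToLp m d).trans ?_
  refine Eq.trans ?_ (integral_add hi
    ((((m 0).integrable_sq.add (m 1).integrable_sq).add j2).add j3))
  refine integral_congr_ae (Eventually.of_forall fun p => ?_)
  refine (Fin.sum_univ_four _).trans ?_
  change r * G.1 p.1 p.2 * (r⁻¹ * -timeDeriv T G.1 p.1 p.2 + r * G.1 p.1 p.2)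
      + spaceDeriv G.1 p.1 p.2 * spaceDeriv G.1 p.1 p.2 + G.1 p.1 1 * (c₁ p.1 * G.1 p.1 1)
      + G.1 p.1 0 * (c₀ p.1 * G.1 p.1 0)
    = G.1 p.1 p.2 * -timeDeriv T G.1 p.1 p.2 + ((r * G.1 p.1 p.2) ^ 2
      + spaceDeriv G.1 p.1 p.2 ^ 2 + c₁ p.1 * G.1 p.1 1 ^ 2 + c₀ p.1 * G.1 p.1 0 ^ 2)
  field_simp
  ring

theorem norm_sq_jetMap (hT : 0 < T) (r : ℝ) (G : vanishingSpace T hT) :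
    ‖jetMap hT r G‖ ^ 2 = ∫ p, (jet r G.1 0 p ^ 2 + jet r G.1 1 p ^ 2 + jet r G.1 2 p ^ 2
        + jet r G.1 3 p ^ 2) ∂((timeMeasure T).prod unitMeasure) := by
  rw [← real_inner_self_eq_norm_sq]
  refine (inner_familyToLp (memLp_jet r G.2.1) (memLp_jet r G.2.1)).trans ?_
  simp only [Fin.sum_univ_four, sq]

/-- The first two components enter with coefficient 1, hence `κ ≤ 1`; the traces enter with `c₁` and
`c₀`. The initial term is kept because it controls the functional given by the initial datum. -/
theorem coercive_jetMap (hT : 0 < T) {r κ : ℝ} (hr : r ≠ 0) (hκ : κ ≤ 1) {c₀ c₁ : ℝ → ℝ}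
    (h₀ : ContinuousOn c₀ (Icc 0 T)) (h₁ : ContinuousOn c₁ (Icc 0 T))
    (hκ₀ : ∀ t ∈ Icc 0 T, κ ≤ c₀ t) (hκ₁ : ∀ t ∈ Icc 0 T, κ ≤ c₁ t) (G : vanishingSpace T hT) :
    (∫ x, G.1 0 x ^ 2 ∂unitMeasure) / 2 + κ * ‖jetMap hT r G‖ ^ 2
      ≤ inner ℝ (jetMap hT r G) (dualJetMap hT r h₀ h₁ G) := by
  have m := memLp_jet r G.2.1
  obtain ⟨C₀, hC₀⟩ := isCompact_Icc.exists_bound_of_continuousOn h₀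
  obtain ⟨C₁, hC₁⟩ := isCompact_Icc.exists_bound_of_continuousOn h₁
  have hmul : ∀ {c : ℝ → ℝ} {C : ℝ} (j : Fin 4), ContinuousOn c (Icc 0 T) →
      (∀ t ∈ Icc 0 T, ‖c t‖ ≤ C) → Integrable (fun p : ℝ × ℝ => c p.1 * jet r G.1 j p ^ 2)
        ((timeMeasure T).prod unitMeasure) := fun {c C} j hc hC =>
    (m j).integrable_sq.bdd_mul (c := C)
      (memLp_comp_fst (memLp_timeMeasure_of_continuousOn hc)).1
      ((ae_prod_mem_cylinder T).mono fun p hp => hC p.1 hp.1)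
  rw [inner_jetMap_dualJetMap hT hr, norm_sq_jetMap, ← integral_const_mul]
  refine add_le_add le_rfl (integral_mono_ae ?_ ?_ ?_)
  · exact ((((m 0).integrable_sq.add (m 1).integrable_sq).add (m 2).integrable_sq).add
      (m 3).integrable_sq).const_mul κ
  · exact (((m 0).integrable_sq.add (m 1).integrable_sq).add (hmul 2 h₁ hC₁)).add (hmul 3 h₀ hC₀)
  · filter_upwards [ae_prod_mem_cylinder T] with p hp
    have k0 := mul_le_mul_of_nonneg_right hκ (sq_nonneg (jet r G.1 0 p))
    have k1 := mul_le_mul_of_nonneg_right hκ (sq_nonneg (jet r G.1 1 p))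
    have k2 := mul_le_mul_of_nonneg_right (hκ₁ p.1 hp.1) (sq_nonneg (jet r G.1 2 p))
    have k3 := mul_le_mul_of_nonneg_right (hκ₀ p.1 hp.1) (sq_nonneg (jet r G.1 3 p))
    simp only [one_mul] at k0 k1
    linarith

end Lions

/-! ### Structure of limits of jets. -/

section Closure

variable {T : ℝ}

/-- Limits of jets are jets of functions with a generalized space derivative. -/
theorem ae_of_mem_closure_range_jetMap (hT : 0 < T) (r : ℝ)
    {e : PiLp 2 fun _ : Fin 4 => Lp ℝ 2 ((timeMeasure T).prod unitMeasure)}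
    (he : e ∈ (LinearMap.range (jetMap hT r)).topologicalClosure) :
    (∀ᵐ p ∂((timeMeasure T).prod unitMeasure),
      e 0 p = r * (e 3 p + primitive (fun y => e 1 (p.1, y)) p.2)) ∧
    (∀ᵐ p ∂((timeMeasure T).prod unitMeasure), e 2 p = e 3 p + ∫ y, e 1 (p.1, y) ∂unitMeasure) ∧
    ∀ᵐ p ∂((timeMeasure T).prod unitMeasure), e 3 p = ∫ y, e 3 (p.1, y) ∂unitMeasure := by
  obtain ⟨P, hP⟩ := exists_primitiveOp T
  obtain ⟨J, hJ⟩ := exists_averageOp T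
  -- Averaging and primitive are continuous on `L²`, so these relations between components pass from
  -- jets to limits. The last one says that the component for the left trace does not depend on `x`.
  have hclosed : IsClosed {e : PiLp 2 fun _ : Fin 4 => Lp ℝ 2 ((timeMeasure T).prod unitMeasure) |
      e 0 = r • (e 3 + P (e 1)) ∧ e 2 = e 3 + J (e 1) ∧ e 3 = J (e 3)} := by
    refine (isClosed_eq (by fun_prop) (by fun_prop)).inter
      ((isClosed_eq (by fun_prop) (by fun_prop)).inter (isClosed_eq (by fun_prop) (by fun_prop)))
  have hrange : (LinearMap.range (jetMap hT r) : Set (PiLp 2 fun _ : Fin 4 =>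
      Lp ℝ 2 ((timeMeasure T).prod unitMeasure))) ⊆
      {e | e 0 = r • (e 3 + P (e 1)) ∧ e 2 = e 3 + J (e 1) ∧ e 3 = J (e 3)} := by
    rintro _ ⟨G, rfl⟩
    have m := memLp_jet r G.2.1
    have hj : ∀ j, jetMap hT r G j =ᵐ[(timeMeasure T).prod unitMeasure] jet r G.1 j :=
      coeFn_familyToLp _ m
    have hrep := fun (p : ℝ × ℝ) (hp : p ∈ cylinder T) => G.2.1.eq_primitive one_le_two hp.1
    have e1 := ae_slice_eq (hj 1)
    refine ⟨Lp.ext ?_, Lp.ext ?_, Lp.ext ?_⟩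
    · filter_upwards [hj 0, hj 3, e1, hP (jetMap hT r G 1), ae_prod_mem_cylinder T,
        Lp.coeFn_smul r (jetMap hT r G 3 + P (jetMap hT r G 1)),
        Lp.coeFn_add (jetMap hT r G 3) (P (jetMap hT r G 1))] with p k0 k3 k1 kP hp ks ka
      rw [ks, Pi.smul_apply, ka, Pi.add_apply, k0, k3, kP, primitive_congr k1, smul_eq_mul]
      exact congrArg (r * ·) (hrep p hp p.2 hp.2)
    · filter_upwards [hj 2, hj 3, e1, hJ (jetMap hT r G 1), ae_prod_mem_cylinder T,
        Lp.coeFn_add (jetMap hT r G 3) (J (jetMap hT r G 1))] with p k2 k3 k1 kJ hp ka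
      rw [ka, Pi.add_apply, k2, k3, kJ, integral_congr_ae k1]
      have := hrep p hp 1 (right_mem_Icc.2 zero_le_one)
      rwa [primitive_one] at this
    · filter_upwards [hj 3, ae_slice_eq (hj 3), hJ (jetMap hT r G 3)] with p k3 k3' kJ
      rw [kJ, integral_congr_ae k3', k3]
      change G.1 p.1 0 = ∫ _, G.1 p.1 0 ∂unitMeasure
      simp
  obtain ⟨h0, h2, h3⟩ := closure_minimal hrange hclosed he
  refine ⟨?_, ?_, ?_⟩
  · filter_upwards [hP (e 1), Lp.coeFn_smul r (e 3 + P (e 1)), Lp.coeFn_add (e 3) (P (e 1))]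
      with p kP ks ka
    rw [h0, ks, Pi.smul_apply, ka, Pi.add_apply, kP, smul_eq_mul]
  · filter_upwards [hJ (e 1), Lp.coeFn_add (e 3) (J (e 1))] with p kJ ka
    rw [h2, ka, Pi.add_apply, kJ]
  · filter_upwards [hJ (e 3)] with p kJ
    rw [← kJ, ← h3]

end Closure

/-! ### Existence for a Lipschitz nonlinearity. -/

section SemilinearProblem

variable {T : ℝ}

/-- Existence for the parabolic problem with a Lipschitz nonlinearity in the flux. -/
theorem exists_weak_of_lipschitz (hT : 0 < T) {r κ q : ℝ} (hr : 0 < r) (hκ0 : 0 < κ) (hκ : κ ≤ 1)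
    (hq : 0 ≤ q) (hqκ : q < κ) {c₀ c₁ : ℝ → ℝ}
    (h₀ : ContinuousOn c₀ (Icc 0 T)) (h₁ : ContinuousOn c₁ (Icc 0 T))
    (hκ₀ : ∀ t ∈ Icc 0 T, κ ≤ c₀ t) (hκ₁ : ∀ t ∈ Icc 0 T, κ ≤ c₁ t)
    {b : ℝ × ℝ → ℝ → ℝ} (hb : ∀ f : ℝ × ℝ → ℝ, MemLp f 2 ((timeMeasure T).prod unitMeasure) →
      MemLp (fun p => b p (f p)) 2 ((timeMeasure T).prod unitMeasure))
    (hbq : ∀ᵐ p ∂((timeMeasure T).prod unitMeasure), ∀ x y, |b p x - b p y| ≤ q * |x - y|)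
    {F₀ F₁ : ℝ → ℝ} (hF₀ : MemLp F₀ 2 (timeMeasure T)) (hF₁ : MemLp F₁ 2 (timeMeasure T))
    {γ : ℝ → ℝ} (hγ : MemLp γ 2 unitMeasure) :
    ∃ v g : ℝ → ℝ → ℝ,
      MemLp (fun p : ℝ × ℝ => v p.1 p.2) 2 ((timeMeasure T).prod unitMeasure) ∧
      MemLp (fun p : ℝ × ℝ => g p.1 p.2) 2 ((timeMeasure T).prod unitMeasure) ∧
      (∀ t x, v t x = v t 0 + primitive (g t) x) ∧
      ∀ G, IsC T 1 2 G → (∀ x ∈ Icc (0 : ℝ) 1, G T x = 0) →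
        ∫ p : ℝ × ℝ, (v p.1 p.2 * (-timeDeriv T G p.1 p.2 + r ^ 2 * G p.1 p.2)
            + (g p.1 p.2 - b p (r * v p.1 p.2)) * spaceDeriv G p.1 p.2
            + (c₁ p.1 * v p.1 1 - F₁ p.1) * G p.1 1 + (c₀ p.1 * v p.1 0 - F₀ p.1) * G p.1 0)
            ∂((timeMeasure T).prod unitMeasure) = ∫ x, γ x * G 0 x ∂unitMeasure := by
  set Q := (timeMeasure T).prod unitMeasure
  let l : vanishingSpace T hT →ₗ[ℝ] ℝ :=
    { toFun := fun G => ∫ x, γ x * G.1 0 x ∂unitMeasure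
      map_add' := fun G G' => by
        have h0 := left_mem_Icc.2 hT.le
        rw [← integral_add (integrable_mul_of_memLp_two hγ (G.2.1.memLp_slice h0))
          (integrable_mul_of_memLp_two hγ (G'.2.1.memLp_slice h0))]
        exact integral_congr_ae (Eventually.of_forall fun x => mul_add _ _ _)
      map_smul' := fun c G => by
        rw [RingHom.id_apply, smul_eq_mul, ← integral_const_mul]
        exact integral_congr_ae (Eventually.of_forall fun x => mul_left_comm _ c _) }
  -- Only the component paired with `∇G` depends on the unknown, and only through its first
  -- component `r v`; this is why the Lipschitz constant is `q`.
  let n : (PiLp 2 fun _ : Fin 4 => Lp ℝ 2 Q) → Fin 4 → ℝ × ℝ → ℝ := fun e =>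
    ![fun _ => 0, fun p => b p (e 0 p), fun p => F₁ p.1, fun p => F₀ p.1]
  have hn : ∀ e j, MemLp (n e j) 2 Q := fun e j => by
    fin_cases j
    · exact MemLp.zero
    · exact hb _ (Lp.memLp (e 0))
    · exact memLp_comp_fst hF₁
    · exact memLp_comp_fst hF₀
  have hco := coercive_jetMap hT hr.ne' hκ h₀ h₁ hκ₀ hκ₁
  have hnn : ∀ G : vanishingSpace T hT, 0 ≤ ∫ x, G.1 0 x ^ 2 ∂unitMeasure := fun G =>
    integral_nonneg fun x => sq_nonneg _
  obtain ⟨e, heF, he⟩ := exists_inner_eq_of_coercive_of_lipschitz (jetMap hT r)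
    (dualJetMap hT r h₀ h₁) l (C := 2 * ∫ x, γ x ^ 2 ∂unitMeasure) hκ0
    (mul_nonneg zero_le_two (integral_nonneg fun x => sq_nonneg _)) hq hqκ
    (fun G => by linarith [hco G, hnn G])
    (fun G => by
      have hG := G.2.1.memLp_slice (left_mem_Icc.2 hT.le)
      have h1 : l G = inner ℝ (hγ.toLp γ) (hG.toLp (G.1 0)) := (inner_toLp_eq hγ hG).symm
      -- Cauchy-Schwarz; the term `(∫ G_0²) / 2` in the coercivity then gives the constant `2 ∫ γ²`.
      have h2 : l G ^ 2 ≤ (∫ x, γ x ^ 2 ∂unitMeasure) * ∫ x, G.1 0 x ^ 2 ∂unitMeasure := by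
        rw [h1, ← norm_sq_toLp_eq hγ, ← norm_sq_toLp_eq hG, ← mul_pow, ← sq_abs]
        exact pow_le_pow_left₀ (abs_nonneg _) (abs_real_inner_le_norm _ _) 2
      have h3 : (∫ x, G.1 0 x ^ 2 ∂unitMeasure)
          ≤ 2 * inner ℝ (jetMap hT r G) (dualJetMap hT r h₀ h₁ G) := by
        linarith [hco G, mul_nonneg hκ0.le (sq_nonneg ‖jetMap hT r G‖)]
      have h4 := mul_le_mul_of_nonneg_left h3
        (integral_nonneg fun x => sq_nonneg _ : (0 : ℝ) ≤ ∫ x, γ x ^ 2 ∂unitMeasure)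
      linarith)
    (fun e => familyToLp (n e) (hn e))
    (fun e e' => by
      have hle : ‖(hn e 1).toLp (n e 1) - (hn e' 1).toLp (n e' 1)‖ ≤ q * ‖e 0 - e' 0‖ := by
        refine Lp.norm_le_mul_norm_of_ae_le_mul ?_
        filter_upwards [Lp.coeFn_sub ((hn e 1).toLp (n e 1)) ((hn e' 1).toLp (n e' 1)),
          Lp.coeFn_sub (e 0) (e' 0), (hn e 1).coeFn_toLp, (hn e' 1).coeFn_toLp, hbq]
          with p k1 k2 k3 k4 k5
        rw [k1, k2, Pi.sub_apply, Pi.sub_apply, k3, k4]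
        exact k5 _ _
      have h0 : ‖e 0 - e' 0‖ ≤ ‖e - e'‖ := PiLp.norm_apply_le (e - e') 0
      refine le_trans (le_of_eq ?_) (hle.trans (mul_le_mul_of_nonneg_left h0 hq))
      rw [PiLp.norm_eq_of_L2, Fin.sum_univ_four]
      change √(‖(hn e 0).toLp (n e 0) - (hn e' 0).toLp (n e' 0)‖ ^ 2
        + ‖(hn e 1).toLp (n e 1) - (hn e' 1).toLp (n e' 1)‖ ^ 2
        + ‖(hn e 2).toLp (n e 2) - (hn e' 2).toLp (n e' 2)‖ ^ 2
        + ‖(hn e 3).toLp (n e 3) - (hn e' 3).toLp (n e' 3)‖ ^ 2) = _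
      have z0 : (hn e 0).toLp (n e 0) - (hn e' 0).toLp (n e' 0) = 0 := sub_self _
      have z2 : (hn e 2).toLp (n e 2) - (hn e' 2).toLp (n e' 2) = 0 := sub_self _
      have z3 : (hn e 3).toLp (n e 3) - (hn e' 3).toLp (n e' 3) = 0 := sub_self _
      rw [z0, z2, z3, norm_zero]
      simp)
  obtain ⟨r0, r2, r3⟩ := ae_of_mem_closure_range_jetMap hT r heF
  let g : ℝ → ℝ → ℝ := fun t y => e 1 (t, y)
  -- Averaging the left trace over `x` and adding a primitive selects a representative with the
  -- required identity at all points, so its traces have pointwise meaning.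
  let v : ℝ → ℝ → ℝ := fun t x => (∫ y, e 3 (t, y) ∂unitMeasure) + primitive (g t) x
  have hg : MemLp (fun p : ℝ × ℝ => g p.1 p.2) 2 Q := Lp.memLp (e 1)
  have hv0 : ∀ t, v t 0 = ∫ y, e 3 (t, y) ∂unitMeasure := fun t => by
    simp only [v, primitive_zero, add_zero]
  have hv : MemLp (fun p : ℝ × ℝ => v p.1 p.2) 2 Q :=
    (memLp_comp_fst (memLp_integral_unitMeasure (F := fun t y => e 3 (t, y)) (Lp.memLp (e 3))).1).add
      (memLp_primitive hg).1
  refine ⟨v, g, hv, hg, fun t x => by rw [hv0], fun G hG hGT => ?_⟩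
  have key := he ⟨G, hG, hGT⟩
  have hd := memLp_dualJet r h₀ h₁ hG
  have hj := memLp_jet r hG
  rw [← familyToLp_coeFn e] at key
  have k1 := (inner_familyToLp (fun j => Lp.memLp (e j)) hd).symm.trans key
  rw [familyToLp_coeFn e] at k1
  have k2 := k1.trans (congrArg (l ⟨G, hG, hGT⟩ + ·) (inner_familyToLp (hn e) hj))
  have i1 : Integrable (fun p => ∑ j, e j p * dualJet T r c₀ c₁ G j p) Q :=
    integrable_finsetSum _ fun j _ => integrable_mul_of_memLp_two (Lp.memLp (e j)) (hd j)
  have i2 : Integrable (fun p => ∑ j, n e j p * jet r G j p) Q :=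
    integrable_finsetSum _ fun j _ => integrable_mul_of_memLp_two (hn e j) (hj j)
  have k3 := sub_eq_iff_eq_add.2 k2
  rw [← integral_sub i1 i2] at k3
  refine Eq.trans (integral_congr_ae ?_) k3
  filter_upwards [r0, r2, r3] with p h0 h2 h3
  have hv3 : e 3 p = v p.1 0 := by rw [hv0, ← h3]
  have hv2 : e 2 p = v p.1 1 := by rw [h2, hv3, hv0]; simp only [v, primitive_one, g]
  have hv1 : e 0 p = r * v p.1 p.2 := by rw [h0, hv3, hv0]
  rw [Fin.sum_univ_four, Fin.sum_univ_four]
  change _ = e 0 p * (r⁻¹ * -timeDeriv T G p.1 p.2 + r * G p.1 p.2)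
      + e 1 p * spaceDeriv G p.1 p.2 + e 2 p * (c₁ p.1 * G p.1 1) + e 3 p * (c₀ p.1 * G p.1 0)
    - (0 * (r * G p.1 p.2) + b p (e 0 p) * spaceDeriv G p.1 p.2 + F₁ p.1 * G p.1 1
      + F₀ p.1 * G p.1 0)
  rw [hv1, hv2, hv3]
  change v p.1 p.2 * _ + (e 1 p - _) * _ + _ + _ = _
  field_simp
  ring

end SemilinearProblem

/-! ### Existence for the original problem. -/

section Existence

variable {α β A B T : ℝ} {H u f : ℝ → ℝ → ℝ} {γ q₀ q₁ : ℝ → ℝ}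

theorem integral_weakRate (hT : 0 < T)
    (hu : MemLp (fun p : ℝ × ℝ => u p.1 p.2) 2 ((timeMeasure T).prod unitMeasure))
    (hf : MemLp (fun p : ℝ × ℝ => f p.1 p.2) 2 ((timeMeasure T).prod unitMeasure))
    (hq₀ : MemLp q₀ 2 (timeMeasure T)) (hq₁ : MemLp q₁ 2 (timeMeasure T))
    {G : ℝ → ℝ → ℝ} (hG : IsC T 1 2 G) :
    ∫ s in (0 : ℝ)..T, weakRate T u f q₀ q₁ G s
      = ∫ p : ℝ × ℝ, (u p.1 p.2 * timeDeriv T G p.1 p.2 - f p.1 p.2 * spaceDeriv G p.1 p.2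
        + (q₁ p.1 * G p.1 1 + q₀ p.1 * G p.1 0)) ∂((timeMeasure T).prod unitMeasure) := by
  have i1 := integrable_mul_timeDeriv hu hG
  have i2 := integrable_mul_spaceDeriv hf hG
  have i3 : Integrable (fun p : ℝ × ℝ => q₁ p.1 * G p.1 1 + q₀ p.1 * G p.1 0)
      ((timeMeasure T).prod unitMeasure) := (integrable_boundary hq₀ hq₁ hG).comp_fst unitMeasure
  rw [← integral_timeMeasure hT.le]
  refine Eq.trans ?_ (integral_prod _ ((i1.sub i2).add i3)).symm
  refine integral_congr_ae ?_
  filter_upwards [i1.prod_right_ae, i2.prod_right_ae] with s h1 h2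
  refine Eq.trans ?_ (integral_add (h1.sub h2)
    (integrable_const (q₁ s * G s 1 + q₀ s * G s 0))).symm
  refine Eq.trans ?_ (congrArg (· + _) (integral_sub h1 h2).symm)
  simp [weakRate]

/-- The rate is at least `D⁻¹ min ϱ (1 - ϱ) (e^M + e^{-M})`, and the last factor is at least 2 for
every `M`. -/
theorem exists_pos_le_boundaryRate {ϱ D : ℝ} (h0 : 0 < ϱ) (h1 : ϱ < 1) (hD : 0 < D) :
    ∃ κ, 0 < κ ∧ ∀ M, κ ≤ boundaryRate ϱ D M := by
  refine ⟨D⁻¹ * min ϱ (1 - ϱ), mul_pos (inv_pos.2 hD) (lt_min h0 (by linarith)), fun M => ?_⟩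
  refine mul_le_mul_of_nonneg_left ?_ (inv_pos.2 hD).le
  have e1 := Real.add_one_le_exp M
  have e2 := Real.add_one_le_exp (-M)
  have hm : 0 < min ϱ (1 - ϱ) := lt_min h0 (by linarith)
  have k1 := mul_le_mul_of_nonneg_right (min_le_left ϱ (1 - ϱ)) (Real.exp_pos M).le
  have k2 := mul_le_mul_of_nonneg_right (min_le_right ϱ (1 - ϱ)) (Real.exp_pos (-M)).le
  nlinarith

theorem memLp_continuous_time_mul {k : ℝ → ℝ} (hk : Continuous k) {F : ℝ × ℝ → ℝ}
    (hF : MemLp F 2 ((timeMeasure T).prod unitMeasure)) :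
    MemLp (fun p : ℝ × ℝ => k p.1 * F p) 2 ((timeMeasure T).prod unitMeasure) := by
  obtain ⟨C, hC⟩ := isCompact_Icc.exists_bound_of_continuousOn (hk.continuousOn (s := Icc 0 T))
  refine hF.of_le_mul (c := C)
    (AEStronglyMeasurable.mul (hk.comp continuous_fst).aestronglyMeasurable hF.1) ?_
  filter_upwards [ae_prod_mem_cylinder T] with p hp
  rw [norm_mul]
  exact mul_le_mul_of_nonneg_right (hC p.1 hp.1) (norm_nonneg _)

theorem primitive_const_mul (c : ℝ) (g : ℝ → ℝ) (x : ℝ) :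
    primitive (fun y => c * g y) x = c * primitive g x := by
  simp only [primitive, mul_left_comm _ c]
  exact integral_const_mul c _

theorem exists_isWeakSolution (hα : 0 < α) (hα1 : α < 1) (hβ0 : 0 < β) (hβ : β < 1)
    (hA : 0 < A) (hB : 0 < B) (hT : 0 < T) (hH : IsC T 0 1 H)
    (hγ : ∀ x ∈ Icc (0 : ℝ) 1, γ x ∈ Icc (0 : ℝ) 1) (hγm : MemLp γ 2 unitMeasure) :
    ∃ u, IsWeakSolution α β A B T H γ u := by
  obtain ⟨κ₀, hκ₀, hc₀⟩ := exists_pos_le_boundaryRate hα hα1 hA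
  obtain ⟨κ₁, hκ₁, hc₁⟩ := exists_pos_le_boundaryRate hβ0 hβ hB
  obtain ⟨C, hC0, hC⟩ := exists_bound_of_continuousOn_cylinder (hH.continuousOn_spaceDeriv le_rfl)
  set κ := min 1 (min κ₀ κ₁)
  have hκ : 0 < κ := lt_min one_pos (lt_min hκ₀ hκ₁)
  have hκ1 : κ ≤ 1 := min_le_left _ _
  have hκκ₀ : κ ≤ κ₀ := (min_le_right _ _).trans (min_le_left _ _)
  have hκκ₁ : κ ≤ κ₁ := (min_le_right _ _).trans (min_le_right _ _)
  -- Large enough for the drift's Lipschitz constant `2C / r` to be below the coercivity constant.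
  set r := 2 * C / κ + 1
  have hr : 0 < r := by positivity
  have hqκ : 2 * C / r < κ := by
    rw [div_lt_iff₀ hr, mul_add, mul_one, mul_div_cancel₀ _ hκ.ne']
    linarith
  have hH0 := continuousOn_slice_right hH.continuousOn (left_mem_Icc.2 zero_le_one)
  have hH1 := continuousOn_slice_right hH.continuousOn (right_mem_Icc.2 zero_le_one)
  simp only at hH0 hH1
  have hH' := memLp_of_continuousOn_cylinder (hH.continuousOn_spaceDeriv le_rfl)
  -- The substitution `u = E v` creates the zero-order term `r² v` of the linear problem.
  let E : ℝ → ℝ := fun t => Real.exp (r ^ 2 * t)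
  have hE : Continuous E := by fun_prop
  have hE0 : ∀ t, E t ≠ 0 := fun t => (Real.exp_pos _).ne'
  have hEs : ContDiff ℝ ∞ E := by fun_prop
  have hEd : ∀ t, deriv E t = r ^ 2 * E t := fun t => by
    have := ((hasDerivAt_id t).const_mul (r ^ 2)).exp.deriv
    simp only [id, mul_one] at this
    rw [mul_comm]; exact this
  have hEinv : Continuous fun t => (E t)⁻¹ := hE.inv₀ hE0
  -- At `x = r v` the argument of the mobility is `E v = u`. The factors `E⁻¹` and `E` cancel in the
  -- Lipschitz estimate, leaving `2C / r`.
  let b : ℝ × ℝ → ℝ → ℝ := fun p x =>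
    (E p.1)⁻¹ * (2 * truncMobility (E p.1 * x / r) * spaceDeriv H p.1 p.2)
  obtain ⟨v, g, hv, hg, hrep, key⟩ := exists_weak_of_lipschitz hT hr hκ hκ1
    (q := 2 * C / r) (by positivity) hqκ (c₀ := fun t => boundaryRate α A (H t 0))
    (c₁ := fun t => boundaryRate β B (H t 1)) (continuousOn_boundaryRate hH0)
    (continuousOn_boundaryRate hH1) (fun t _ => hκκ₀.trans (hc₀ _))
    (fun t _ => hκκ₁.trans (hc₁ _)) (b := b)
    (fun f hf => by
      refine memLp_continuous_time_mul (k := fun t => (E t)⁻¹) hEinv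
        (hH'.of_le_mul (c := 2) ?_ (Eventually.of_forall fun p => ?_))
      · refine ((continuous_truncMobility.comp_aestronglyMeasurable ?_).const_mul 2).mul hH'.1
        simp_rw [div_eq_mul_inv]
        exact (memLp_continuous_time_mul hE hf).1.mul_const _
      · rw [norm_mul, norm_mul, Real.norm_ofNat]
        refine mul_le_mul_of_nonneg_right ?_ (norm_nonneg _)
        exact mul_le_of_le_one_right zero_le_two (abs_truncMobility_le _))
    (by
      filter_upwards [ae_prod_mem_cylinder T] with p hp x y
      have hEp : 0 < E p.1 := Real.exp_pos _
      have h1 := abs_truncMobility_sub_le (E p.1 * x / r) (E p.1 * y / r)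
      have h2 : |E p.1 * x / r - E p.1 * y / r| = E p.1 / r * |x - y| := by
        rw [← abs_of_pos (div_pos hEp hr), ← abs_mul]
        congr 1
        ring
      rw [h2] at h1
      have h3 : b p x - b p y = (E p.1)⁻¹ * 2 *
          ((truncMobility (E p.1 * x / r) - truncMobility (E p.1 * y / r))
            * spaceDeriv H p.1 p.2) := by simp only [b]; ring
      rw [h3, abs_mul, abs_mul (_ - _), abs_of_pos (by positivity : 0 < (E p.1)⁻¹ * 2)]
      have h4 := mul_le_mul h1 (hC p hp) (abs_nonneg _) (by positivity)
      refine (mul_le_mul_of_nonneg_left h4 (by positivity)).trans_eq ?_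
      field_simp)
    (F₀ := fun t => (E t)⁻¹ * (A⁻¹ * α * Real.exp (H t 0)))
    (F₁ := fun t => (E t)⁻¹ * (B⁻¹ * β * Real.exp (H t 1)))
    (memLp_timeMeasure_of_continuousOn (hEinv.continuousOn.mul (by fun_prop)))
    (memLp_timeMeasure_of_continuousOn (hEinv.continuousOn.mul (by fun_prop))) hγm
  let w : ℝ → ℝ → ℝ := fun t x => E t * v t x
  let k : ℝ → ℝ → ℝ := fun t x => E t * g t x
  have hw : MemLp (fun p : ℝ × ℝ => w p.1 p.2) 2 ((timeMeasure T).prod unitMeasure) :=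
    memLp_continuous_time_mul hE hv
  have hk : MemLp (fun p : ℝ × ℝ => k p.1 p.2) 2 ((timeMeasure T).prod unitMeasure) :=
    memLp_continuous_time_mul hE hg
  have hwk : ∀ᵐ t ∂timeMeasure T, ∀ x ∈ Icc (0 : ℝ) 1, w t x = w t 0 + primitive (k t) x :=
    Eventually.of_forall fun t x _ => by
      simp only [w, k, primitive_const_mul]
      rw [hrep t x, mul_add]
  refine exists_isWeakSolution_of_truncated hα hα1 hβ0 hβ hA hB hT hH hγ hγm hw hk hwk
    fun G hG hGT => ?_
  rw [integral_weakRate hT hw (memLp_truncFlux hH hw hk)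
    (memLp_boundaryFlux (memLp_trace_zero hw hk hwk) hH0)
    (memLp_boundaryFlux (memLp_trace_one hw hk hwk) hH1) hG]
  -- Testing with `E G`: the derivative of `E` cancels the term `r² v`, and the remaining factor `E`
  -- turns `v` and `g` into `w` and `k`.
  have h1 := key _ (hG.mul_time hT hEs) fun x hx => by rw [hGT x hx, mul_zero]
  have h2 : ∫ x, γ x * (E 0 * G 0 x) ∂unitMeasure = ∫ x, γ x * G 0 x ∂unitMeasure := by
    simp [E]
  rw [← h2, ← h1, ← integral_neg]
  refine integral_congr_ae ?_
  filter_upwards [ae_prod_mem_cylinder T] with p hp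
  rw [timeDeriv_mul_time hG hEs hT hp.1 hp.2, spaceDeriv_mul_time hG E hp.1 hp.2, hEd]
  have hEp := hE0 p.1
  have h3 : E p.1 * (r * v p.1 p.2) / r = w p.1 p.2 := by
    simp only [w]; field_simp
  simp only [b, h3, boundaryFlux_eq, truncFlux]
  simp only [w, k]
  field_simp
  ring

end Existence

end RobinWASEP

end

theorem theoremB5 (α β A B T : ℝ) (hα : 0 < α) (hαβ : α ≤ β) (hβ : β < 1)
    (hA : 0 < A) (hB : 0 < B) (hT : 0 < T)
    (γ : ℝ → ℝ) (hγm : AEMeasurable γ (volume.restrict (Icc 0 1)))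
    (hγ : ∀ x ∈ Icc (0 : ℝ) 1, γ x ∈ Icc (0 : ℝ) 1)
    (H : ℝ → ℝ → ℝ) (hH : RobinWASEP.IsC T 0 1 H) :
    (∃ u : ℝ → ℝ → ℝ, RobinWASEP.IsWeakSolution α β A B T H γ u) ∧
    (∀ u v : ℝ → ℝ → ℝ,
      RobinWASEP.IsWeakSolution α β A B T H γ u →
      RobinWASEP.IsWeakSolution α β A B T H γ v →
      ∀ t ∈ Ioc 0 T, ∀ᵐ x ∂(volume.restrict (Icc (0 : ℝ) 1)), u t x = v t x) := by
  have hα1 : α < 1 := hαβ.trans_lt hβ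
  have hβ0 : 0 < β := hα.trans_le hαβ
  have hγ2 := RobinWASEP.memLp_of_forall_mem_Icc hγm hγ
  exact ⟨RobinWASEP.exists_isWeakSolution hα hα1 hβ0 hβ hA hB hT hH hγ hγ2,
    fun _ _ hu hv => hu.ae_eq_at hα hα1 hβ0 hβ hA hB hT hH hγ2 hv⟩
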